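/- For every $n\ge 1$ let $\mathbf X_1,\dots,\mathbf X_n$ be i.i.d. random vectors in $\mathbb R^{p}$, $p=p(n)\ge 1$, with mean $\mu=(\mu_1,\dots,\mu_p)^T$ and covariance matrix $\Sigma=(\sigma_{ij})_{1\le i,j\le p}$; the dimension and the distribution may depend on $n$. Put $N=\lfloor n/2\rfloor$, $q=p^2$, and let $\mathbf 1_m=(1,\dots,1)^T\in\mathbb R^m$. Put $\mathbf Y_i=(\mathbf X_i-\mu)(\mathbf X_i-\mu)^T$ and let $\Theta$ be the $q\times q$ covariance matrix of $\mathbf Y_1$ written as a $q$-dimensional vector. For a $p\times p$ matrix $S$ and $1\le i\le N$ let $R_i(S)=(e_i(S),v_i(S))^T$ with $$e_i(S)=\operatorname{tr}\bigl((\mathbf Y_i-S)(\mathbf Y_{i+N}-S)\bigr),\qquad v_i(S)=\mathbf 1_p^T(\mathbf Y_i+\mathbf Y_{i+N}-2S)\mathbf 1_p .$$ Let $\overline{\mathbf X}{}^1=\frac1N\sum_{i=1}^N\mathbf X_i$, $\overline{\mathbf X}{}^2=\frac1N\sum_{i=N+1}^{2N}\mathbf X_i$, and for $1\le i\le N$ let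 $\mathbf Y_i^*=(\mathbf X_i-\overline{\mathbf X}{}^1)(\mathbf X_i-\overline{\mathbf X}{}^1)^T$, $\mathbf Y_{N+i}^*=(\mathbf X_{N+i}-\overline{\mathbf X}{}^2)(\mathbf X_{N+i}-\overline{\mathbf X}{}^2)^T$. Let $R_i^*(S)=(e_i^*(S),v_i^*(S))^T$ with $$e_i^*(S)=\operatorname{tr}\Bigl(\bigl(\mathbf Y^*_i-\tfrac{N-1}{N}S\bigr)\bigl(\mathbf Y^*_{i+N}-\tfrac{N-1}{N}S\bigr)\Bigr),\qquad v_i^*(S)=\mathbf 1_p^T\bigl(\mathbf Y_i^*+\mathbf Y_{i+N}^*-\tfrac{2(N-1)}{N}S\bigr)\mathbf 1_p .$$ Define the empirical likelihood ratio functions $$L_1(S)=\sup\Bigl\{\prod_{i=1}^N(Np_i):\ p_1,\dots,p_N\ge 0,\ \sum_{i=1}^Np_i=1,\ \sum_{i=1}^Np_iR_i(S)=0\Bigr\},$$ and $L_2(S)$ in the same way with $R_i^*(S)$ in place of $R_i(S)$, where $\sup\emptyset=0$ and $-2\log 0=+\infty$. Assume that, for some $\delta>0$, A1: $\liminf_{n\to\infty}\frac1q\operatorname{tr}(\Theta^2)>0$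 and $\liminf_{n\to\infty}\frac1q\mathbf 1_q^T\Theta\mathbf 1_q>0$; A2: $\frac1{p^2}\sum_{i=1}^p\sum_{j=1}^p\mathrm E\bigl|(X_{1,i}-\mu_i)(X_{1,j}-\mu_j)-\sigma_{ij}\bigr|^{2+\delta}=O(1)$; A3: $p=o\bigl(n^{(\delta+\min(2,\delta))/(4(2+\delta))}\bigr)$. Let $\Sigma_0=\Sigma_0(n)$ be given $p\times p$ matrices. Then, under $H_0:\Sigma=\Sigma_0$ (for every $n$), $-2\log L_1(\Sigma_0)$ converges in distribution to a chi-square distribution with two degrees of freedom as $n\to\infty$. If, further, there is a constant $C_0>0$, independent of $n$, with $\max_{1\le i\le p}\sigma_{ii}<C_0$, then $-2\log L_2(\Sigma_0)$ also converges in distribution to a chi-square distribution with two degrees of freedom as $n\to\infty$. -/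

import Mathlib

open MeasureTheory ProbabilityTheory Filter Asymptotics
open scoped Topology ENNReal

namespace CovTest

noncomputable section

/-- The chi-square distribution with `k` degrees of freedom: the law of the sum of the squares of
`k` independent standard normal random variables. -/
def chiSquared (k : ℕ) : Measure ℝ :=
  (Measure.pi fun _ : Fin k => gaussianReal 0 1).map fun z => ∑ i, z i ^ 2

instance chiSquared.isProbabilityMeasure (k : ℕ) : IsProbabilityMeasure (chiSquared k) :=
  Measure.isProbabilityMeasure_map
    (Finset.measurable_sum _ fun i _ => (measurable_pi_apply i).pow_const 2).aemeasurable

section Population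

variable {p : ℕ}

/-- Mean vector of a law `ν` on `ℝ^p`. -/
def meanVec (ν : Measure (Fin p → ℝ)) : Fin p → ℝ :=
  fun a => ∫ x, x a ∂ν

/-- Covariance matrix `Σ = (σ_ab)` of a law `ν` on `ℝ^p`. -/
def covMat (ν : Measure (Fin p → ℝ)) : Matrix (Fin p) (Fin p) ℝ :=
  Matrix.of fun a b => covariance (fun x => x a) (fun x => x b) ν

/-- The matrix `(x - m)(x - m)ᵀ`. -/
def outer (m x : Fin p → ℝ) : Matrix (Fin p) (Fin p) ℝ :=
  Matrix.vecMulVec (x - m) (x - m)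

/-- The `p² × p²` covariance matrix `Θ` of the matrix `(X - μ)(X - μ)ᵀ`, regarded as a vector
indexed by pairs, where `X` has law `ν` and `μ` is the mean of `ν`. -/
def prodCovMat (ν : Measure (Fin p → ℝ)) : Matrix (Fin p × Fin p) (Fin p × Fin p) ℝ :=
  Matrix.of fun s t =>
    covariance (fun x => outer (meanVec ν) x s.1 s.2) (fun x => outer (meanVec ν) x t.1 t.2) ν

/-- `E |(X_a - μ_a)(X_b - μ_b) - σ_ab|^r`, as an element of `[0, ∞]`. -/
def prodAbsMoment (ν : Measure (Fin p → ℝ)) (r : ℝ) (a b : Fin p) : ℝ≥0∞ :=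
  ∫⁻ x, ENNReal.ofReal (|outer (meanVec ν) x a b - covMat ν a b| ^ r) ∂ν

end Population

/-- The quadratic form `1ᵀ A 1`. -/
def onesForm {ι : Type*} [Fintype ι] (A : Matrix ι ι ℝ) : ℝ :=
  (1 : ι → ℝ) ⬝ᵥ (A.mulVec 1)

/-- The empirical likelihood ratio of `R_1, …, R_N` in the plane:
the supremum of `∏ (N w_i)` over probability weights `w` with `∑ w_i R_i = 0`
(it is `0` if there are no such weights). -/
def elRatio {N : ℕ} (R : Fin N → ℝ × ℝ) : ℝ :=
  sSup {L : ℝ | ∃ w : Fin N → ℝ, (∀ i, 0 ≤ w i) ∧ ∑ i, w i = 1 ∧ ∑ i, w i • R i = 0 ∧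
    L = ∏ i, (N : ℝ) * w i}

/-- `-2 log L` for `L ≥ 0`, with the value `+∞` at `L = 0`. -/
def negTwoLog (L : ℝ) : EReal :=
  if L = 0 then ⊤ else ((-2 * Real.log L : ℝ) : EReal)

section Sample

variable {n p : ℕ}

/-- The index of the `i`-th observation of the first half, of size `N = ⌊n/2⌋`. -/
def idx₁ (i : Fin (n / 2)) : Fin n := ⟨i, by omega⟩

/-- The index `i + N` of the `i`-th observation of the second half, where `N = ⌊n/2⌋`. -/
def idx₂ (i : Fin (n / 2)) : Fin n := ⟨i + n / 2, by omega⟩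

/-- `R_i(S) = (e_i(S), v_i(S))`, computed with the known mean `m`, where
`e_i(S) = tr((Y_i - S)(Y_{i+N} - S))` and `v_i(S) = 1ᵀ(Y_i + Y_{i+N} - 2S)1`
with `Y_i = (x_i - m)(x_i - m)ᵀ`. -/
def R₁ (m : Fin p → ℝ) (S : Matrix (Fin p) (Fin p) ℝ) (x : Fin n → Fin p → ℝ)
    (i : Fin (n / 2)) : ℝ × ℝ :=
  (((outer m (x (idx₁ i)) - S) * (outer m (x (idx₂ i)) - S)).trace,
    onesForm (outer m (x (idx₁ i)) + outer m (x (idx₂ i)) - (2 : ℝ) • S))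

/-- The empirical likelihood ratio function `L_1(S)` for known mean `m`. -/
def L₁ (m : Fin p → ℝ) (S : Matrix (Fin p) (Fin p) ℝ) (x : Fin n → Fin p → ℝ) : ℝ :=
  elRatio (R₁ m S x)

/-- Sample mean of the first half of the sample. -/
def xbar₁ (x : Fin n → Fin p → ℝ) : Fin p → ℝ :=
  ((n / 2 : ℕ) : ℝ)⁻¹ • ∑ i : Fin (n / 2), x (idx₁ i)

/-- Sample mean of the second half of the sample. -/
def xbar₂ (x : Fin n → Fin p → ℝ) : Fin p → ℝ :=
  ((n / 2 : ℕ) : ℝ)⁻¹ • ∑ i : Fin (n / 2), x (idx₂ i)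

/-- The matrix `((N - 1) / N) S` with `N = ⌊n/2⌋`. -/
def shrink (n : ℕ) (S : Matrix (Fin p) (Fin p) ℝ) : Matrix (Fin p) (Fin p) ℝ :=
  ((((n / 2 : ℕ) : ℝ) - 1) / ((n / 2 : ℕ) : ℝ)) • S

/-- `R*_i(S) = (e*_i(S), v*_i(S))`: the mean is replaced by the sample mean in each half, and
`S` by `((N - 1) / N) S`. -/
def R₂ (S : Matrix (Fin p) (Fin p) ℝ) (x : Fin n → Fin p → ℝ) (i : Fin (n / 2)) : ℝ × ℝ :=
  (((outer (xbar₁ x) (x (idx₁ i)) - shrink n S) *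
      (outer (xbar₂ x) (x (idx₂ i)) - shrink n S)).trace,
    onesForm (outer (xbar₁ x) (x (idx₁ i)) + outer (xbar₂ x) (x (idx₂ i)) -
      (2 : ℝ) • shrink n S))

/-- The empirical likelihood ratio function `L_2(S)` for unknown mean. -/
def L₂ (S : Matrix (Fin p) (Fin p) ℝ) (x : Fin n → Fin p → ℝ) : ℝ :=
  elRatio (R₂ S x)

end Sample

end

end CovTest

namespace CovTest

/-! ### Empirical likelihood of a planar sample: deterministic bounds and measurability. -/

section EmpiricalLikelihood

/-! Write Z_i for the matrix Y_i − Σ regarded as a vector with p² coordinates. Under the null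
hypothesis e_i = ⟪Z_i, Z_{i+N}⟫ and v_i = ⟪1, Z_i⟫ + ⟪1, Z_{i+N}⟫. These are centred and
uncorrelated, with variances tr Θ² and 2·1ᵀΘ1, both at least of order p² by A1. Empirical likelihood
is invariant under rescaling of each coordinate (`elRatio_scale`), so both may be standardised. It
then remains to show that −2 log of the ratio is close to N|R̄|² and that N|R̄|² tends to
chi-square.

The quadratic approximation (`abs_neg_two_log_elRatio_sub_le`) needs no analysis of the optimal
Lagrange multiplier. For an upper bound on the ratio, any multiplier λ will do: feasible weights
satisfy ∏ N w_i (1 + λ·R_i) ≤ 1, and λ = R̄ is good enough. For a lower bound any feasible weights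
will do: those proportional to 1 + β·(R_i − R̄) are feasible once β solves a 2 × 2 linear system. If
the empirical second moments are near the identity and max |R_i| is o(√N), both bounds are
exp(−N|R̄|²/2) up to a factor 1 + o(1) in the exponent.

The probabilistic input is Lyapunov's condition of order 2 + d with d = min(2, δ). By Cauchy–Schwarz
and independence E|e_i|^(2+d) ≤ (E‖Z‖^(2+d))², which A2 bounds by a multiple of p^(2(2+d)); after
standardisation p^(2+d) is left. A3 says exactly that p^(2+d) = o(n^(d/2)). Lyapunov's condition
yields the central limit theorem for every projection (hence for the plane), the law of large
numbers for squares, and the bound on the maximum; `IsStandardArray.tendsto_negTwoLog_elRatio`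
combines them.

For an unknown mean, Z_i becomes Z_i − D_i, where D_i is of rank-two type plus Σ/N and has joint
size O(p) in expectation (`isSmallPerturbation_recentering`). The two halves are independent, so
conditionally on one half the cross terms ⟪Z_i, D_{i+N}⟫ are independent and centred, and their
variances add. The accumulated error is O(p²), hence O(p/√N) after division by p√N, and this tends
to 0. The known-mean statement is the case D = 0 of the same theorem. -/

/-- The Taylor remainder |u|³ / (1 − |u|) is absorbed into the quadratic term: |u| ≤ θ and 1 − |u| ≥
1/2 make it at most 2θu². -/
theorem sub_sq_le_log_one_add {u θ : ℝ} (hθ : θ ≤ 1 / 2) (hu : |u| ≤ θ) :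
    u - (1 / 2 + 2 * θ) * u ^ 2 ≤ Real.log (1 + u) := by
  have h1 : |(-u)| < 1 := by rw [abs_neg]; linarith
  have h := Real.abs_log_sub_add_sum_range_le h1 2
  simp only [Finset.sum_range_succ, Finset.sum_range_zero, abs_neg, sub_neg_eq_add] at h
  have h2 : |u| ^ 3 / (1 - |u|) ≤ 2 * θ * u ^ 2 := by
    rw [div_le_iff₀ (by linarith)]
    have : |u| ^ 3 = |u| * u ^ 2 := by rw [pow_succ', sq_abs]
    rw [this]
    have h3 : |u| ≤ 2 * θ * (1 - |u|) := by nlinarith [abs_nonneg u]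
    nlinarith [sq_nonneg u]
  have h3 := (abs_le.1 (h.trans h2)).1
  norm_num at h3
  linarith

theorem exp_sum_le_prod_one_add {ι : Type*} (s : Finset ι) {u : ι → ℝ} {θ : ℝ} (hθ : θ ≤ 1 / 2)
    (hu : ∀ i, |u i| ≤ θ) :
    Real.exp (∑ i ∈ s, (u i - (1 / 2 + 2 * θ) * u i ^ 2)) ≤ ∏ i ∈ s, (1 + u i) := by
  rw [Real.exp_sum]
  refine Finset.prod_le_prod (fun i _ => (Real.exp_pos _).le) fun i _ => ?_
  have hpos : 0 < 1 + u i := by linarith [(abs_le.1 (hu i)).1]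
  rw [← Real.le_log_iff_exp_le hpos]
  exact sub_sq_le_log_one_add hθ (hu i)

variable {N : ℕ}

theorem prod_le_one_of_sum_sub_one_eq_zero {x : Fin N → ℝ} (hx : ∀ i, 0 ≤ x i)
    (h : ∑ i, (x i - 1) = 0) : ∏ i, x i ≤ 1 := by
  calc ∏ i, x i ≤ ∏ i, Real.exp (x i - 1) :=
        Finset.prod_le_prod (fun i _ => hx i) fun i _ => by
          linarith [Real.add_one_le_exp (x i - 1)]
    _ = 1 := by rw [← Real.exp_sum, h, Real.exp_zero]

theorem sum_fst_snd_eq_zero {R : Fin N → ℝ × ℝ} {w : Fin N → ℝ} :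
    ∑ i, w i • R i = 0 ↔ ∑ i, w i * (R i).1 = 0 ∧ ∑ i, w i * (R i).2 = 0 := by
  rw [Prod.ext_iff, Prod.fst_sum, Prod.snd_sum]
  simp

/-- Weak duality: for feasible w the numbers N w_i (1 + λ·R_i) have mean 1, so their product is at
most 1. Every multiplier λ = (l₁, l₂) therefore gives an upper bound, optimal or not. -/
theorem prod_mul_le_exp {R : Fin N → ℝ × ℝ} {w : Fin N → ℝ} (hw : ∀ i, 0 ≤ w i)
    (hw1 : ∑ i, w i = 1) (hwR : ∑ i, w i • R i = 0) (l₁ l₂ : ℝ) {θ : ℝ} (hθ : θ ≤ 1 / 2)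
    (hu : ∀ i, |l₁ * (R i).1 + l₂ * (R i).2| ≤ θ) :
    ∏ i, (N : ℝ) * w i ≤ Real.exp (-∑ i, (l₁ * (R i).1 + l₂ * (R i).2 -
      (1 / 2 + 2 * θ) * (l₁ * (R i).1 + l₂ * (R i).2) ^ 2)) := by
  have hpos : ∀ i, 0 < 1 + (l₁ * (R i).1 + l₂ * (R i).2) := fun i => by
    linarith [(abs_le.1 (hu i)).1]
  obtain ⟨h1, h2⟩ := sum_fst_snd_eq_zero.1 hwR
  have hle : ∏ i, ((N : ℝ) * w i * (1 + (l₁ * (R i).1 + l₂ * (R i).2))) ≤ 1 := by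
    refine prod_le_one_of_sum_sub_one_eq_zero (fun i => ?_) ?_
    · exact mul_nonneg (mul_nonneg (Nat.cast_nonneg _) (hw i)) (hpos i).le
    · have : ∀ i, (N : ℝ) * w i * (1 + (l₁ * (R i).1 + l₂ * (R i).2)) - 1
          = N * w i + N * l₁ * (w i * (R i).1) + N * l₂ * (w i * (R i).2) - 1 := fun i => by ring
      simp_rw [this, Finset.sum_sub_distrib, Finset.sum_add_distrib, ← Finset.mul_sum, h1, h2, hw1]
      simp
  rw [Finset.prod_mul_distrib] at hle
  have hexp := exp_sum_le_prod_one_add Finset.univ hθ hu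
  rw [Real.exp_neg, ← one_div, le_div_iff₀ (Real.exp_pos _)]
  refine le_trans ?_ hle
  exact mul_le_mul_of_nonneg_left hexp
    (Finset.prod_nonneg fun i _ => mul_nonneg (Nat.cast_nonneg _) (hw i))

theorem bddAbove_elRatio (R : Fin N → ℝ × ℝ) :
    BddAbove {L : ℝ | ∃ w : Fin N → ℝ, (∀ i, 0 ≤ w i) ∧ ∑ i, w i = 1 ∧ ∑ i, w i • R i = 0 ∧
      L = ∏ i, (N : ℝ) * w i} := by
  refine ⟨1, ?_⟩
  rintro L ⟨w, hw, hw1, hwR, rfl⟩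
  simpa using prod_mul_le_exp hw hw1 hwR 0 0 (θ := 0) (by norm_num) (by simp)

theorem elRatio_le_exp {R : Fin N → ℝ × ℝ} (l₁ l₂ : ℝ) {θ : ℝ} (hθ : θ ≤ 1 / 2)
    (hu : ∀ i, |l₁ * (R i).1 + l₂ * (R i).2| ≤ θ) :
    elRatio R ≤ Real.exp (-∑ i, (l₁ * (R i).1 + l₂ * (R i).2 -
      (1 / 2 + 2 * θ) * (l₁ * (R i).1 + l₂ * (R i).2) ^ 2)) := by
  refine Real.sSup_le ?_ (Real.exp_pos _).le
  rintro L ⟨w, hw, hw1, hwR, rfl⟩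
  exact prod_mul_le_exp hw hw1 hwR l₁ l₂ hθ hu

/-- The weights (1 + u_i) / N are feasible, so their product bounds the supremum from below. -/
theorem exp_le_elRatio {R : Fin N → ℝ × ℝ} (hN : 0 < N) {u : Fin N → ℝ} {θ : ℝ}
    (hθ : θ ≤ 1 / 2) (hu : ∀ i, |u i| ≤ θ) (hsum : ∑ i, u i = 0)
    (h1 : ∑ i, (1 + u i) * (R i).1 = 0) (h2 : ∑ i, (1 + u i) * (R i).2 = 0) :
    Real.exp (-((1 / 2 + 2 * θ) * ∑ i, u i ^ 2)) ≤ elRatio R := by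
  have hN' : (N : ℝ) ≠ 0 := by positivity
  refine le_csSup_of_le (bddAbove_elRatio R)
    (b := ∏ i, (N : ℝ) * ((N : ℝ)⁻¹ * (1 + u i))) ⟨fun i => (N : ℝ)⁻¹ * (1 + u i), ?_, ?_, ?_, rfl⟩ ?_
  · intro i
    have := (abs_le.1 (hu i)).1
    exact mul_nonneg (by positivity) (by linarith)
  · rw [← Finset.mul_sum, Finset.sum_add_distrib, hsum]
    simp [hN']
  · rw [sum_fst_snd_eq_zero]
    simp only [mul_assoc, ← Finset.mul_sum, h1, h2, mul_zero, and_self]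
  · have := exp_sum_le_prod_one_add Finset.univ hθ hu
    rw [Finset.sum_sub_distrib, hsum, zero_sub, ← Finset.mul_sum] at this
    simpa [hN'] using this

/-- The constraints are homogeneous in each coordinate, so the feasible weights do not change. This
lets the two statistics be divided by their standard deviations. -/
theorem elRatio_scale (R : Fin N → ℝ × ℝ) {s t : ℝ} (hs : s ≠ 0) (ht : t ≠ 0) :
    elRatio (fun i => (s * (R i).1, t * (R i).2)) = elRatio R := by
  unfold elRatio
  simp_rw [sum_fst_snd_eq_zero]
  have h : ∀ (c : ℝ) (w x : Fin N → ℝ), ∑ i, w i * (c * x i) = c * ∑ i, w i * x i := fun c w x => by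
    rw [Finset.mul_sum]; exact Finset.sum_congr rfl fun i _ => by ring
  simp [h, hs, ht]

theorem quadForm_le {x y a b c r : ℝ} (ha : a ≤ 1 + r) (hb : b ≤ 1 + r) (hc : |c| ≤ r) :
    a * x ^ 2 + 2 * c * (x * y) + b * y ^ 2 ≤ (1 + 2 * r) * (x ^ 2 + y ^ 2) := by
  have h1 : 2 * c * (x * y) ≤ r * (x ^ 2 + y ^ 2) := by
    calc 2 * c * (x * y) ≤ |2 * c * (x * y)| := le_abs_self _
      _ = |c| * (2 * (|x| * |y|)) := by rw [abs_mul, abs_mul, abs_mul]; norm_num; ring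
      _ ≤ r * (x ^ 2 + y ^ 2) := by
        refine mul_le_mul hc ?_ (by positivity) ((abs_nonneg c).trans hc)
        nlinarith [sq_nonneg (|x| - |y|), sq_abs x, sq_abs y]
  nlinarith [mul_le_mul_of_nonneg_right ha (sq_nonneg x),
    mul_le_mul_of_nonneg_right hb (sq_nonneg y)]

/-- Solution of a planar linear system whose matrix is close to the identity. -/
theorem exists_solution_near_identity {c₁₁ c₁₂ c₂₂ m₁ m₂ μ θ : ℝ} (hθ : θ ≤ 1 / 40)
    (k₁₁ : |c₁₁ - 1| ≤ 2 * θ) (k₁₂ : |c₁₂| ≤ 2 * θ) (k₂₂ : |c₂₂ - 1| ≤ 2 * θ)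
    (hm₁ : |m₁| ≤ μ) (hm₂ : |m₂| ≤ μ) :
    ∃ β₁ β₂ : ℝ, c₁₁ * β₁ + c₁₂ * β₂ = -m₁ ∧ c₁₂ * β₁ + c₂₂ * β₂ = -m₂ ∧
      |β₁| ≤ 2 * μ ∧ |β₂| ≤ 2 * μ ∧
      -(β₁ * m₁ + β₂ * m₂) ≤ (1 + 4 * θ) / (1 - 4 * θ) * (m₁ ^ 2 + m₂ ^ 2) := by
  have hμ0 : 0 ≤ μ := (abs_nonneg _).trans hm₁
  have hθ0 : 0 ≤ 2 * θ := (abs_nonneg _).trans k₁₂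
  obtain ⟨k₁₁a, k₁₁b⟩ := abs_le.1 k₁₁
  obtain ⟨k₂₂a, k₂₂b⟩ := abs_le.1 k₂₂
  obtain ⟨Δ, hΔ⟩ : ∃ Δ, Δ = c₁₁ * c₂₂ - c₁₂ ^ 2 := ⟨_, rfl⟩
  have hΔ1 : 1 - 4 * θ ≤ Δ := by
    have h1 : c₁₂ ^ 2 ≤ (2 * θ) ^ 2 := sq_le_sq' (by linarith [(abs_le.1 k₁₂).1]) (abs_le.1 k₁₂).2
    have h2 : (1 - 2 * θ) * (1 - 2 * θ) ≤ c₁₁ * c₂₂ := by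
      apply mul_le_mul <;> linarith
    rw [hΔ]
    linarith
  have hΔ0 : 0 < Δ := by linarith
  have hbound : ∀ {a b x y : ℝ}, |a - 1| ≤ 2 * θ → |b| ≤ 2 * θ → |x| ≤ μ → |y| ≤ μ →
      |-(a * x - b * y) / Δ| ≤ 2 * μ := by
    intro a b x y ha hb hx hy
    rw [abs_div, abs_of_pos hΔ0, abs_neg, div_le_iff₀ hΔ0]
    have ha' : |a| ≤ 1 + 2 * θ := by
      have := abs_add_le (a - 1) 1
      rw [sub_add_cancel, abs_one] at this
      linarith
    calc |a * x - b * y| ≤ |a| * |x| + |b| * |y| := by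
          rw [← abs_mul, ← abs_mul]; exact abs_sub _ _
      _ ≤ (1 + 2 * θ) * μ + 2 * θ * μ := by gcongr
      _ ≤ 2 * μ * (1 - 4 * θ) := by nlinarith
      _ ≤ 2 * μ * Δ := by gcongr
  refine ⟨-(c₂₂ * m₁ - c₁₂ * m₂) / Δ, -(c₁₁ * m₂ - c₁₂ * m₁) / Δ, ?_, ?_, hbound k₂₂ k₁₂ hm₁ hm₂,
    hbound k₁₁ k₁₂ hm₂ hm₁, ?_⟩
  · field_simp; rw [hΔ]; ring
  · field_simp; rw [hΔ]; ring
  -- By Cramer's rule −β·m is the quadratic form of the adjugate matrix at m, divided by the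
  -- determinant Δ ≥ 1 − 4θ.
  · have hQ : -(-(c₂₂ * m₁ - c₁₂ * m₂) / Δ * m₁ + -(c₁₁ * m₂ - c₁₂ * m₁) / Δ * m₂)
        = (c₂₂ * m₁ ^ 2 + 2 * (-c₁₂) * (m₁ * m₂) + c₁₁ * m₂ ^ 2) / Δ := by
      field_simp; ring
    rw [hQ, div_le_iff₀ hΔ0]
    have h1 := quadForm_le (x := m₁) (y := m₂) (a := c₂₂) (b := c₁₁) (c := -c₁₂) (r := 2 * θ)
      (by linarith) (by linarith) (by rwa [abs_neg])
    refine h1.trans ?_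
    have h2 : (1 + 4 * θ) ≤ (1 + 4 * θ) / (1 - 4 * θ) * Δ := by
      rw [div_mul_eq_mul_div, le_div_iff₀ (by linarith)]
      exact mul_le_mul_of_nonneg_left hΔ1 (by linarith)
    have h3 := mul_le_mul_of_nonneg_right h2 (add_nonneg (sq_nonneg m₁) (sq_nonneg m₂))
    linarith

/-- The multiplier is λ = m, the first-order approximation to the optimal one when the second
moments are near the identity. -/
theorem elRatio_le_exp_of_moments {R : Fin N → ℝ × ℝ} {θ μ κ m₁ m₂ s₁₁ s₁₂ s₂₂ : ℝ}
    (hθ : θ ≤ 1 / 40) (hμκ : 2 * μ * κ ≤ θ)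
    (hκ₁ : ∀ i, |(R i).1| ≤ κ) (hκ₂ : ∀ i, |(R i).2| ≤ κ) (hm₁ : |m₁| ≤ μ) (hm₂ : |m₂| ≤ μ)
    (e₁ : ∑ i, (R i).1 = N * m₁) (e₂ : ∑ i, (R i).2 = N * m₂)
    (e₁₁ : ∑ i, (R i).1 ^ 2 = N * s₁₁) (e₂₂ : ∑ i, (R i).2 ^ 2 = N * s₂₂)
    (e₁₂ : ∑ i, (R i).1 * (R i).2 = N * s₁₂) :
    elRatio R ≤ Real.exp (-(N * ((m₁ ^ 2 + m₂ ^ 2) -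
      (1 / 2 + 2 * θ) * (s₁₁ * m₁ ^ 2 + 2 * s₁₂ * (m₁ * m₂) + s₂₂ * m₂ ^ 2)))) := by
  have hμ0 : 0 ≤ μ := (abs_nonneg _).trans hm₁
  have hu : ∀ i, |m₁ * (R i).1 + m₂ * (R i).2| ≤ θ := fun i => by
    calc |m₁ * (R i).1 + m₂ * (R i).2| ≤ |m₁| * |(R i).1| + |m₂| * |(R i).2| := by
          rw [← abs_mul, ← abs_mul]; exact abs_add_le _ _
      _ ≤ μ * κ + μ * κ := by
          gcongr
          exacts [hκ₁ i, hκ₂ i]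
      _ ≤ θ := by linarith
  refine (elRatio_le_exp m₁ m₂ (by linarith) hu).trans (le_of_eq ?_)
  congr 2
  have : ∀ i, m₁ * (R i).1 + m₂ * (R i).2 - (1 / 2 + 2 * θ) * (m₁ * (R i).1 + m₂ * (R i).2) ^ 2
      = m₁ * (R i).1 + m₂ * (R i).2 - (1 / 2 + 2 * θ) * (m₁ ^ 2 * (R i).1 ^ 2
        + 2 * (m₁ * m₂) * ((R i).1 * (R i).2) + m₂ ^ 2 * (R i).2 ^ 2) := fun i => by ring
  simp_rw [this, Finset.sum_sub_distrib, ← Finset.mul_sum, Finset.sum_add_distrib,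
    ← Finset.mul_sum, e₁, e₂, e₁₁, e₂₂, e₁₂]
  ring

/-- The tilt u_i = β·(R_i − m) sums to zero, and the linear system for β, whose matrix is the
empirical covariance, says that the tilted mean of R vanishes. The factor 8 is 2 · 2 · 2: two
coordinates, |β| ≤ 2μ and |R_i − m| ≤ 2κ. -/
theorem exp_le_elRatio_of_moments {R : Fin N → ℝ × ℝ} (hN : 0 < N)
    {θ μ κ m₁ m₂ s₁₁ s₁₂ s₂₂ β₁ β₂ : ℝ} (hθ : θ ≤ 1 / 40) (hμκ : 8 * μ * κ ≤ θ)
    (hκ₁ : ∀ i, |(R i).1| ≤ κ) (hκ₂ : ∀ i, |(R i).2| ≤ κ) (hm₁ : |m₁| ≤ κ) (hm₂ : |m₂| ≤ κ)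
    (e₁ : ∑ i, (R i).1 = N * m₁) (e₂ : ∑ i, (R i).2 = N * m₂)
    (e₁₁ : ∑ i, (R i).1 ^ 2 = N * s₁₁) (e₂₂ : ∑ i, (R i).2 ^ 2 = N * s₂₂)
    (e₁₂ : ∑ i, (R i).1 * (R i).2 = N * s₁₂)
    (hs₁ : (s₁₁ - m₁ ^ 2) * β₁ + (s₁₂ - m₁ * m₂) * β₂ = -m₁)
    (hs₂ : (s₁₂ - m₁ * m₂) * β₁ + (s₂₂ - m₂ ^ 2) * β₂ = -m₂)
    (hβ₁ : |β₁| ≤ 2 * μ) (hβ₂ : |β₂| ≤ 2 * μ) :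
    Real.exp (-((1 / 2 + 2 * θ) * (N * -(β₁ * m₁ + β₂ * m₂)))) ≤ elRatio R := by
  have hμ0 : 0 ≤ 2 * μ := (abs_nonneg _).trans hβ₁
  obtain ⟨u, hu⟩ : ∃ u : Fin N → ℝ, ∀ i, u i = β₁ * ((R i).1 - m₁) + β₂ * ((R i).2 - m₂) :=
    ⟨_, fun _ => rfl⟩
  have huθ : ∀ i, |u i| ≤ θ := fun i => by
    have h1 : |(R i).1 - m₁| ≤ 2 * κ := (abs_sub _ _).trans (by linarith [hκ₁ i])
    have h2 : |(R i).2 - m₂| ≤ 2 * κ := (abs_sub _ _).trans (by linarith [hκ₂ i])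
    calc |u i| ≤ |β₁| * |(R i).1 - m₁| + |β₂| * |(R i).2 - m₂| := by
          rw [← abs_mul, ← abs_mul, hu]; exact abs_add_le _ _
      _ ≤ 2 * μ * (2 * κ) + 2 * μ * (2 * κ) := by gcongr
      _ ≤ θ := by linarith
  have hsum : ∑ i, u i = 0 := by
    simp_rw [hu, Finset.sum_add_distrib, ← Finset.mul_sum, Finset.sum_sub_distrib, e₁, e₂]
    simp
  have hR₁ : ∑ i, (1 + u i) * (R i).1 = 0 := by
    have : ∀ i, (1 + u i) * (R i).1 = (R i).1 + β₁ * (R i).1 ^ 2 - β₁ * m₁ * (R i).1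
        + β₂ * ((R i).1 * (R i).2) - β₂ * m₂ * (R i).1 := fun i => by rw [hu]; ring
    simp_rw [this, Finset.sum_sub_distrib, Finset.sum_add_distrib, Finset.sum_sub_distrib,
      Finset.sum_add_distrib, ← Finset.mul_sum, e₁, e₁₁, e₁₂]
    linear_combination (N : ℝ) * hs₁
  have hR₂ : ∑ i, (1 + u i) * (R i).2 = 0 := by
    have : ∀ i, (1 + u i) * (R i).2 = (R i).2 + β₁ * ((R i).1 * (R i).2) - β₁ * m₁ * (R i).2
        + β₂ * (R i).2 ^ 2 - β₂ * m₂ * (R i).2 := fun i => by rw [hu]; ring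
    simp_rw [this, Finset.sum_sub_distrib, Finset.sum_add_distrib, Finset.sum_sub_distrib,
      Finset.sum_add_distrib, ← Finset.mul_sum, e₂, e₂₂, e₁₂]
    linear_combination (N : ℝ) * hs₂
  -- The sums of (1 + u_i) R_i vanish, so expanding one factor u_i leaves −∑ β·R_i; no second
  -- moments enter.
  have hsq : ∑ i, u i ^ 2 = N * -(β₁ * m₁ + β₂ * m₂) := by
    have h1 : ∀ i, u i ^ 2 = β₁ * ((1 + u i) * (R i).1) + β₂ * ((1 + u i) * (R i).2)
        - (β₁ * (R i).1 + β₂ * (R i).2) - (β₁ * m₁ + β₂ * m₂) * u i := fun i => by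
      rw [hu]; ring
    rw [Finset.sum_congr rfl fun i _ => h1 i]
    simp_rw [Finset.sum_sub_distrib, Finset.sum_add_distrib, ← Finset.mul_sum, hR₁, hR₂, hsum,
      e₁, e₂]
    ring
  rw [← hsq]
  exact exp_le_elRatio hN (by linarith) huθ hsum hR₁ hR₂

theorem abs_sum_div_le {x : Fin N → ℝ} (hN : 0 < N) {κ : ℝ} (h : ∀ i, |x i| ≤ κ) :
    |(∑ i, x i) / N| ≤ κ := by
  have hN' : (0 : ℝ) < N := by positivity
  rw [abs_div, abs_of_pos hN', div_le_iff₀ hN']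
  calc |∑ i, x i| ≤ ∑ i : Fin N, |x i| := Finset.abs_sum_le_sum_abs _ _
    _ ≤ ∑ _i : Fin N, κ := Finset.sum_le_sum fun i _ => h i
    _ = κ * N := by simp [mul_comm]

/-- For θ ≤ 1/40 both (1 + 4θ)(1 + 2θ) and (1 + 4θ)² / (1 − 4θ) are at most 1 + 40θ. -/
theorem abs_sub_le_of_expansion {M θ T q Q ℓ : ℝ} (hθ0 : 0 ≤ θ) (hθ : θ ≤ 1 / 40) (hM : 0 ≤ M)
    (hT : 0 ≤ T) (hlog₁ : ℓ ≤ -(M * (T - (1 / 2 + 2 * θ) * q)))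
    (hlog₂ : -((1 / 2 + 2 * θ) * (M * Q)) ≤ ℓ) (hq : q ≤ (1 + 2 * θ) * T)
    (hQ : Q ≤ (1 + 4 * θ) / (1 - 4 * θ) * T) : |-2 * ℓ - M * T| ≤ 40 * θ * (M * T) := by
  have hfac : (1 + 4 * θ) * ((1 + 4 * θ) / (1 - 4 * θ)) ≤ 1 + 40 * θ := by
    rw [← mul_div_assoc, div_le_iff₀ (by linarith)]
    nlinarith
  rw [abs_le]
  constructor
  · have h1 : (1 + 4 * θ) * q ≤ (1 + 4 * θ) * ((1 + 2 * θ) * T) :=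
      mul_le_mul_of_nonneg_left hq (by linarith)
    have h2 : (1 + 4 * θ) * (1 + 2 * θ) ≤ 1 + 40 * θ := by nlinarith
    have h3 := mul_le_mul_of_nonneg_right h2 hT
    have h4 : 0 ≤ M * ((1 + 40 * θ) * T - (1 + 4 * θ) * q) :=
      mul_nonneg hM (by linarith)
    linarith
  · have h1 : (1 + 4 * θ) * Q ≤ (1 + 4 * θ) * ((1 + 4 * θ) / (1 - 4 * θ) * T) :=
      mul_le_mul_of_nonneg_left hQ (by linarith)
    have h3 := mul_le_mul_of_nonneg_right hfac hT
    have h4 : 0 ≤ M * ((1 + 40 * θ) * T - (1 + 4 * θ) * Q) :=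
      mul_nonneg hM (by linarith)
    linarith

/-- If the first two empirical moments of `R_1, …, R_N` are close to those of a standardised
sample and no `R_i` is too large, then `-2 log` of the empirical likelihood ratio is close to
`N |R̄|²`. -/
theorem abs_neg_two_log_elRatio_sub_le {R : Fin N → ℝ × ℝ} (hN : 0 < N)
    {θ μ κ m₁ m₂ s₁₁ s₁₂ s₂₂ : ℝ} (hθ : θ ≤ 1 / 40) (hμ : μ ^ 2 ≤ θ) (hμκ : 8 * μ * κ ≤ θ)
    (hκ₁ : ∀ i, |(R i).1| ≤ κ) (hκ₂ : ∀ i, |(R i).2| ≤ κ) (hm₁ : |m₁| ≤ μ) (hm₂ : |m₂| ≤ μ)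
    (e₁ : ∑ i, (R i).1 = N * m₁) (e₂ : ∑ i, (R i).2 = N * m₂)
    (e₁₁ : ∑ i, (R i).1 ^ 2 = N * s₁₁) (e₂₂ : ∑ i, (R i).2 ^ 2 = N * s₂₂)
    (e₁₂ : ∑ i, (R i).1 * (R i).2 = N * s₁₂)
    (h₁₁ : |s₁₁ - 1| ≤ θ) (h₂₂ : |s₂₂ - 1| ≤ θ) (h₁₂ : |s₁₂| ≤ θ) :
    0 < elRatio R ∧
    |-2 * Real.log (elRatio R) - N * (m₁ ^ 2 + m₂ ^ 2)| ≤ 40 * θ * (N * (m₁ ^ 2 + m₂ ^ 2)) := by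
  have hN' : (0 : ℝ) < N := by positivity
  have hμ0 : 0 ≤ μ := (abs_nonneg _).trans hm₁
  have hκ0 : 0 ≤ κ := (abs_nonneg _).trans (hκ₁ ⟨0, hN⟩)
  have hθ0 : 0 ≤ θ := (sq_nonneg μ).trans hμ
  have hmκ₁ : |m₁| ≤ κ := by
    have := abs_sum_div_le hN hκ₁
    rwa [e₁, mul_div_cancel_left₀ _ hN'.ne'] at this
  have hmκ₂ : |m₂| ≤ κ := by
    have := abs_sum_div_le hN hκ₂
    rwa [e₂, mul_div_cancel_left₀ _ hN'.ne'] at this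
  have hm₁sq : m₁ ^ 2 ≤ θ := (sq_le_sq' (by linarith [(abs_le.1 hm₁).1]) (abs_le.1 hm₁).2).trans hμ
  have hm₂sq : m₂ ^ 2 ≤ θ := (sq_le_sq' (by linarith [(abs_le.1 hm₂).1]) (abs_le.1 hm₂).2).trans hμ
  have hm₁₂ : |m₁ * m₂| ≤ θ := by
    rw [abs_le]; constructor <;> nlinarith [sq_nonneg (m₁ + m₂), sq_nonneg (m₁ - m₂)]
  have hT : 0 ≤ m₁ ^ 2 + m₂ ^ 2 := by positivity
  have hupper := elRatio_le_exp_of_moments hθ (by nlinarith) hκ₁ hκ₂ hm₁ hm₂ e₁ e₂ e₁₁ e₂₂ e₁₂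
  have k₁₁ : |s₁₁ - m₁ ^ 2 - 1| ≤ 2 * θ := by
    have := abs_sub (s₁₁ - 1) (m₁ ^ 2)
    rw [abs_of_nonneg (sq_nonneg m₁)] at this
    rw [sub_right_comm]; linarith
  have k₂₂ : |s₂₂ - m₂ ^ 2 - 1| ≤ 2 * θ := by
    have := abs_sub (s₂₂ - 1) (m₂ ^ 2)
    rw [abs_of_nonneg (sq_nonneg m₂)] at this
    rw [sub_right_comm]; linarith
  have k₁₂ : |s₁₂ - m₁ * m₂| ≤ 2 * θ := (abs_sub _ _).trans (by linarith)
  obtain ⟨β₁, β₂, hs₁, hs₂, hβ₁, hβ₂, hQ⟩ :=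
    exists_solution_near_identity hθ k₁₁ k₁₂ k₂₂ hm₁ hm₂
  have hlow := exp_le_elRatio_of_moments hN hθ hμκ hκ₁ hκ₂ hmκ₁ hmκ₂ e₁ e₂ e₁₁ e₂₂ e₁₂
    hs₁ hs₂ hβ₁ hβ₂
  have hpos : 0 < elRatio R := (Real.exp_pos _).trans_le hlow
  refine ⟨hpos, ?_⟩
  have hlog₁ := (Real.log_le_iff_le_exp hpos).2 hupper
  have hlog₂ := (Real.le_log_iff_exp_le hpos).2 hlow
  have hq := quadForm_le (x := m₁) (y := m₂) (a := s₁₁) (b := s₂₂) (c := s₁₂) (r := θ)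
    (by linarith [(abs_le.1 h₁₁).2]) (by linarith [(abs_le.1 h₂₂).2]) h₁₂
  exact abs_sub_le_of_expansion hθ0 hθ hN'.le hT (by linarith) (by linarith) hq hQ

/-- The supremum is attained, because the feasible weights form a compact set. Positivity of c
excludes the empty feasible set, where the supremum is 0 by convention. -/
theorem le_elRatio_iff {R : Fin N → ℝ × ℝ} {c : ℝ} (hc : 0 < c) :
    c ≤ elRatio R ↔ ∃ w ∈ stdSimplex ℝ (Fin N), ∑ i, w i • R i = 0 ∧ c ≤ ∏ i, (N : ℝ) * w i := by
  constructor
  · intro h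
    have hne : {w ∈ stdSimplex ℝ (Fin N) | ∑ i, w i • R i = 0}.Nonempty := by
      by_contra hcon
      have : elRatio R = 0 := by
        unfold elRatio
        convert Real.sSup_empty
        rw [Set.eq_empty_iff_forall_notMem]
        rintro L ⟨w, hw, hw1, hwR, -⟩
        exact hcon ⟨w, ⟨hw, hw1⟩, hwR⟩
      linarith
    have hcomp : IsCompact {w ∈ stdSimplex ℝ (Fin N) | ∑ i, w i • R i = 0} :=
      (isCompact_stdSimplex ℝ (Fin N)).inter_right
        (isClosed_eq (by fun_prop) continuous_const)
    obtain ⟨w, hw, hmax⟩ := hcomp.exists_isMaxOn hne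
      (f := fun w : Fin N → ℝ => ∏ i, (N : ℝ) * w i) (by fun_prop)
    refine ⟨w, hw.1, hw.2, h.trans (csSup_le ⟨_, w, hw.1.1, hw.1.2, hw.2, rfl⟩ ?_)⟩
    rintro L ⟨w', h0, h1, h2, rfl⟩
    exact hmax ⟨⟨h0, h1⟩, h2⟩
  · rintro ⟨w, hw, hwR, hle⟩
    exact le_csSup_of_le (bddAbove_elRatio R) ⟨w, hw.1, hw.2, hwR, rfl⟩ hle

/-- For c > 0 the superlevel set is the projection, along the compact simplex, of a closed set of
pairs (R, w); hence it is closed. For c ≤ 0 it is the whole space. -/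
theorem measurable_elRatio : Measurable (elRatio : (Fin N → ℝ × ℝ) → ℝ) := by
  refine measurable_of_Ici fun c => ?_
  rcases le_or_gt c 0 with hc | hc
  · convert MeasurableSet.univ
    refine Set.eq_univ_of_forall fun R => hc.trans ?_
    refine Real.sSup_nonneg ?_
    rintro L ⟨w, hw, -, -, rfl⟩
    exact Finset.prod_nonneg fun i _ => mul_nonneg (Nat.cast_nonneg _) (hw i)
  · have : elRatio (N := N) ⁻¹' Set.Ici c = Prod.fst '' {q : (Fin N → ℝ × ℝ) ×
        stdSimplex ℝ (Fin N) | ∑ i, (q.2 : Fin N → ℝ) i • q.1 i = 0 ∧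
          c ≤ ∏ i, (N : ℝ) * (q.2 : Fin N → ℝ) i} := by
      ext R
      rw [Set.mem_preimage, Set.mem_Ici, le_elRatio_iff hc]
      constructor
      · rintro ⟨w, hw, h⟩
        exact ⟨(R, ⟨w, hw⟩), h, rfl⟩
      · rintro ⟨⟨R', w⟩, h, rfl⟩
        exact ⟨w, w.2, h⟩
    rw [this]
    have : CompactSpace (stdSimplex ℝ (Fin N)) :=
      isCompact_iff_compactSpace.1 (isCompact_stdSimplex ℝ (Fin N))
    refine (isClosedMap_fst_of_compactSpace _ ?_).measurableSet
    have hw : ∀ i, Continuous fun q : (Fin N → ℝ × ℝ) × stdSimplex ℝ (Fin N) =>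
        (q.2 : Fin N → ℝ) i := fun i =>
      (continuous_apply i).comp (continuous_subtype_val.comp continuous_snd)
    have hR : ∀ i, Continuous fun q : (Fin N → ℝ × ℝ) × stdSimplex ℝ (Fin N) => q.1 i := fun i =>
      (continuous_apply i).comp continuous_fst
    exact (isClosed_eq (continuous_finsetSum _ fun i _ => (hw i).smul (hR i))
      continuous_const).and (isClosed_le continuous_const
        (continuous_finsetProd _ fun i _ => continuous_const.mul (hw i)))

theorem measurable_negTwoLog : Measurable negTwoLog := by
  refine Measurable.ite (measurableSet_singleton 0) measurable_const ?_
  exact measurable_coe_real_ereal.comp (Real.measurable_log.const_mul _)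

end EmpiricalLikelihood


/-! ### Convergence in distribution and in probability along a sequence of probability spaces. -/

section WeakConvergence

variable {Ω : ℕ → Type*} [∀ n, MeasurableSpace (Ω n)] {P : ∀ n, Measure (Ω n)}
  {Ω' : Type*} [MeasurableSpace Ω'] {μ' : Measure Ω'}

/-- Convergence in distribution only depends on the laws. -/
theorem tendstoInDistribution_of_map_eq {E : Type*} [TopologicalSpace E] [MeasurableSpace E]
    [OpensMeasurableSpace E] {Ω₁ : ℕ → Type*} [∀ n, MeasurableSpace (Ω₁ n)]
    {P₁ : ∀ n, Measure (Ω₁ n)} {Ω₁' : Type*} [MeasurableSpace Ω₁'] {μ₁' : Measure Ω₁'}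
    [∀ n, IsProbabilityMeasure (P n)] [IsProbabilityMeasure μ'] [∀ n, IsProbabilityMeasure (P₁ n)]
    [IsProbabilityMeasure μ₁'] {X : ∀ n, Ω n → E} {X₁ : ∀ n, Ω₁ n → E} {Z : Ω' → E} {Z₁ : Ω₁' → E}
    (h : TendstoInDistribution X atTop Z P μ') (hX₁ : ∀ n, AEMeasurable (X₁ n) (P₁ n))
    (hZ₁ : AEMeasurable Z₁ μ₁') (hX : ∀ᶠ n in atTop, (P₁ n).map (X₁ n) = (P n).map (X n))
    (hZ : μ₁'.map Z₁ = μ'.map Z) : TendstoInDistribution X₁ atTop Z₁ P₁ μ₁' := by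
  refine ⟨hX₁, hZ₁, ?_⟩
  have e : (⟨μ'.map Z, Measure.isProbabilityMeasure_map h.aemeasurable_limit⟩ :
      ProbabilityMeasure E) = ⟨μ₁'.map Z₁, Measure.isProbabilityMeasure_map hZ₁⟩ :=
    Subtype.ext hZ.symm
  rw [← e]
  exact h.tendsto.congr' (hX.mono fun n hn => Subtype.ext hn.symm)

/-- An extended-real sequence which is asymptotically close in probability to a real sequence
that converges in distribution has the same limit in distribution. -/
theorem tendstoInDistribution_coe_of_close [∀ n, IsProbabilityMeasure (P n)]
    [IsProbabilityMeasure μ'] {Z : Ω' → ℝ} {T : ∀ n, Ω n → ℝ}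
    (hT : TendstoInDistribution T atTop Z P μ') {V : ∀ n, Ω n → EReal}
    (hV : ∀ n, AEMeasurable (V n) (P n))
    (h : ∀ ε > 0, Tendsto (fun n => P n {ω | ¬ ∃ v : ℝ, V n ω = v ∧ |v - T n ω| ≤ ε})
      atTop (𝓝 0)) :
    TendstoInDistribution V atTop (fun ω => (Z ω : EReal)) P μ' := by
  have hZ := hT.aemeasurable_limit
  refine ⟨hV, hZ.coe_real_ereal, tendsto_of_forall_isClosed_limsup_le' fun F hF => ?_⟩
  simp only [ProbabilityMeasure.coe_mk]
  have hF' : IsClosed ((fun t : ℝ => (t : EReal)) ⁻¹' F) := hF.preimage continuous_coe_real_ereal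
  have : IsProbabilityMeasure (μ'.map Z) := Measure.isProbabilityMeasure_map hZ
  rw [Measure.map_apply_of_aemeasurable hZ.coe_real_ereal hF.measurableSet]
  -- Closed thickenings of the real trace of F decrease to it in measure, so it suffices to apply
  -- the portmanteau inequality to T on each thickening: V in F and |V − T| ≤ r put T within
  -- distance r of the trace.
  have hlim := tendsto_measure_cthickening_of_isClosed (μ := μ'.map Z)
    ⟨1, one_pos, measure_ne_top _ _⟩ hF'
  rw [Measure.map_apply_of_aemeasurable hZ hF'.measurableSet] at hlim
  refine ge_of_tendsto (hlim.mono_left (nhdsWithin_le_nhds (s := Set.Ioi 0))) ?_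
  filter_upwards [self_mem_nhdsWithin] with r hr
  have hcl : IsClosed (Metric.cthickening r ((fun t : ℝ => (t : EReal)) ⁻¹' F)) :=
    Metric.isClosed_cthickening
  have hle : ∀ n, (P n).map (V n) F ≤
      (P n).map (T n) (Metric.cthickening r ((fun t : ℝ => (t : EReal)) ⁻¹' F)) +
        P n {ω | ¬ ∃ v : ℝ, V n ω = v ∧ |v - T n ω| ≤ r} := by
    intro n
    rw [Measure.map_apply_of_aemeasurable (hV n) hF.measurableSet,
      Measure.map_apply_of_aemeasurable (hT.forall_aemeasurable n) hcl.measurableSet]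
    refine (measure_mono fun ω hω => ?_).trans (measure_union_le _ _)
    by_cases hb : ∃ v : ℝ, V n ω = v ∧ |v - T n ω| ≤ r
    · obtain ⟨v, hv, hvr⟩ := hb
      refine Or.inl (Metric.mem_cthickening_of_dist_le (T n ω) v r _ ?_ ?_)
      · rw [Set.mem_preimage, ← hv]; exact hω
      · rwa [dist_comm, Real.dist_eq]
    · exact Or.inr hb
  refine (limsup_le_limsup (Eventually.of_forall hle)).trans ?_
  refine (ENNReal.limsup_add_of_right_tendsto_zero (h r hr) _).le.trans ?_
  exact ProbabilityMeasure.limsup_measure_closed_le_of_tendsto hT.tendsto hcl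

/-- Convergence to zero in probability along a sequence of probability spaces. -/
def TendstoZeroInProb (P : ∀ n, Measure (Ω n)) (f : ∀ n, Ω n → ℝ) : Prop :=
  ∀ ε > 0, Tendsto (fun n => P n {ω | ε < |f n ω|}) atTop (𝓝 0)

namespace TendstoZeroInProb

variable {f g : ∀ n, Ω n → ℝ}

theorem mono (hg : TendstoZeroInProb P g) (h : ∀ᶠ n in atTop, ∀ ω, |f n ω| ≤ |g n ω|) :
    TendstoZeroInProb P f := fun ε hε =>
  tendsto_of_tendsto_of_tendsto_of_le_of_le' tendsto_const_nhds (hg ε hε)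
    (Eventually.of_forall fun _ => zero_le)
    (h.mono fun _ hn => measure_mono fun ω hω => lt_of_lt_of_le hω (hn ω))

theorem add (hf : TendstoZeroInProb P f) (hg : TendstoZeroInProb P g) :
    TendstoZeroInProb P fun n ω => f n ω + g n ω := fun ε hε => by
  have h := (hf (ε / 2) (by positivity)).add (hg (ε / 2) (by positivity))
  rw [add_zero] at h
  refine tendsto_of_tendsto_of_tendsto_of_le_of_le tendsto_const_nhds h (fun _ => zero_le)
    fun n => (measure_mono fun ω hω => ?_).trans (measure_union_le _ _)
  by_contra hcon
  simp only [Set.mem_union, Set.mem_ofPred_eq, not_or, not_lt] at hcon hω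
  linarith [abs_add_le (f n ω) (g n ω)]

theorem const_mul (c : ℝ) (hf : TendstoZeroInProb P f) :
    TendstoZeroInProb P fun n ω => c * f n ω := fun ε hε => by
  refine tendsto_of_tendsto_of_tendsto_of_le_of_le tendsto_const_nhds
    (hf (ε / (|c| + 1)) (by positivity)) (fun _ => zero_le) fun n => measure_mono fun ω hω => ?_
  simp only [Set.mem_ofPred_eq, abs_mul] at hω ⊢
  rw [div_lt_iff₀ (by positivity)]
  nlinarith [abs_nonneg (f n ω), abs_nonneg c]

theorem sub (hf : TendstoZeroInProb P f) (hg : TendstoZeroInProb P g) :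
    TendstoZeroInProb P fun n ω => f n ω - g n ω :=
  (hf.add (hg.const_mul (-1))).mono (Eventually.of_forall fun n ω => by
    rw [neg_one_mul, sub_eq_add_neg])

end TendstoZeroInProb

theorem measure_lt_abs_le_ofReal {Ω : Type*} [MeasurableSpace Ω] {P : Measure Ω} {f : Ω → ℝ}
    (hf : Integrable f P) {ε : ℝ} (hε : 0 < ε) :
    P {ω | ε < |f ω|} ≤ ENNReal.ofReal ((∫ ω, |f ω| ∂P) / ε) := by
  have h := meas_ge_le_lintegral_div (μ := P) (f := fun ω => ENNReal.ofReal |f ω|)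
    hf.abs.aestronglyMeasurable.aemeasurable.ennreal_ofReal
    (ε := ENNReal.ofReal ε) (by simpa using hε) ENNReal.ofReal_ne_top
  rw [← ofReal_integral_eq_lintegral_ofReal hf.abs (ae_of_all _ fun _ => abs_nonneg _),
    ← ENNReal.ofReal_div_of_pos hε] at h
  refine (measure_mono fun ω hω => ?_).trans h
  exact ENNReal.ofReal_le_ofReal (le_of_lt hω)

theorem tendstoZeroInProb_of_integral_le {f : ∀ n, Ω n → ℝ} {c : ℕ → ℝ}
    (hc : Tendsto c atTop (𝓝 0))
    (h : ∀ᶠ n in atTop, Integrable (f n) (P n) ∧ ∫ ω, |f n ω| ∂P n ≤ c n) :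
    TendstoZeroInProb P f := fun ε hε => by
  have h1 : Tendsto (fun n => ENNReal.ofReal (c n / ε)) atTop (𝓝 0) := by
    have := ENNReal.tendsto_ofReal (hc.div_const ε)
    simpa using this
  refine tendsto_of_tendsto_of_tendsto_of_le_of_le' tendsto_const_nhds h1
    (Eventually.of_forall fun _ => zero_le) (h.mono fun n hn => ?_)
  refine (measure_lt_abs_le_ofReal hn.1 hε).trans (ENNReal.ofReal_le_ofReal ?_)
  gcongr
  exact hn.2

theorem tendstoZeroInProb_of_integral_sq_le {f : ∀ n, Ω n → ℝ} {c : ℕ → ℝ}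
    (hc : Tendsto c atTop (𝓝 0))
    (h : ∀ᶠ n in atTop, Integrable (fun ω => f n ω ^ 2) (P n) ∧ ∫ ω, f n ω ^ 2 ∂P n ≤ c n) :
    TendstoZeroInProb P f := fun ε hε => by
  have h1 := tendstoZeroInProb_of_integral_le (f := fun n ω => f n ω ^ 2) (P := P) hc
    (h.mono fun n hn => ⟨hn.1, by simpa using hn.2⟩) (ε ^ 2) (by positivity)
  refine h1.congr fun n => ?_
  congr 1
  ext ω
  simp only [Set.mem_ofPred_eq, abs_pow]
  exact pow_lt_pow_iff_left₀ hε.le (abs_nonneg _) two_ne_zero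

end WeakConvergence


/-! ### Characteristic functions under Lyapunov's condition. -/

section Lyapunov

/-- Supplies truncation levels that vanish slowly: with s = r + 1/(n+1) and κ = s^(1/(2δ)) one has
κ^(−δ) r ≤ √s. The summand 1/(n+1) only keeps s positive. -/
theorem exists_tendsto_zero_rpow_neg_mul {r : ℕ → ℝ} (hr : Tendsto r atTop (𝓝 0))
    (hr0 : ∀ n, 0 ≤ r n) {δ : ℝ} (hδ : 0 < δ) :
    ∃ κ : ℕ → ℝ, (∀ n, 0 < κ n) ∧ Tendsto κ atTop (𝓝 0) ∧
      Tendsto (fun n => κ n ^ (-δ) * r n) atTop (𝓝 0) := by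
  have hs : Tendsto (fun n : ℕ => r n + 1 / ((n : ℝ) + 1)) atTop (𝓝 0) := by
    simpa using hr.add tendsto_one_div_add_atTop_nhds_zero_nat
  have hs0 : ∀ n : ℕ, 0 < r n + 1 / ((n : ℝ) + 1) := fun n =>
    add_pos_of_nonneg_of_pos (hr0 n) (by positivity)
  have hlim : ∀ {a : ℝ}, 0 < a →
      Tendsto (fun n : ℕ => (r n + 1 / ((n : ℝ) + 1)) ^ a) atTop (𝓝 0) := fun {a} ha => by
    simpa [Real.zero_rpow ha.ne'] using hs.rpow_const (p := a) (Or.inr ha.le)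
  refine ⟨fun n => (r n + 1 / ((n : ℝ) + 1)) ^ (1 / (2 * δ)), fun n => Real.rpow_pos_of_pos (hs0 n) _,
    hlim (by positivity), ?_⟩
  refine squeeze_zero (fun n => mul_nonneg (Real.rpow_nonneg (Real.rpow_nonneg (hs0 n).le _) _)
    (hr0 n)) (fun n => ?_) (hlim (a := 1 / 2) (by norm_num))
  rw [← Real.rpow_mul (hs0 n).le]
  have h1 : 1 / (2 * δ) * -δ = -(1 / 2) := by field_simp
  rw [h1]
  calc (r n + 1 / ((n : ℝ) + 1)) ^ (-(1 / 2) : ℝ) * r n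
      ≤ (r n + 1 / ((n : ℝ) + 1)) ^ (-(1 / 2) : ℝ) * (r n + 1 / ((n : ℝ) + 1)) := by
        gcongr
        · exact Real.rpow_nonneg (hs0 n).le _
        · have : (0 : ℝ) < 1 / ((n : ℝ) + 1) := by positivity
          linarith
    _ = (r n + 1 / ((n : ℝ) + 1)) ^ (1 / 2 : ℝ) := by
        rw [← Real.rpow_add_one (hs0 n).ne']; norm_num

/-- The cubic Taylor remainder serves for |y| ≤ 1, and the triangle inequality for |y| ≥ 1. -/
theorem norm_cexp_sub_le_sq_mul_min (y : ℝ) :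
    ‖Complex.exp (y * Complex.I) - (1 + y * Complex.I - (y : ℂ) ^ 2 / 2)‖
      ≤ 4 * (y ^ 2 * min 1 |y|) := by
  rcases le_total |y| 1 with h | h
  · have h1 := Complex.norm_exp_sub_sum_le_norm_mul_exp (y * Complex.I) 3
    have h2 : ‖(y : ℂ) * Complex.I‖ = |y| := by simp
    rw [h2] at h1
    have h3 : ∑ m ∈ Finset.range 3, ((y : ℂ) * Complex.I) ^ m / (m.factorial : ℂ)
        = 1 + y * Complex.I - (y : ℂ) ^ 2 / 2 := by
      simp [Finset.sum_range_succ, mul_pow, Complex.I_sq, Nat.factorial]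
      ring
    rw [h3] at h1
    refine h1.trans ?_
    rw [min_eq_right h]
    have h4 : Real.exp |y| ≤ 4 :=
      (Real.exp_le_exp.2 h).trans (by linarith [Real.exp_one_lt_d9])
    have h5 : |y| ^ 3 = y ^ 2 * |y| := by rw [pow_succ, sq_abs]
    rw [h5]
    nlinarith [mul_nonneg (sq_nonneg y) (abs_nonneg y)]
  · rw [min_eq_left h, mul_one]
    have h1 : ‖Complex.exp (y * Complex.I)‖ = 1 := Complex.norm_exp_ofReal_mul_I y
    have h2 : ‖(1 + y * Complex.I - (y : ℂ) ^ 2 / 2)‖ ≤ 1 + |y| + y ^ 2 / 2 := by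
      refine (norm_sub_le _ _).trans (add_le_add ((norm_add_le _ _).trans ?_) ?_)
      · simp
      · simp
    refine (norm_sub_le _ _).trans ?_
    rw [h1]
    nlinarith [sq_abs y]

/-- Below |y| = κ the minimum is at most κ; above it (|y|/κ)^δ ≥ 1. Thus a moment of order 2 + δ
replaces the third moment, for any δ > 0. -/
theorem sq_mul_min_le {y κ δ : ℝ} (hκ : 0 < κ) (hδ : 0 < δ) :
    y ^ 2 * min 1 |y| ≤ κ * y ^ 2 + κ ^ (-δ) * |y| ^ (2 + δ) := by
  rcases le_total |y| κ with h | h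
  · have h1 : y ^ 2 * min 1 |y| ≤ y ^ 2 * κ :=
      mul_le_mul_of_nonneg_left ((min_le_right _ _).trans h) (sq_nonneg y)
    have h2 : 0 ≤ κ ^ (-δ) * |y| ^ (2 + δ) := by positivity
    linarith
  · have hy : 0 < |y| := hκ.trans_le h
    have h1 : y ^ 2 * min 1 |y| ≤ y ^ 2 * 1 :=
      mul_le_mul_of_nonneg_left (min_le_left _ _) (sq_nonneg y)
    have h2 : |y| ^ (2 + δ) = y ^ 2 * |y| ^ δ := by
      rw [Real.rpow_add hy, Real.rpow_two, sq_abs]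
    have h3 : 1 ≤ κ ^ (-δ) * |y| ^ δ := by
      rw [Real.rpow_neg hκ.le, ← div_eq_inv_mul, one_le_div (by positivity)]
      exact Real.rpow_le_rpow hκ.le h hδ.le
    have h4 : 0 ≤ κ * y ^ 2 := by positivity
    rw [h2]
    nlinarith [sq_nonneg y]

theorem norm_pow_sub_pow_le {a b : ℂ} (ha : ‖a‖ ≤ 1) (hb : ‖b‖ ≤ 1) (n : ℕ) :
    ‖a ^ n - b ^ n‖ ≤ n * ‖a - b‖ := by
  induction n with
  | zero => simp
  | succ n ih =>
    have h : a ^ (n + 1) - b ^ (n + 1) = a * (a ^ n - b ^ n) + (a - b) * b ^ n := by ring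
    rw [h]
    refine (norm_add_le _ _).trans ?_
    rw [norm_mul, norm_mul, norm_pow]
    have h1 : ‖a‖ * ‖a ^ n - b ^ n‖ ≤ 1 * (n * ‖a - b‖) :=
      mul_le_mul ha ih (norm_nonneg _) zero_le_one
    have h2 : ‖a - b‖ * ‖b‖ ^ n ≤ ‖a - b‖ * 1 :=
      mul_le_mul_of_nonneg_left (pow_le_one₀ (norm_nonneg _) hb) (norm_nonneg _)
    push_cast
    linarith

/-- Row laws `ρ n` of a triangular array with rows of length `N n`, centred with variance `σ²`,
which satisfy Lyapunov's condition of order `2 + δ`. -/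
structure LyapunovCondition (N : ℕ → ℕ) (ρ : ℕ → Measure ℝ) (δ σ2 : ℝ) : Prop where
  isProbabilityMeasure : ∀ n, IsProbabilityMeasure (ρ n)
  delta_pos : 0 < δ
  integrable : ∀ᶠ n in atTop, Integrable (fun x => |x| ^ (2 + δ)) (ρ n)
  mean : ∀ᶠ n in atTop, ∫ x, x ∂ρ n = 0
  variance : ∀ᶠ n in atTop, ∫ x, x ^ 2 ∂ρ n = σ2
  tendsto : Tendsto (fun n => (N n : ℝ) ^ (-(δ / 2)) * ∫ x, |x| ^ (2 + δ) ∂ρ n) atTop (𝓝 0)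

theorem memLp_two_of_integrable_abs_rpow {𝒳 : Type*} [MeasurableSpace 𝒳] {π : Measure 𝒳}
    [IsFiniteMeasure π] {h : 𝒳 → ℝ} {δ : ℝ} (hδ : 0 < δ) (hh : AEStronglyMeasurable h π)
    (hi : Integrable (fun x => |h x| ^ (2 + δ)) π) : MemLp h 2 π := by
  have h1 : MemLp h (ENNReal.ofReal (2 + δ)) π := by
    rw [← integrable_norm_rpow_iff hh (by simp; linarith) (by simp),
      ENNReal.toReal_ofReal (by linarith)]
    exact hi
  refine h1.mono_exponent ?_
  rw [show (2 : ℝ≥0∞) = ENNReal.ofReal 2 by simp]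
  exact ENNReal.ofReal_le_ofReal (by linarith)

theorem memLp_two_of_integrable_rpow {ρ : Measure ℝ} [IsFiniteMeasure ρ] {δ : ℝ} (hδ : 0 < δ)
    (h : Integrable (fun x => |x| ^ (2 + δ)) ρ) : MemLp (fun x : ℝ => x) 2 ρ :=
  memLp_two_of_integrable_abs_rpow hδ (by fun_prop) h

theorem norm_charFun_sub_le {ρ : Measure ℝ} [IsProbabilityMeasure ρ] {δ κ σ2 : ℝ} (hδ : 0 < δ)
    (hκ : 0 < κ) (hint : Integrable (fun x => |x| ^ (2 + δ)) ρ) (hm : ∫ x, x ∂ρ = 0)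
    (hv : ∫ x, x ^ 2 ∂ρ = σ2) {t : ℝ} (ht : 0 ≤ t) :
    ‖charFun ρ t - (1 - (t : ℂ) ^ 2 * σ2 / 2)‖ ≤
      4 * (κ * (t ^ 2 * σ2) + κ ^ (-δ) * (t ^ (2 + δ) * ∫ x, |x| ^ (2 + δ) ∂ρ)) := by
  have hL2 := memLp_two_of_integrable_rpow hδ hint
  have hi1 : Integrable (fun x : ℝ => x) ρ := hL2.integrable (by norm_num)
  have hi2 : Integrable (fun x : ℝ => x ^ 2) ρ := hL2.integrable_sq
  have hc1 : Integrable (fun x : ℝ => ((t * x : ℝ) : ℂ) * Complex.I) ρ :=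
    ((hi1.const_mul t).ofReal (𝕜 := ℂ)).mul_const _
  have hc2 : Integrable (fun x : ℝ => ((t * x : ℝ) : ℂ) ^ 2 / 2) ρ := by
    have := ((hi2.const_mul (t ^ 2)).ofReal (𝕜 := ℂ)).div_const 2
    refine this.congr (ae_of_all _ fun x => ?_)
    simp [mul_pow]
  have hc0 : Integrable (fun x : ℝ => Complex.exp (((t * x : ℝ) : ℂ) * Complex.I)) ρ :=
    Integrable.of_bound (by fun_prop) 1 (ae_of_all _ fun x => by
      rw [Complex.norm_exp_ofReal_mul_I])
  have e1 : ∫ x, ((t * x : ℝ) : ℂ) * Complex.I ∂ρ = 0 := by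
    rw [integral_mul_const, integral_complex_ofReal, integral_const_mul, hm]
    simp
  have e2 : ∫ x, ((t * x : ℝ) : ℂ) ^ 2 / 2 ∂ρ = (t : ℂ) ^ 2 * σ2 / 2 := by
    rw [integral_div]
    have : ∀ x : ℝ, ((t * x : ℝ) : ℂ) ^ 2 = ((t ^ 2 * x ^ 2 : ℝ) : ℂ) := fun x => by
      push_cast; ring
    simp_rw [this]
    rw [integral_complex_ofReal, integral_const_mul, hv]
    push_cast; ring
  have e : charFun ρ t - (1 - (t : ℂ) ^ 2 * σ2 / 2) =
      ∫ x, (Complex.exp (((t * x : ℝ) : ℂ) * Complex.I) - (1 + ((t * x : ℝ) : ℂ) * Complex.I -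
        ((t * x : ℝ) : ℂ) ^ 2 / 2)) ∂ρ := by
    have hA : Integrable (fun x : ℝ => (1 : ℂ) + ((t * x : ℝ) : ℂ) * Complex.I) ρ :=
      (integrable_const _).add hc1
    have hB : Integrable (fun x : ℝ => (1 : ℂ) + ((t * x : ℝ) : ℂ) * Complex.I -
        ((t * x : ℝ) : ℂ) ^ 2 / 2) ρ := hA.sub hc2
    rw [integral_sub hc0 hB, integral_sub hA hc2, integral_add (integrable_const _) hc1,
      e1, e2, charFun_apply_real]
    simp
  rw [e]
  have hbound : Integrable (fun x : ℝ => 4 * (κ * (t ^ 2 * x ^ 2) +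
      κ ^ (-δ) * (t ^ (2 + δ) * |x| ^ (2 + δ)))) ρ :=
    (((hi2.const_mul _).const_mul _).add ((hint.const_mul _).const_mul _)).const_mul _
  refine (norm_integral_le_of_norm_le hbound (ae_of_all _ fun x => ?_)).trans (le_of_eq ?_)
  · refine (norm_cexp_sub_le_sq_mul_min _).trans ?_
    have h := sq_mul_min_le (y := t * x) hκ hδ
    rw [abs_mul, abs_of_nonneg ht, Real.mul_rpow ht (abs_nonneg x), mul_pow] at h
    rw [mul_pow, abs_mul, abs_of_nonneg ht]
    linarith
  · rw [integral_const_mul, integral_add ((hi2.const_mul _).const_mul _)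
      ((hint.const_mul _).const_mul _)]
    simp_rw [integral_const_mul]
    rw [hv]

namespace LyapunovCondition

variable {N : ℕ → ℕ} {ρ : ℕ → Measure ℝ} {δ σ2 : ℝ}

/-- The comparison is with w = exp(−σ²/(2N)), whose N-th power is the limit itself. Both bases lie
in the unit disc, so the N-th powers differ by at most N times ‖φ − w‖, and both are expanded to
second order. -/
theorem tendsto_charFun_pow (h : LyapunovCondition N ρ δ σ2) (hN : Tendsto N atTop atTop) :
    Tendsto (fun n => charFun (ρ n) (√(N n))⁻¹ ^ N n) atTop (𝓝 (Complex.exp (-(σ2 / 2)))) := by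
  have hprob := h.isProbabilityMeasure
  have hδ := h.delta_pos
  obtain ⟨κ, hκ0, hκ, hκr⟩ := exists_tendsto_zero_rpow_neg_mul h.tendsto (fun n => by
    have : 0 ≤ ∫ x, |x| ^ (2 + δ) ∂ρ n := integral_nonneg fun x => by positivity
    positivity) hδ
  have hNr : Tendsto (fun n => (N n : ℝ)) atTop atTop := tendsto_natCast_atTop_atTop.comp hN
  have hlim : Tendsto (fun n => 4 * (κ n * σ2 + κ n ^ (-δ) * ((N n : ℝ) ^ (-(δ / 2)) *
      ∫ x, |x| ^ (2 + δ) ∂ρ n)) + (σ2 / 2) ^ 2 / N n) atTop (𝓝 0) := by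
    have := (((hκ.mul_const σ2).add hκr).const_mul 4).add
      (hNr.const_div_atTop ((σ2 / 2) ^ 2))
    simpa using this
  rw [tendsto_iff_norm_sub_tendsto_zero]
  refine squeeze_zero' (Eventually.of_forall fun _ => norm_nonneg _) ?_ hlim
  filter_upwards [h.integrable, h.mean, h.variance, hNr.eventually_ge_atTop 1,
    hNr.eventually_ge_atTop (σ2 / 2)] with n hint hm hv hN1 hNσ
  have hNpos : (0 : ℝ) < N n := by linarith
  have hσ : 0 ≤ σ2 := by rw [← hv]; exact integral_nonneg fun x => sq_nonneg x
  set t := (√(N n : ℝ))⁻¹ with ht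
  have ht0 : 0 ≤ t := by positivity
  have ht2 : t ^ 2 = (N n : ℝ)⁻¹ := by rw [ht, inv_pow, Real.sq_sqrt hNpos.le]
  have htδ : t ^ (2 + δ) = (N n : ℝ)⁻¹ * (N n : ℝ) ^ (-(δ / 2)) := by
    rw [ht, Real.sqrt_eq_rpow, ← Real.rpow_neg hNpos.le, ← Real.rpow_mul hNpos.le,
      ← Real.rpow_neg_one, ← Real.rpow_add hNpos]
    congr 1; ring
  have h1 := norm_charFun_sub_le hδ (hκ0 n) hint hm hv ht0
  set w : ℂ := Complex.exp (-(σ2 / 2) / N n) with hw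
  have hwN : w ^ N n = Complex.exp (-(σ2 / 2)) := by
    have hNc : (N n : ℂ) ≠ 0 := by exact_mod_cast hNpos.ne'
    rw [hw, ← Complex.exp_nat_mul, mul_div_cancel₀ _ hNc]
  have hwr : w = ((Real.exp (-(σ2 / 2 / N n)) : ℝ) : ℂ) := by
    rw [hw]; push_cast; congr 1; ring
  have hw1 : ‖w‖ ≤ 1 := by
    rw [hwr, Complex.norm_real, Real.norm_of_nonneg (Real.exp_pos _).le, Real.exp_le_one_iff]
    have : 0 ≤ σ2 / 2 / N n := by positivity
    linarith
  have h2 : ‖w - (1 - (t : ℂ) ^ 2 * σ2 / 2)‖ ≤ (σ2 / 2 / N n) ^ 2 := by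
    have h3 : w - (1 - (t : ℂ) ^ 2 * σ2 / 2)
        = ((Real.exp (-(σ2 / 2 / N n)) - 1 - -(σ2 / 2 / N n) : ℝ) : ℂ) := by
      rw [hwr, ← Complex.ofReal_pow, ht2]
      push_cast
      field_simp
      ring
    rw [h3, Complex.norm_real, Real.norm_eq_abs]
    have h4 : |-(σ2 / 2 / N n)| ≤ 1 := by
      rw [abs_neg, abs_of_nonneg (by positivity), div_le_one hNpos]; exact hNσ
    have := Real.abs_exp_sub_one_sub_id_le h4
    simpa using this
  rw [← hwN]
  refine (norm_pow_sub_pow_le (norm_charFun_le_one _) hw1 _).trans ?_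
  have h5 : ‖charFun (ρ n) t - w‖ ≤ ‖charFun (ρ n) t - (1 - (t : ℂ) ^ 2 * σ2 / 2)‖
      + ‖w - (1 - (t : ℂ) ^ 2 * σ2 / 2)‖ := by
    rw [← norm_neg (w - _)]
    refine le_trans (le_of_eq ?_) (norm_add_le _ _)
    congr 1; ring
  refine (mul_le_mul_of_nonneg_left (h5.trans (add_le_add h1 h2)) hNpos.le).trans (le_of_eq ?_)
  rw [htδ, ht2]
  field_simp

end LyapunovCondition

end Lyapunov


/-! ### Triangular arrays with i.i.d. rows: central limit theorem and law of large numbers. -/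

section IIDArray

theorem integral_sum_sq_eq {Ω ι : Type*} [MeasurableSpace Ω] [Fintype ι] {P : Measure Ω}
    [IsProbabilityMeasure P] {X : ι → Ω → ℝ} (hX : ∀ i, MemLp (X i) 2 P)
    (hind : Pairwise fun i j => IndepFun (X i) (X j) P) (hmean : ∀ i, ∫ ω, X i ω ∂P = 0) :
    ∫ ω, (∑ i, X i ω) ^ 2 ∂P = ∑ i, ∫ ω, X i ω ^ 2 ∂P := by
  have h1 := IndepFun.variance_sum (s := Finset.univ) (fun i _ => hX i)
    (fun i _ j _ hij => hind hij)
  rw [variance_of_integral_eq_zero] at h1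
  · have h2 : ∀ i, Var[X i; P] = ∫ ω, X i ω ^ 2 ∂P := fun i =>
      variance_of_integral_eq_zero (hX i).aemeasurable (hmean i)
    simpa [h2] using h1
  · exact (memLp_finsetSum' _ fun i _ => hX i).aemeasurable
  · simp only [Finset.sum_apply]
    rw [integral_finsetSum _ fun i _ => (hX i).integrable (by norm_num)]
    simp [hmean]

variable {Ω : ℕ → Type*} [∀ n, MeasurableSpace (Ω n)] {P : ∀ n, Measure (Ω n)}
  {N : ℕ → ℕ}

/-- A triangular array whose `n`-th row consists of `N n` i.i.d. real variables with law `ρ n`. -/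
structure IsIIDArray (P : ∀ n, Measure (Ω n)) (N : ℕ → ℕ) (u : ∀ n, Fin (N n) → Ω n → ℝ)
    (ρ : ℕ → Measure ℝ) : Prop where
  measurable : ∀ n i, Measurable (u n i)
  indep : ∀ n, iIndepFun (u n) (P n)
  map_eq : ∀ n i, (P n).map (u n i) = ρ n

namespace IsIIDArray

variable {u : ∀ n, Fin (N n) → Ω n → ℝ} {ρ : ℕ → Measure ℝ} {δ σ2 : ℝ}

theorem integral_comp (hu : IsIIDArray P N u ρ) {g : ℝ → ℝ} (hg : Measurable g) (n : ℕ)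
    (i : Fin (N n)) : ∫ ω, g (u n i ω) ∂P n = ∫ x, g x ∂ρ n := by
  rw [← hu.map_eq n i, integral_map (hu.measurable n i).aemeasurable hg.aestronglyMeasurable]

theorem integrable_comp (hu : IsIIDArray P N u ρ) {g : ℝ → ℝ} {n : ℕ}
    (hg : Integrable g (ρ n)) (i : Fin (N n)) : Integrable (fun ω => g (u n i ω)) (P n) := by
  rw [← hu.map_eq n i] at hg
  exact hg.comp_measurable (hu.measurable n i)

theorem memLp_comp (hu : IsIIDArray P N u ρ) {g : ℝ → ℝ} {n : ℕ}
    (hg : MemLp g 2 (ρ n)) (i : Fin (N n)) : MemLp (fun ω => g (u n i ω)) 2 (P n) := by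
  rw [← hu.map_eq n i] at hg
  exact hg.comp_of_map (hu.measurable n i).aemeasurable

theorem indepFun_comp (hu : IsIIDArray P N u ρ) {g : ℝ → ℝ} (hg : Measurable g) (n : ℕ) :
    Pairwise fun i j => IndepFun (fun ω => g (u n i ω)) (fun ω => g (u n j ω)) (P n) :=
  fun _ _ hij => ((hu.indep n).indepFun hij).comp hg hg

theorem tendsto_charFun_sum (hu : IsIIDArray P N u ρ) (h : LyapunovCondition N ρ δ σ2)
    (hN : Tendsto N atTop atTop) :
    Tendsto (fun n => ∫ ω, Complex.exp (((√(N n))⁻¹ * ∑ i, u n i ω : ℝ) * Complex.I) ∂P n)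
      atTop (𝓝 (Complex.exp (-(σ2 / 2)))) := by
  refine (h.tendsto_charFun_pow hN).congr fun n => ?_
  have h1 := congrFun ((hu.indep n).charFun_map_fun_sum_eq_prod
    fun i => (hu.measurable n i).aemeasurable) ((√(N n : ℝ))⁻¹)
  simp only [Finset.prod_apply, hu.map_eq, Finset.prod_const, Finset.card_univ,
    Fintype.card_fin] at h1
  rw [← h1, charFun_apply_real, integral_map
    (Finset.measurable_sum _ fun i _ => hu.measurable n i).aemeasurable (by fun_prop)]
  simp

/-- The normalised absolute moment of order `2 + δ` of a row is asymptotically negligible. -/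
theorem tendsto_sum_rpow (hu : IsIIDArray P N u ρ) (h : LyapunovCondition N ρ δ σ2)
    (hN : Tendsto N atTop atTop) :
    TendstoZeroInProb P fun n ω => (N n : ℝ) ^ (-(1 + δ / 2)) * ∑ i, |u n i ω| ^ (2 + δ) := by
  refine tendstoZeroInProb_of_integral_le h.tendsto ?_
  filter_upwards [h.integrable, hN.eventually_gt_atTop 0] with n hint hNn
  have hint' : ∀ i, Integrable (fun ω => |u n i ω| ^ (2 + δ)) (P n) := hu.integrable_comp hint
  have hsum : Integrable (fun ω => ∑ i, |u n i ω| ^ (2 + δ)) (P n) :=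
    integrable_finsetSum _ fun i _ => hint' i
  refine ⟨hsum.const_mul _, ?_⟩
  have hpos : (0 : ℝ) < N n := by exact_mod_cast hNn
  have habs : ∀ ω, |(N n : ℝ) ^ (-(1 + δ / 2)) * ∑ i, |u n i ω| ^ (2 + δ)|
      = (N n : ℝ) ^ (-(1 + δ / 2)) * ∑ i, |u n i ω| ^ (2 + δ) := fun ω =>
    abs_of_nonneg (mul_nonneg (by positivity) (Finset.sum_nonneg fun i _ => by positivity))
  simp_rw [habs]
  rw [integral_const_mul, integral_finsetSum _ fun i _ => hint' i]
  simp_rw [hu.integral_comp (g := fun x => |x| ^ (2 + δ)) (by fun_prop)]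
  rw [Finset.sum_const, Finset.card_univ, Fintype.card_fin, nsmul_eq_mul, ← mul_assoc,
    ← Real.rpow_add_one hpos.ne']
  refine le_of_eq ?_
  congr 2
  ring

variable [∀ n, IsProbabilityMeasure (P n)]

theorem integral_sum_sq (hu : IsIIDArray P N u ρ) {n : ℕ} {g : ℝ → ℝ} (hg : Measurable g)
    (hg2 : MemLp g 2 (ρ n)) (hmean : ∫ x, g x ∂ρ n = 0) :
    ∫ ω, (∑ i, g (u n i ω)) ^ 2 ∂P n = N n * ∫ x, g x ^ 2 ∂ρ n := by
  rw [integral_sum_sq_eq (hu.memLp_comp hg2) (hu.indepFun_comp hg n)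
    fun i => (hu.integral_comp hg n i).trans hmean]
  simp_rw [hu.integral_comp (g := fun x => g x ^ 2) (hg.pow_const 2)]
  simp

/-- Weak law of large numbers for the squares of a Lyapunov array. -/
theorem tendsto_mean_sq (hu : IsIIDArray P N u ρ) (h : LyapunovCondition N ρ δ σ2)
    (hN : Tendsto N atTop atTop) :
    TendstoZeroInProb P fun n ω => (∑ i, u n i ω ^ 2) / N n - σ2 := by
  have hδ := h.delta_pos
  have hprob := h.isProbabilityMeasure
  have hM0 : ∀ n, 0 ≤ ∫ x, |x| ^ (2 + δ) ∂ρ n := fun n => integral_nonneg fun x => by positivity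
  -- The exponent is δ/2 because discarding x² > κN costs a factor (κN)^(−δ/2) against |x|^(2+δ).
  obtain ⟨κ, hκ0, hκ, hκr⟩ := exists_tendsto_zero_rpow_neg_mul h.tendsto (fun n => by
    have := hM0 n
    positivity) (half_pos hδ)
  -- truncation of the squares at level `κ N`
  set f : ℕ → ℝ → ℝ := fun n => {x : ℝ | x ^ 2 ≤ κ n * N n}.indicator fun x => x ^ 2 with hf
  have hfm : ∀ n, Measurable (f n) := fun n =>
    (measurable_id.pow_const 2).indicator (measurableSet_le (by fun_prop) (by fun_prop))
  have hf0 : ∀ n x, 0 ≤ f n x := fun n x => Set.indicator_nonneg (fun x _ => sq_nonneg x) x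
  have hfle : ∀ n x, f n x ≤ x ^ 2 := fun n x =>
    Set.indicator_le_self' (fun x _ => sq_nonneg x) x
  have hfb : ∀ n x, f n x ≤ κ n * N n := fun n x => by
    by_cases hx : x ^ 2 ≤ κ n * N n
    · simp [hf, hx]
    · have : f n x = 0 := Set.indicator_of_notMem (s := {x : ℝ | x ^ 2 ≤ κ n * N n}) hx _
      rw [this]
      exact mul_nonneg (hκ0 n).le (Nat.cast_nonneg _)
  have hfL2 : ∀ n, MemLp (f n) 2 (ρ n) := fun n =>
    MemLp.of_bound (hfm n).aestronglyMeasurable (κ n * N n) (ae_of_all _ fun x => by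
      rw [Real.norm_of_nonneg (hf0 n x)]; exact hfb n x)
  have hg0 : ∀ n x, 0 ≤ x ^ 2 - f n x := fun n x => sub_nonneg.2 (hfle n x)
  have hgb : ∀ n, 0 < N n → ∀ x, x ^ 2 - f n x ≤
      κ n ^ (-(δ / 2)) * ((N n : ℝ) ^ (-(δ / 2)) * |x| ^ (2 + δ)) := fun n hn x => by
    have hNpos : (0 : ℝ) < N n := by exact_mod_cast hn
    have hpos : 0 < κ n * N n := mul_pos (hκ0 n) hNpos
    by_cases hx : x ^ 2 ≤ κ n * N n
    · have : f n x = x ^ 2 := Set.indicator_of_mem (s := {x : ℝ | x ^ 2 ≤ κ n * N n}) hx _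
      rw [this, sub_self]
      have := (hκ0 n).le
      positivity
    · have h1 : f n x = 0 := Set.indicator_of_notMem (s := {x : ℝ | x ^ 2 ≤ κ n * N n}) hx _
      push Not at hx
      have hx0 : 0 < |x| := abs_pos.2 fun h0 => by rw [h0] at hx; nlinarith
      rw [h1, sub_zero, ← mul_assoc, ← Real.mul_rpow (hκ0 n).le hNpos.le, Real.rpow_add hx0,
        Real.rpow_two, sq_abs, Real.rpow_neg hpos.le]
      have h2 : (κ n * N n) ^ (δ / 2) ≤ |x| ^ δ := by
        calc (κ n * N n) ^ (δ / 2) ≤ (|x| ^ 2) ^ (δ / 2) := by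
              rw [sq_abs]
              exact Real.rpow_le_rpow hpos.le hx.le (by positivity)
          _ = |x| ^ δ := by
              rw [← Real.rpow_natCast, ← Real.rpow_mul (abs_nonneg x)]
              congr 1; push_cast; ring
      have h3 : 1 ≤ ((κ n * N n) ^ (δ / 2))⁻¹ * |x| ^ δ := by
        rw [← div_eq_inv_mul, one_le_div (by positivity)]
        exact h2
      nlinarith [sq_nonneg x]
  -- The deviation of the mean square from σ² is `hA` + `hB` − `hC`. `hA` is the centred truncated
  -- part, with second moment at most E f² / N ≤ κσ²; `hB` is the discarded part and `hC` its
  -- expectation, both small in L¹.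
  have hA : TendstoZeroInProb P fun n ω =>
      (∑ i, (f n (u n i ω) - ∫ x, f n x ∂ρ n)) / N n := by
    refine tendstoZeroInProb_of_integral_sq_le (c := fun n => κ n * σ2)
      (by simpa using hκ.mul_const σ2) ?_
    filter_upwards [h.integrable, h.variance, hN.eventually_gt_atTop 0] with n hint hvar hNn
    have hNpos : (0 : ℝ) < N n := by exact_mod_cast hNn
    have hL2 := memLp_two_of_integrable_rpow hδ hint
    have hcL2 : MemLp (fun x => f n x - ∫ x, f n x ∂ρ n) 2 (ρ n) := (hfL2 n).sub (memLp_const _)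
    have hmean : ∫ x, (f n x - ∫ x, f n x ∂ρ n) ∂ρ n = 0 := by
      rw [integral_sub ((hfL2 n).integrable (by norm_num)) (integrable_const _)]
      simp
    constructor
    · have := (memLp_finsetSum Finset.univ fun i _ => hu.memLp_comp hcL2 i).integrable_sq
      simp_rw [div_pow]
      exact this.div_const _
    · simp_rw [div_pow]
      rw [integral_div, hu.integral_sum_sq ((hfm n).sub_const _) hcL2 hmean]
      have h1 : ∫ x, (f n x - ∫ x, f n x ∂ρ n) ^ 2 ∂ρ n ≤ ∫ x, f n x ^ 2 ∂ρ n := by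
        rw [← variance_eq_integral (hfm n).aemeasurable]
        exact variance_le_expectation_sq (hfm n).aestronglyMeasurable
      have h2 : ∫ x, f n x ^ 2 ∂ρ n ≤ κ n * N n * σ2 := by
        rw [← hvar, ← integral_const_mul]
        refine integral_mono (hfL2 n).integrable_sq (hL2.integrable_sq.const_mul _) fun x => ?_
        show f n x ^ 2 ≤ κ n * N n * x ^ 2
        rw [pow_two]
        exact mul_le_mul (hfb n x) (hfle n x) (hf0 n x)
          (mul_nonneg (hκ0 n).le (Nat.cast_nonneg _))
      rw [div_le_iff₀ (by positivity)]
      nlinarith [h1.trans h2]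
  have hB : TendstoZeroInProb P fun n ω => (∑ i, (u n i ω ^ 2 - f n (u n i ω))) / N n := by
    refine tendstoZeroInProb_of_integral_le hκr ?_
    filter_upwards [h.integrable, hN.eventually_gt_atTop 0] with n hint hNn
    have hNpos : (0 : ℝ) < N n := by exact_mod_cast hNn
    have hL2 := memLp_two_of_integrable_rpow hδ hint
    have hgi : Integrable (fun x => x ^ 2 - f n x) (ρ n) :=
      hL2.integrable_sq.sub ((hfL2 n).integrable (by norm_num))
    have hgi' : ∀ i, Integrable (fun ω => u n i ω ^ 2 - f n (u n i ω)) (P n) :=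
      hu.integrable_comp hgi
    refine ⟨(integrable_finsetSum _ fun i _ => hgi' i).div_const _, ?_⟩
    have habs : ∀ ω, |(∑ i, (u n i ω ^ 2 - f n (u n i ω))) / N n|
        = (∑ i, (u n i ω ^ 2 - f n (u n i ω))) / N n := fun ω =>
      abs_of_nonneg (div_nonneg (Finset.sum_nonneg fun i _ => hg0 n _) hNpos.le)
    simp_rw [habs]
    rw [integral_div, integral_finsetSum _ fun i _ => hgi' i]
    simp_rw [hu.integral_comp (g := fun x => x ^ 2 - f n x)
      ((measurable_id.pow_const 2).sub (hfm n))]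
    rw [Finset.sum_const, Finset.card_univ, Fintype.card_fin, nsmul_eq_mul,
      mul_div_cancel_left₀ _ hNpos.ne', ← integral_const_mul, ← integral_const_mul]
    exact integral_mono hgi ((hint.const_mul _).const_mul _) (hgb n hNn)
  have hC : TendstoZeroInProb P fun n _ => (∫ x, (x ^ 2 - f n x) ∂ρ n) := by
    refine tendstoZeroInProb_of_integral_le hκr ?_
    filter_upwards [h.integrable, hN.eventually_gt_atTop 0] with n hint hNn
    have hL2 := memLp_two_of_integrable_rpow hδ hint
    have hgi : Integrable (fun x => x ^ 2 - f n x) (ρ n) :=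
      hL2.integrable_sq.sub ((hfL2 n).integrable (by norm_num))
    refine ⟨integrable_const _, ?_⟩
    rw [integral_const, abs_of_nonneg (integral_nonneg (hg0 n))]
    simp only [probReal_univ, smul_eq_mul, one_mul]
    rw [← integral_const_mul, ← integral_const_mul]
    exact integral_mono hgi ((hint.const_mul _).const_mul _) (hgb n hNn)
  refine ((hA.add hB).sub hC).mono ?_
  filter_upwards [h.integrable, h.variance, hN.eventually_gt_atTop 0] with n hint hvar hNn ω
  have hNpos : (0 : ℝ) < N n := by exact_mod_cast hNn
  have hL2 := memLp_two_of_integrable_rpow hδ hint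
  refine le_of_eq ?_
  rw [integral_sub hL2.integrable_sq ((hfL2 n).integrable (by norm_num)), hvar,
    Finset.sum_sub_distrib, Finset.sum_sub_distrib, Finset.sum_const, Finset.card_univ,
    Fintype.card_fin, nsmul_eq_mul]
  congr 1
  field_simp
  ring

theorem measure_lt_abs_sum_le (hu : IsIIDArray P N u ρ) (h : LyapunovCondition N ρ δ σ2)
    (hN : Tendsto N atTop atTop) {K : ℝ} (hK : 0 < K) :
    ∀ᶠ n in atTop, P n {ω | K < |(√(N n))⁻¹ * ∑ i, u n i ω|} ≤ ENNReal.ofReal (σ2 / K ^ 2) := by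
  have hprob := h.isProbabilityMeasure
  filter_upwards [h.integrable, h.mean, h.variance, hN.eventually_gt_atTop 0]
    with n hint hmean hvar hNn
  have hNpos : (0 : ℝ) < N n := by exact_mod_cast hNn
  have hL2 := memLp_two_of_integrable_rpow h.delta_pos hint
  have hi : Integrable (fun ω => ((√(N n))⁻¹ * ∑ i, u n i ω) ^ 2) (P n) := by
    have := (memLp_finsetSum Finset.univ fun i _ => hu.memLp_comp hL2 i).integrable_sq
    simp_rw [mul_pow]
    exact this.const_mul _
  have h1 := measure_lt_abs_le_ofReal hi (ε := K ^ 2) (by positivity)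
  have h2 : ∫ ω, |((√(N n))⁻¹ * ∑ i, u n i ω) ^ 2| ∂P n = σ2 := by
    simp_rw [abs_pow, sq_abs, mul_pow]
    rw [integral_const_mul, hu.integral_sum_sq measurable_id' hL2 hmean, hvar, inv_pow,
      Real.sq_sqrt hNpos.le]
    field_simp
  rw [h2] at h1
  refine (measure_mono fun ω hω => ?_).trans h1
  simp only [Set.mem_ofPred_eq, abs_pow] at hω ⊢
  exact pow_lt_pow_left₀ hω hK.le two_ne_zero

end IsIIDArray

end IIDArray


/-! ### Perturbation of a nearly standardised planar sample. -/

section StandardArray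

/-- Young's inequality with weight η: |xy| ≤ ηx²/2 + y²/(2η). The two terms contribute at most η, as
the mean of x² is at most 2, and η/2. -/
theorem abs_mean_two_mul_le {N : ℕ} {x y : Fin N → ℝ} {η : ℝ} (hη : 0 < η) (hη1 : η ≤ 1)
    (hx : |(∑ i, x i ^ 2) / N - 1| ≤ η) (hy : (∑ i, y i ^ 2) / N ≤ η ^ 2) :
    |(∑ i, x i * y i) / N| ≤ 3 / 2 * η := by
  have h1 : ∀ i, |x i * y i| ≤ η / 2 * x i ^ 2 + (2 * η)⁻¹ * y i ^ 2 := fun i => by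
    have e : η / 2 * x i ^ 2 + (2 * η)⁻¹ * y i ^ 2
        = (2 * η)⁻¹ * (η ^ 2 * |x i| ^ 2 + |y i| ^ 2) := by
      rw [sq_abs, sq_abs]; field_simp
    rw [e, abs_mul, ← div_eq_inv_mul, le_div_iff₀ (by positivity)]
    nlinarith [sq_nonneg (η * |x i| - |y i|)]
  have h2 : |(∑ i, x i * y i) / N| ≤
      η / 2 * ((∑ i, x i ^ 2) / N) + (2 * η)⁻¹ * ((∑ i, y i ^ 2) / N) := by
    rw [abs_div, Nat.abs_cast, ← mul_div_assoc, ← mul_div_assoc, ← add_div]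
    gcongr
    rw [Finset.mul_sum, Finset.mul_sum, ← Finset.sum_add_distrib]
    exact (Finset.abs_sum_le_sum_abs _ _).trans (Finset.sum_le_sum fun i _ => h1 i)
  have h3 : (2 * η)⁻¹ * ((∑ i, y i ^ 2) / N) ≤ η / 2 := by
    calc (2 * η)⁻¹ * ((∑ i, y i ^ 2) / N) ≤ (2 * η)⁻¹ * η ^ 2 := by gcongr
      _ = η / 2 := by field_simp
  nlinarith [(abs_le.1 hx).2]

theorem abs_le_of_mean_sq_le {N : ℕ} (hN : 0 < N) {y : Fin N → ℝ} {η : ℝ} (hη : 0 ≤ η)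
    (hy : (∑ i, y i ^ 2) / N ≤ η ^ 2) (i : Fin N) : |y i| ≤ η * √N := by
  have hN' : (0 : ℝ) < N := by exact_mod_cast hN
  refine abs_le_of_sq_le_sq ?_ (by positivity)
  rw [mul_pow, Real.sq_sqrt hN'.le]
  rw [div_le_iff₀ hN'] at hy
  exact (Finset.single_le_sum (f := fun i => y i ^ 2) (fun i _ => sq_nonneg (y i))
    (Finset.mem_univ i)).trans hy

theorem abs_mean_sq_add_sub_one_le {N : ℕ} {a c : Fin N → ℝ} {η : ℝ} (hη : 0 < η) (hη1 : η ≤ 1)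
    (ha : |(∑ i, a i ^ 2) / N - 1| ≤ η) (hc : (∑ i, c i ^ 2) / N ≤ η ^ 2) :
    |(∑ i, (a i + c i) ^ 2) / N - 1| ≤ 5 * η := by
  have h1 := abs_mean_two_mul_le hη hη1 ha hc
  have e : (∑ i, (a i + c i) ^ 2) / (N : ℝ) - 1 = ((∑ i, a i ^ 2) / N - 1)
      + 2 * ((∑ i, a i * c i) / N) + (∑ i, c i ^ 2) / N := by
    have : ∀ i, (a i + c i) ^ 2 = a i ^ 2 + 2 * (a i * c i) + c i ^ 2 := fun i => by ring
    simp_rw [this, Finset.sum_add_distrib, ← Finset.mul_sum]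
    ring
  have h0 : 0 ≤ (∑ i, c i ^ 2) / (N : ℝ) :=
    div_nonneg (Finset.sum_nonneg fun i _ => sq_nonneg _) (Nat.cast_nonneg _)
  rw [e, abs_le]
  obtain ⟨h2, h3⟩ := abs_le.1 ha
  obtain ⟨h4, h5⟩ := abs_le.1 h1
  constructor <;> nlinarith

/-- The mean of the products a_i b_i comes by polarisation from the means of a², b² and (a + b)², so
a law of large numbers for squares of projections is enough. -/
theorem abs_mean_mul_add_le {N : ℕ} {a b c d : Fin N → ℝ} {η : ℝ} (hη : 0 < η) (hη1 : η ≤ 1)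
    (ha : |(∑ i, a i ^ 2) / N - 1| ≤ η) (hb : |(∑ i, b i ^ 2) / N - 1| ≤ η)
    (hab : |(∑ i, (a i + b i) ^ 2) / N - 2| ≤ η)
    (hc : (∑ i, c i ^ 2) / N ≤ η ^ 2) (hd : (∑ i, d i ^ 2) / N ≤ η ^ 2) :
    |(∑ i, (a i + c i) * (b i + d i)) / N| ≤ 6 * η := by
  have h1 := abs_mean_two_mul_le hη hη1 ha hd
  have h2 := abs_mean_two_mul_le hη hη1 hb hc
  have h3 : |(∑ i, c i * d i) / (N : ℝ)| ≤ η ^ 2 := by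
    have h4 : ∀ i, |c i * d i| ≤ (c i ^ 2 + d i ^ 2) / 2 := fun i => by
      rw [abs_mul]
      nlinarith [sq_nonneg (|c i| - |d i|), sq_abs (c i), sq_abs (d i)]
    calc |(∑ i, c i * d i) / (N : ℝ)| ≤ (∑ i, (c i ^ 2 + d i ^ 2) / 2) / N := by
          rw [abs_div, Nat.abs_cast]
          gcongr
          exact (Finset.abs_sum_le_sum_abs _ _).trans (Finset.sum_le_sum fun i _ => h4 i)
      _ = ((∑ i, c i ^ 2) / N + (∑ i, d i ^ 2) / N) / 2 := by
          rw [← Finset.sum_div, Finset.sum_add_distrib]; ring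
      _ ≤ η ^ 2 := by linarith
  have e : (∑ i, (a i + c i) * (b i + d i)) / (N : ℝ) =
      (((∑ i, (a i + b i) ^ 2) / N - 2) - ((∑ i, a i ^ 2) / N - 1) - ((∑ i, b i ^ 2) / N - 1)) / 2
      + (∑ i, a i * d i) / N + (∑ i, b i * c i) / N + (∑ i, c i * d i) / N := by
    have h5 : ∀ i, (a i + c i) * (b i + d i) = ((a i + b i) ^ 2 - a i ^ 2 - b i ^ 2) / 2
      + a i * d i + b i * c i + c i * d i := fun i => by ring
    simp_rw [h5, Finset.sum_add_distrib, ← Finset.sum_div, Finset.sum_sub_distrib]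
    ring
  rw [e, abs_le]
  obtain ⟨h6, h7⟩ := abs_le.1 ha
  obtain ⟨h8, h9⟩ := abs_le.1 hb
  obtain ⟨h10, h11⟩ := abs_le.1 hab
  obtain ⟨h12, h13⟩ := abs_le.1 h1
  obtain ⟨h14, h15⟩ := abs_le.1 h2
  obtain ⟨h16, h17⟩ := abs_le.1 h3
  constructor <;> nlinarith

/-- The relative error contributes 40 · 16 · 2 = 1280, and passing from A + C, B + D to A, B
contributes 4; 1300 rounds up the sum. -/
theorem abs_sub_sq_add_sq_le {A B C D K η ℓ : ℝ} (hK : 1 ≤ K) (hη : 0 < η) (hη1 : η ≤ 1)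
    (hA : |A| ≤ K) (hB : |B| ≤ K) (hC : |C| ≤ η) (hD : |D| ≤ η)
    (hle : |ℓ - ((A + C) ^ 2 + (B + D) ^ 2)| ≤
      40 * (16 * (K + 1) ^ 2 * η) * ((A + C) ^ 2 + (B + D) ^ 2)) :
    |ℓ - (A ^ 2 + B ^ 2)| ≤ 1300 * (K + 1) ^ 4 * η := by
  have hsq : ∀ {x y : ℝ}, |x| ≤ K → |y| ≤ η →
      (x + y) ^ 2 ≤ (K + 1) ^ 2 ∧ |(x + y) ^ 2 - x ^ 2| ≤ 2 * (K + 1) * η := by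
    intro x y hx hy
    constructor
    · exact sq_le_sq.2 ((abs_add_le _ _).trans (by rw [abs_of_nonneg (show 0 ≤ K + 1 by linarith)]; linarith))
    · have : (x + y) ^ 2 - x ^ 2 = (2 * x + y) * y := by ring
      rw [this, abs_mul]
      refine mul_le_mul ?_ hy (abs_nonneg _) (by linarith)
      refine (abs_add_le _ _).trans ?_
      rw [abs_mul, abs_two]
      linarith
  obtain ⟨h1, h2⟩ := hsq hA hC
  obtain ⟨h3, h4⟩ := hsq hB hD
  have h5 : 40 * (16 * (K + 1) ^ 2 * η) * ((A + C) ^ 2 + (B + D) ^ 2)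
      ≤ 40 * (16 * (K + 1) ^ 2 * η) * (2 * (K + 1) ^ 2) := by
    apply mul_le_mul_of_nonneg_left _ (by positivity)
    linarith
  have h6 : (K + 1) * η ≤ (K + 1) ^ 4 * η := by
    gcongr
    exact le_self_pow₀ (by linarith) (by norm_num)
  have h7 : |ℓ - (A ^ 2 + B ^ 2)| ≤ |ℓ - ((A + C) ^ 2 + (B + D) ^ 2)| +
      (|(A + C) ^ 2 - A ^ 2| + |(B + D) ^ 2 - B ^ 2|) := by
    have : ℓ - (A ^ 2 + B ^ 2) = (ℓ - ((A + C) ^ 2 + (B + D) ^ 2)) +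
      (((A + C) ^ 2 - A ^ 2) + ((B + D) ^ 2 - B ^ 2)) := by ring
    rw [this]
    exact (abs_add_le _ _).trans (add_le_add le_rfl (abs_add_le _ _))
  refine h7.trans ((add_le_add (hle.trans h5) (add_le_add h2 h4)).trans ?_)
  have h8 : 0 ≤ (K + 1) ^ 4 * η := by positivity
  nlinarith

/-- Stability of `-2 log` of the empirical likelihood ratio under small perturbations of a nearly
standardised sample. -/
theorem abs_neg_two_log_elRatio_add_sub_le {N : ℕ} (hN : 0 < N) {a b c d : Fin N → ℝ} {K η : ℝ}
    (hK : 1 ≤ K) (hη : 0 < η) (hηK : 16 * (K + 1) ^ 2 * η ≤ 1 / 40)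
    (hA : |(√N)⁻¹ * ∑ i, a i| ≤ K) (hB : |(√N)⁻¹ * ∑ i, b i| ≤ K)
    (hC : |(√N)⁻¹ * ∑ i, c i| ≤ η) (hD : |(√N)⁻¹ * ∑ i, d i| ≤ η)
    (hc : (∑ i, c i ^ 2) / N ≤ η ^ 2) (hd : (∑ i, d i ^ 2) / N ≤ η ^ 2)
    (ha2 : |(∑ i, a i ^ 2) / N - 1| ≤ η) (hb2 : |(∑ i, b i ^ 2) / N - 1| ≤ η)
    (hab : |(∑ i, (a i + b i) ^ 2) / N - 2| ≤ η)
    (ha : ∀ i, |a i| ≤ η * √N) (hb : ∀ i, |b i| ≤ η * √N) (hNη : (√N)⁻¹ ≤ η)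
    {R : Fin N → ℝ × ℝ} (hR₁ : ∀ i, (R i).1 = a i + c i) (hR₂ : ∀ i, (R i).2 = b i + d i) :
    0 < elRatio R ∧
    |-2 * Real.log (elRatio R) -
      (((√N)⁻¹ * ∑ i, a i) ^ 2 + ((√N)⁻¹ * ∑ i, b i) ^ 2)| ≤ 1300 * (K + 1) ^ 4 * η := by
  have hN' : (0 : ℝ) < N := by exact_mod_cast hN
  have hs : 0 < √(N : ℝ) := Real.sqrt_pos.2 hN'
  have hinv : (N : ℝ) * ((√(N : ℝ))⁻¹ * (√(N : ℝ))⁻¹) = 1 := by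
    rw [← mul_inv, Real.mul_self_sqrt hN'.le, mul_inv_cancel₀ hN'.ne']
  have hK2 : 1 ≤ (K + 1) ^ 2 := by nlinarith
  have hη1 : η ≤ 1 := by nlinarith
  have hmean : ∀ {x y : Fin N → ℝ}, |(√N)⁻¹ * ∑ i, x i| ≤ K → |(√N)⁻¹ * ∑ i, y i| ≤ η →
      ∑ i, (x i + y i) = N * ((√N)⁻¹ * ((√N)⁻¹ * ∑ i, x i + (√N)⁻¹ * ∑ i, y i)) ∧
      |(√N)⁻¹ * ((√N)⁻¹ * ∑ i, x i + (√N)⁻¹ * ∑ i, y i)| ≤ (√N)⁻¹ * (K + 1) := by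
    intro x y hx hy
    constructor
    · rw [Finset.sum_add_distrib]
      linear_combination (-(∑ i, x i + ∑ i, y i)) * hinv
    · rw [abs_mul, abs_of_pos (inv_pos.2 hs)]
      gcongr
      exact (abs_add_le _ _).trans (by linarith)
  obtain ⟨e₁, hm₁⟩ := hmean hA hC
  obtain ⟨e₂, hm₂⟩ := hmean hB hD
  have hκ : ∀ {x y : Fin N → ℝ}, (∀ i, |x i| ≤ η * √N) → (∑ i, y i ^ 2) / (N : ℝ) ≤ η ^ 2 →
      ∀ i, |x i + y i| ≤ 2 * η * √N := fun hx hy i =>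
    (abs_add_le _ _).trans (by linarith [hx i, abs_le_of_mean_sq_le hN hη.le hy i])
  -- `abs_neg_two_log_elRatio_sub_le` is applied with μ = (K + 1)/√N, κ = 2η√N and θ = 16(K + 1)²η.
  -- The factors √N cancel in 8μκ = 16(K + 1)η.
  have hμ : ((√(N : ℝ))⁻¹ * (K + 1)) ^ 2 ≤ 16 * (K + 1) ^ 2 * η := by
    rw [mul_pow]
    have h1 : ((√(N : ℝ))⁻¹) ^ 2 ≤ η := by
      calc ((√(N : ℝ))⁻¹) ^ 2 ≤ η ^ 2 := by gcongr
        _ ≤ η := by nlinarith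
    have h2 := mul_le_mul_of_nonneg_right h1 (sq_nonneg (K + 1))
    have h3 : 0 ≤ η * (K + 1) ^ 2 := by positivity
    linarith
  have hμκ : 8 * ((√(N : ℝ))⁻¹ * (K + 1)) * (2 * η * √N) ≤ 16 * (K + 1) ^ 2 * η := by
    have : 8 * ((√(N : ℝ))⁻¹ * (K + 1)) * (2 * η * √N) = 16 * (K + 1) * η := by
      field_simp; ring
    rw [this]
    gcongr
    nlinarith
  have h5θ : 6 * η ≤ 16 * (K + 1) ^ 2 * η := by
    gcongr
    linarith
  have hdiv : ∀ x : ℝ, x = N * (x / N) := fun x => by field_simp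
  have h₁₁ := (abs_mean_sq_add_sub_one_le hη hη1 ha2 hc).trans
    ((by linarith : 5 * η ≤ 6 * η).trans h5θ)
  have h₂₂ := (abs_mean_sq_add_sub_one_le hη hη1 hb2 hd).trans
    ((by linarith : 5 * η ≤ 6 * η).trans h5θ)
  have h₁₂ := (abs_mean_mul_add_le hη hη1 ha2 hb2 hab hc hd).trans h5θ
  have hκ₁ := hκ ha hc
  have hκ₂ := hκ hb hd
  simp only [← hR₁, ← hR₂] at e₁ e₂ h₁₁ h₂₂ h₁₂ hκ₁ hκ₂
  obtain ⟨hpos, hle⟩ := abs_neg_two_log_elRatio_sub_le hN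
    hηK hμ hμκ hκ₁ hκ₂ hm₁ hm₂ e₁ e₂ (hdiv _) (hdiv _) (hdiv _) h₁₁ h₂₂ h₁₂
  refine ⟨hpos, ?_⟩
  have hT : ∀ A B C D : ℝ, (N : ℝ) * (((√(N : ℝ))⁻¹ * (A + C)) ^ 2 + ((√(N : ℝ))⁻¹ * (B + D)) ^ 2)
      = (A + C) ^ 2 + (B + D) ^ 2 := fun A B C D => by
    rw [mul_pow, mul_pow, inv_pow, Real.sq_sqrt hN'.le]
    field_simp
  rw [hT] at hle
  exact abs_sub_sq_add_sq_le hK hη hη1 hA hB hC hD hle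

/-- One term of a nonnegative sum is at most the sum: this turns the negligible Lyapunov sum into a
bound on the row maximum. -/
theorem abs_le_of_sum_rpow_le {N : ℕ} (hN : 0 < N) {x : Fin N → ℝ} {δ η : ℝ} (hδ : 0 < δ)
    (hη : 0 ≤ η) (h : (N : ℝ) ^ (-(1 + δ / 2)) * ∑ i, |x i| ^ (2 + δ) ≤ η ^ (2 + δ)) (i : Fin N) :
    |x i| ≤ η * √N := by
  have hN' : (0 : ℝ) < N := by exact_mod_cast hN
  have h1 : |x i| ^ (2 + δ) ≤ ∑ i, |x i| ^ (2 + δ) :=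
    Finset.single_le_sum (f := fun i => |x i| ^ (2 + δ)) (fun i _ => by positivity)
      (Finset.mem_univ i)
  have h2 : √(N : ℝ) ^ (2 + δ) = (N : ℝ) ^ (1 + δ / 2) := by
    rw [Real.sqrt_eq_rpow, ← Real.rpow_mul hN'.le]
    congr 1; ring
  rw [← Real.rpow_le_rpow_iff (abs_nonneg _) (by positivity) (show 0 < 2 + δ by linarith),
    Real.mul_rpow hη (Real.sqrt_nonneg _), h2]
  rw [Real.rpow_neg hN'.le, ← div_eq_inv_mul, div_le_iff₀ (by positivity)] at h
  exact h1.trans h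

end StandardArray


/-! ### The central limit theorem and Wilks' theorem for standard arrays. -/

section StandardArray

variable {Ω : ℕ → Type*} [∀ n, MeasurableSpace (Ω n)] {P : ∀ n, Measure (Ω n)} {N : ℕ → ℕ}

/-- A triangular array of i.i.d. rows of planar vectors, all of whose one-dimensional projections
are standardised and satisfy Lyapunov's condition. -/
structure IsStandardArray (P : ∀ n, Measure (Ω n)) (N : ℕ → ℕ) (a b : ∀ n, Fin (N n) → Ω n → ℝ)
    (ρ : ℕ → Measure (ℝ × ℝ)) (δ : ℝ) : Prop where
  measurable_fst : ∀ n i, Measurable (a n i)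
  measurable_snd : ∀ n i, Measurable (b n i)
  indep : ∀ n, iIndepFun (fun i ω => (a n i ω, b n i ω)) (P n)
  map_eq : ∀ n i, (P n).map (fun ω => (a n i ω, b n i ω)) = ρ n
  lyapunov : ∀ s t : ℝ, LyapunovCondition N
    (fun n => (ρ n).map fun z => s * z.1 + t * z.2) δ (s ^ 2 + t ^ 2)

namespace IsStandardArray

variable {a b : ∀ n, Fin (N n) → Ω n → ℝ} {ρ : ℕ → Measure (ℝ × ℝ)} {δ : ℝ}

theorem isIIDArray (h : IsStandardArray P N a b ρ δ) (s t : ℝ) :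
    IsIIDArray P N (fun n i ω => s * a n i ω + t * b n i ω)
      (fun n => (ρ n).map fun z => s * z.1 + t * z.2) where
  measurable n i := ((h.measurable_fst n i).const_mul s).add ((h.measurable_snd n i).const_mul t)
  indep n := (h.indep n).comp (fun _ z => s * z.1 + t * z.2) fun _ => by fun_prop
  map_eq n i := by
    rw [← h.map_eq n i, Measure.map_map (by fun_prop)
      ((h.measurable_fst n i).prodMk (h.measurable_snd n i))]
    rfl

variable [∀ n, IsProbabilityMeasure (P n)]

/-- Central limit theorem for the squared norm of the normalised row sums. -/
theorem tendstoInDistribution_sum_sq (h : IsStandardArray P N a b ρ δ)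
    (hN : Tendsto N atTop atTop) :
    TendstoInDistribution
      (fun n ω => ((√(N n))⁻¹ * ∑ i, a n i ω) ^ 2 + ((√(N n))⁻¹ * ∑ i, b n i ω) ^ 2)
      atTop (fun t : ℝ => t) P (chiSquared 2) := by
  let W : ∀ n, Ω n → EuclideanSpace ℝ (Fin 2) := fun n ω =>
    WithLp.toLp 2 ![(√(N n))⁻¹ * ∑ i, a n i ω, (√(N n))⁻¹ * ∑ i, b n i ω]
  have hW : ∀ n, Measurable (W n) := fun n => by
    refine (WithLp.measurable_toLp 2 (Fin 2 → ℝ)).comp (measurable_pi_iff.2 fun j => ?_)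
    fin_cases j
    · exact (Finset.measurable_sum _ fun i _ => h.measurable_fst n i).const_mul _
    · exact (Finset.measurable_sum _ fun i _ => h.measurable_snd n i).const_mul _
  have hWlim : TendstoInDistribution W atTop (fun z => z) P
      (stdGaussian (EuclideanSpace ℝ (Fin 2))) := by
    refine ⟨fun n => (hW n).aemeasurable, aemeasurable_id', ?_⟩
    -- Cramér–Wold: the characteristic function at t is that of the projection t₀a + t₁b evaluated
    -- at 1, and each projection is again a Lyapunov array.
    refine ProbabilityMeasure.tendsto_iff_tendsto_charFun.2 fun t => ?_
    simp only [ProbabilityMeasure.coe_mk, Measure.map_id', charFun_stdGaussian]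
    have h1 := (h.isIIDArray (t 0) (t 1)).tendsto_charFun_sum (h.lyapunov (t 0) (t 1)) hN
    have h2 : Complex.exp (-(‖t‖ : ℂ) ^ 2 / 2)
        = Complex.exp (-((t 0 ^ 2 + t 1 ^ 2 : ℝ) / 2)) := by
      rw [← Complex.ofReal_pow, EuclideanSpace.norm_sq_eq]
      simp only [Fin.sum_univ_two, Real.norm_eq_abs, sq_abs, neg_div]
    rw [h2]
    refine h1.congr fun n => ?_
    rw [charFun_apply, integral_map (hW n).aemeasurable (by fun_prop)]
    congr 1
    ext ω
    congr 3
    simp only [W, PiLp.inner_apply, Fin.sum_univ_two, RCLike.inner_apply, conj_trivial]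
    simp only [Matrix.cons_val_zero, Matrix.cons_val_one, Finset.sum_add_distrib,
      ← Finset.mul_sum]
    ring
  have hcont : Continuous fun z : EuclideanSpace ℝ (Fin 2) => z 0 ^ 2 + z 1 ^ 2 := by fun_prop
  have h3 := hWlim.continuous_comp hcont
  refine tendstoInDistribution_of_map_eq h3 h3.forall_aemeasurable aemeasurable_id'
    (Eventually.of_forall fun n => rfl) ?_
  change Measure.map (fun t : ℝ => t) (chiSquared 2) = Measure.map
    (fun z : EuclideanSpace ℝ (Fin 2) => z 0 ^ 2 + z 1 ^ 2) (stdGaussian (EuclideanSpace ℝ (Fin 2)))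
  rw [Measure.map_id', ← map_pi_eq_stdGaussian, Measure.map_map hcont.measurable
    (WithLp.measurable_toLp 2 (Fin 2 → ℝ)), chiSquared]
  congr 1
  ext z
  simp [Fin.sum_univ_two]

/-- The nonparametric Wilks theorem for a perturbed standard array. -/
theorem tendsto_negTwoLog_elRatio (h : IsStandardArray P N a b ρ δ)
    (hN : Tendsto N atTop atTop) {R : ∀ n, Ω n → Fin (N n) → ℝ × ℝ} (hR : ∀ n, Measurable (R n))
    {s t : ℕ → ℝ} (hs : ∀ᶠ n in atTop, 0 < s n) (ht : ∀ᶠ n in atTop, 0 < t n)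
    (hc : TendstoZeroInProb P fun n ω =>
      (√(N n))⁻¹ * ∑ i, ((s n)⁻¹ * (R n ω i).1 - a n i ω))
    (hd : TendstoZeroInProb P fun n ω =>
      (√(N n))⁻¹ * ∑ i, ((t n)⁻¹ * (R n ω i).2 - b n i ω))
    (hc2 : TendstoZeroInProb P fun n ω => (∑ i, ((s n)⁻¹ * (R n ω i).1 - a n i ω) ^ 2) / N n)
    (hd2 : TendstoZeroInProb P fun n ω => (∑ i, ((t n)⁻¹ * (R n ω i).2 - b n i ω) ^ 2) / N n) :
    TendstoInDistribution (fun n ω => negTwoLog (elRatio (R n ω))) atTop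
      (fun t : ℝ => (t : EReal)) P (chiSquared 2) := by
  have hδ := (h.lyapunov 0 0).delta_pos
  have h10 := h.isIIDArray 1 0
  have h01 := h.isIIDArray 0 1
  -- The direction (1, 1) controls the mean of (a + b)², from which the cross moment is recovered.
  have h11 := h.isIIDArray 1 1
  have l10 := h.lyapunov 1 0
  have l01 := h.lyapunov 0 1
  have l11 := h.lyapunov 1 1
  refine tendstoInDistribution_coe_of_close (h.tendstoInDistribution_sum_sq hN) (fun n =>
    (measurable_negTwoLog.comp (measurable_elRatio.comp (hR n))).aemeasurable) fun ε hε => ?_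
  have abs_abs' : ∀ {f : ∀ n, Ω n → ℝ}, TendstoZeroInProb P f →
      TendstoZeroInProb P fun n ω => |f n ω| := fun hf =>
    hf.mono (Eventually.of_forall fun n ω => by rw [abs_abs])
  -- Nine nonnegative errors are added so that one event bounds all of them.
  have hG := abs_abs' hc |>.add (abs_abs' hd) |>.add (abs_abs' hc2) |>.add (abs_abs' hd2)
    |>.add (abs_abs' (h10.tendsto_mean_sq l10 hN)) |>.add (abs_abs' (h01.tendsto_mean_sq l01 hN))
    |>.add (abs_abs' (h11.tendsto_mean_sq l11 hN)) |>.add (abs_abs' (h10.tendsto_sum_rpow l10 hN))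
    |>.add (abs_abs' (h01.tendsto_sum_rpow l01 hN))
  rw [ENNReal.tendsto_nhds_zero]
  intro γ hγ
  -- The exceptional probability γ is split into thirds: two Chebyshev tails beyond K, and the event
  -- that the combined error exceeds a threshold chosen after K.
  obtain ⟨K, hK1, hKγ⟩ : ∃ K : ℝ, 1 ≤ K ∧ ENNReal.ofReal (1 / K ^ 2) ≤ γ / 3 := by
    have h1 : Tendsto (fun K : ℝ => ENNReal.ofReal (1 / K ^ 2)) atTop (𝓝 0) := by
      have : Tendsto (fun K : ℝ => 1 / K ^ 2) atTop (𝓝 0) :=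
        tendsto_const_nhds.div_atTop (tendsto_pow_atTop two_ne_zero)
      simpa using ENNReal.tendsto_ofReal this
    have h2 := (ENNReal.tendsto_nhds_zero.1 h1 (γ / 3)
      (ENNReal.div_pos hγ.ne' (by norm_num))).and (eventually_ge_atTop 1)
    obtain ⟨K, hK⟩ := h2.exists
    exact ⟨K, hK.2, hK.1⟩
  obtain ⟨η, hη0, hη1, hη2⟩ : ∃ η : ℝ, 0 < η ∧ 16 * (K + 1) ^ 2 * η ≤ 1 / 40 ∧
      1300 * (K + 1) ^ 4 * η ≤ ε := by
    have hpos2 : 0 < 16 * (K + 1) ^ 2 := by positivity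
    have hpos4 : 0 < 1300 * (K + 1) ^ 4 := by positivity
    refine ⟨min (1 / 40 / (16 * (K + 1) ^ 2)) (ε / (1300 * (K + 1) ^ 4)), by positivity, ?_, ?_⟩
    · rw [mul_comm, ← le_div_iff₀ hpos2]; exact min_le_left _ _
    · rw [mul_comm, ← le_div_iff₀ hpos4]; exact min_le_right _ _
  -- The three thresholds serve the normalised sums and second moments (η), the mean squares of the
  -- perturbations (η²) and the Lyapunov sums (η^(2+δ)).
  set ζ := min (min η (η ^ 2)) (η ^ (2 + δ)) with hζ
  have hζ0 : 0 < ζ := by positivity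
  have hζ1 : ζ ≤ η := (min_le_left _ _).trans (min_le_left _ _)
  have hζ2 : ζ ≤ η ^ 2 := (min_le_left _ _).trans (min_le_right _ _)
  have hζ3 : ζ ≤ η ^ (2 + δ) := min_le_right _ _
  have hNr : Tendsto (fun n => (√(N n : ℝ))⁻¹) atTop (𝓝 0) :=
    tendsto_inv_atTop_zero.comp (Real.tendsto_sqrt_atTop.comp
      (tendsto_natCast_atTop_atTop.comp hN))
  filter_upwards [ENNReal.tendsto_nhds_zero.1 (hG ζ hζ0) (γ / 3)
      (ENNReal.div_pos hγ.ne' (by norm_num)), h10.measure_lt_abs_sum_le l10 hN (zero_lt_one.trans_le hK1),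
    h01.measure_lt_abs_sum_le l01 hN (zero_lt_one.trans_le hK1), hN.eventually_gt_atTop 0,
    hNr.eventually_le_const hη0, hs, ht] with n hGn hAn hBn hNn hNη hsn htn
  have hthird : γ = γ / 3 + γ / 3 + γ / 3 := (ENNReal.add_thirds γ).symm
  simp only [one_mul, zero_mul, add_zero, zero_add, one_pow, ne_eq, OfNat.ofNat_ne_zero,
    not_false_eq_true, zero_pow] at hAn hBn hGn
  rw [hthird]
  refine le_trans ?_ (add_le_add (add_le_add (hAn.trans hKγ) (hBn.trans hKγ)) hGn)
  refine (measure_mono fun ω hω => ?_).trans ((measure_union_le _ _).trans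
    (add_le_add (measure_union_le _ _) le_rfl))
  by_contra hcon
  simp only [Set.mem_union, Set.mem_ofPred_eq, not_or, not_lt] at hcon
  obtain ⟨⟨hA, hB⟩, hsum⟩ := hcon
  replace hsum := (le_abs_self _).trans hsum
  have p1 := abs_nonneg ((√(N n : ℝ))⁻¹ * ∑ i, ((s n)⁻¹ * (R n ω i).1 - a n i ω))
  have p2 := abs_nonneg ((√(N n : ℝ))⁻¹ * ∑ i, ((t n)⁻¹ * (R n ω i).2 - b n i ω))
  have p3 := abs_nonneg ((∑ i, ((s n)⁻¹ * (R n ω i).1 - a n i ω) ^ 2) / (N n : ℝ))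
  have p4 := abs_nonneg ((∑ i, ((t n)⁻¹ * (R n ω i).2 - b n i ω) ^ 2) / (N n : ℝ))
  have p5 := abs_nonneg ((∑ i, a n i ω ^ 2) / (N n : ℝ) - 1)
  have p6 := abs_nonneg ((∑ i, b n i ω ^ 2) / (N n : ℝ) - 1)
  have p7 := abs_nonneg ((∑ i, (a n i ω + b n i ω) ^ 2) / (N n : ℝ) - (1 + 1))
  have p8 := abs_nonneg ((N n : ℝ) ^ (-(1 + δ / 2)) * ∑ i, |a n i ω| ^ (2 + δ))
  have p9 := abs_nonneg ((N n : ℝ) ^ (-(1 + δ / 2)) * ∑ i, |b n i ω| ^ (2 + δ))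
  have q3 := le_abs_self ((∑ i, ((s n)⁻¹ * (R n ω i).1 - a n i ω) ^ 2) / (N n : ℝ))
  have q4 := le_abs_self ((∑ i, ((t n)⁻¹ * (R n ω i).2 - b n i ω) ^ 2) / (N n : ℝ))
  have q8 := le_abs_self ((N n : ℝ) ^ (-(1 + δ / 2)) * ∑ i, |a n i ω| ^ (2 + δ))
  have q9 := le_abs_self ((N n : ℝ) ^ (-(1 + δ / 2)) * ∑ i, |b n i ω| ^ (2 + δ))
  have h2 : (1 + 1 : ℝ) = 2 := by norm_num
  obtain ⟨hpos, hle⟩ := abs_neg_two_log_elRatio_add_sub_le (a := fun i => a n i ω)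
    (b := fun i => b n i ω) (c := fun i => (s n)⁻¹ * (R n ω i).1 - a n i ω)
    (d := fun i => (t n)⁻¹ * (R n ω i).2 - b n i ω) hNn hK1 hη0 hη1 hA hB
    (by linarith) (by linarith) (by linarith) (by linarith) (by linarith) (by linarith)
    (by rw [← h2]; linarith)
    (abs_le_of_sum_rpow_le hNn hδ hη0.le (by linarith))
    (abs_le_of_sum_rpow_le hNn hδ hη0.le (by linarith)) hNη
    (R := fun i => ((s n)⁻¹ * (R n ω i).1, (t n)⁻¹ * (R n ω i).2))
    (fun i => by simp) (fun i => by simp)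
  rw [elRatio_scale (R n ω) (inv_ne_zero hsn.ne') (inv_ne_zero htn.ne')] at hpos hle
  refine hω ⟨-2 * Real.log (elRatio (R n ω)), ?_, hle.trans hη2⟩
  rw [negTwoLog, if_neg hpos.ne']

end IsStandardArray

end StandardArray


/-! ### Criteria for convergence in probability and for Lyapunov's condition. -/

section Criteria

variable {Ω : ℕ → Type*} [∀ n, MeasurableSpace (Ω n)] {P : ∀ n, Measure (Ω n)}

theorem TendstoZeroInProb.sq {f : ∀ n, Ω n → ℝ} (hf : TendstoZeroInProb P f) :
    TendstoZeroInProb P fun n ω => f n ω ^ 2 := fun ε hε => by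
  refine (hf (√ε) (Real.sqrt_pos.2 hε)).congr fun n => ?_
  congr 1
  ext ω
  simp only [Set.mem_ofPred_eq, abs_pow]
  exact Real.sqrt_lt hε.le (abs_nonneg _)

theorem tendstoZeroInProb_of_lintegral_le {f : ∀ n, Ω n → ℝ} {c : ℕ → ℝ}
    (hc : Tendsto c atTop (𝓝 0))
    (h : ∀ᶠ n in atTop, AEMeasurable (f n) (P n) ∧
      ∫⁻ ω, ENNReal.ofReal |f n ω| ∂P n ≤ ENNReal.ofReal (c n)) :
    TendstoZeroInProb P f := by
  have hc' : Tendsto (fun n => max (c n) 0) atTop (𝓝 0) := by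
    simpa using hc.max (tendsto_const_nhds (x := (0 : ℝ)))
  refine tendstoZeroInProb_of_integral_le hc' (h.mono fun n hn => ?_)
  have hint : Integrable (f n) (P n) := by
    refine ⟨hn.1.aestronglyMeasurable, ?_⟩
    rw [hasFiniteIntegral_iff_norm]
    exact hn.2.trans_lt ENNReal.ofReal_lt_top
  refine ⟨hint, ?_⟩
  rw [integral_eq_lintegral_of_nonneg_ae (ae_of_all _ fun _ => abs_nonneg _)
    hint.abs.aestronglyMeasurable]
  exact (ENNReal.toReal_mono ENNReal.ofReal_ne_top hn.2).trans (by rw [ENNReal.toReal_ofReal'])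

theorem abs_add_rpow_le {r : ℝ} (hr : 1 ≤ r) (x y : ℝ) :
    |x + y| ^ r ≤ 2 ^ (r - 1) * (|x| ^ r + |y| ^ r) := by
  refine (Real.rpow_le_rpow (abs_nonneg _) (abs_add_le x y) (by linarith)).trans ?_
  have := NNReal.rpow_add_le_mul_rpow_add_rpow (Real.nnabs x) (Real.nnabs y) hr
  exact_mod_cast this

/-- Lyapunov's condition for all linear combinations of two uncorrelated standardised variables. -/
theorem lyapunovCondition_of_moments {𝒳 : ℕ → Type*} [∀ n, MeasurableSpace (𝒳 n)]
    {π : ∀ n, Measure (𝒳 n)} [∀ n, IsProbabilityMeasure (π n)] {f g : ∀ n, 𝒳 n → ℝ}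
    (hfm : ∀ n, Measurable (f n)) (hgm : ∀ n, Measurable (g n)) {N : ℕ → ℕ} {δ : ℝ} (hδ : 0 < δ)
    (hfi : ∀ᶠ n in atTop, Integrable (fun x => |f n x| ^ (2 + δ)) (π n))
    (hgi : ∀ᶠ n in atTop, Integrable (fun x => |g n x| ^ (2 + δ)) (π n))
    (hf0 : ∀ᶠ n in atTop, ∫ x, f n x ∂π n = 0) (hg0 : ∀ᶠ n in atTop, ∫ x, g n x ∂π n = 0)
    (hf2 : ∀ᶠ n in atTop, ∫ x, f n x ^ 2 ∂π n = 1) (hg2 : ∀ᶠ n in atTop, ∫ x, g n x ^ 2 ∂π n = 1)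
    (hfg : ∀ᶠ n in atTop, ∫ x, f n x * g n x ∂π n = 0)
    (hf : Tendsto (fun n => (N n : ℝ) ^ (-(δ / 2)) * ∫ x, |f n x| ^ (2 + δ) ∂π n) atTop (𝓝 0))
    (hg : Tendsto (fun n => (N n : ℝ) ^ (-(δ / 2)) * ∫ x, |g n x| ^ (2 + δ) ∂π n) atTop (𝓝 0))
    (s t : ℝ) :
    LyapunovCondition N (fun n => ((π n).map fun x => (f n x, g n x)).map
      fun z => s * z.1 + t * z.2) δ (s ^ 2 + t ^ 2) := by
  have hm : ∀ n, Measurable fun x => s * f n x + t * g n x := fun n =>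
    ((hfm n).const_mul s).add ((hgm n).const_mul t)
  have hpm : Measurable fun x : ℝ => |x| ^ (2 + δ) := measurable_id.abs.pow_const _
  have hmap : ∀ n, ((π n).map fun x => (f n x, g n x)).map (fun z => s * z.1 + t * z.2)
      = (π n).map fun x => s * f n x + t * g n x := fun n => by
    rw [Measure.map_map (by fun_prop) ((hfm n).prodMk (hgm n))]
    rfl
  simp_rw [hmap]
  have hint : ∀ᶠ n in atTop, Integrable (fun x => |s * f n x + t * g n x| ^ (2 + δ)) (π n) ∧
      ∫ x, |s * f n x + t * g n x| ^ (2 + δ) ∂π n ≤ 2 ^ (2 + δ - 1) *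
        (|s| ^ (2 + δ) * (∫ x, |f n x| ^ (2 + δ) ∂π n) +
          |t| ^ (2 + δ) * (∫ x, |g n x| ^ (2 + δ) ∂π n)) := by
    filter_upwards [hfi, hgi] with n h1 h2
    have hb : ∀ x, |s * f n x + t * g n x| ^ (2 + δ) ≤ 2 ^ (2 + δ - 1) *
        (|s| ^ (2 + δ) * |f n x| ^ (2 + δ) + |t| ^ (2 + δ) * |g n x| ^ (2 + δ)) := fun x => by
      have := abs_add_rpow_le (r := 2 + δ) (by linarith) (s * f n x) (t * g n x)
      rwa [abs_mul, abs_mul, Real.mul_rpow (abs_nonneg _) (abs_nonneg _),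
        Real.mul_rpow (abs_nonneg _) (abs_nonneg _)] at this
    have hbi : Integrable (fun x => 2 ^ (2 + δ - 1) * (|s| ^ (2 + δ) * |f n x| ^ (2 + δ) +
        |t| ^ (2 + δ) * |g n x| ^ (2 + δ))) (π n) :=
      ((h1.const_mul _).add (h2.const_mul _)).const_mul _
    have hi : Integrable (fun x => |s * f n x + t * g n x| ^ (2 + δ)) (π n) :=
      hbi.mono' ((hm n).abs.pow_const _).aestronglyMeasurable (ae_of_all _ fun x => by
        rw [Real.norm_of_nonneg (by positivity)]; exact hb x)
    refine ⟨hi, (integral_mono hi hbi hb).trans (le_of_eq ?_)⟩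
    rw [integral_const_mul, integral_add (h1.const_mul _) (h2.const_mul _), integral_const_mul,
      integral_const_mul]
  refine ⟨fun n => Measure.isProbabilityMeasure_map (hm n).aemeasurable, hδ, ?_, ?_, ?_, ?_⟩
  · filter_upwards [hint] with n h1
    rw [integrable_map_measure hpm.aestronglyMeasurable
      (hm n).aemeasurable]
    exact h1.1
  · filter_upwards [hf0, hg0, hfi, hgi] with n h1 h2 h3 h4
    rw [integral_map (hm n).aemeasurable (by fun_prop), integral_add, integral_const_mul,
      integral_const_mul, h1, h2]
    · simp
    · exact ((memLp_two_of_integrable_abs_rpow hδ (hfm n).aestronglyMeasurable h3).integrable (by norm_num)).const_mul _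
    · exact ((memLp_two_of_integrable_abs_rpow hδ (hgm n).aestronglyMeasurable h4).integrable (by norm_num)).const_mul _
  · filter_upwards [hf2, hg2, hfg, hfi, hgi] with n h1 h2 h3 h4 h5
    have k1 := memLp_two_of_integrable_abs_rpow hδ (hfm n).aestronglyMeasurable h4
    have k2 := memLp_two_of_integrable_abs_rpow hδ (hgm n).aestronglyMeasurable h5
    rw [integral_map (hm n).aemeasurable (by fun_prop)]
    have e : ∀ x, (s * f n x + t * g n x) ^ 2
        = s ^ 2 * f n x ^ 2 + 2 * s * t * (f n x * g n x) + t ^ 2 * g n x ^ 2 := fun x => by ring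
    simp_rw [e]
    have i1 : Integrable (fun x => s ^ 2 * f n x ^ 2) (π n) := k1.integrable_sq.const_mul _
    have i2 : Integrable (fun x => 2 * s * t * (f n x * g n x)) (π n) :=
      (k1.integrable_mul k2).const_mul _
    have i3 : Integrable (fun x => t ^ 2 * g n x ^ 2) (π n) := k2.integrable_sq.const_mul _
    have i12 : Integrable (fun x => s ^ 2 * f n x ^ 2 + 2 * s * t * (f n x * g n x)) (π n) :=
      i1.add i2
    rw [integral_add i12 i3, integral_add i1 i2]
    simp_rw [integral_const_mul]
    rw [h1, h2, h3]
    ring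
  · have hlim : Tendsto (fun n => 2 ^ (2 + δ - 1) *
        (|s| ^ (2 + δ) * ((N n : ℝ) ^ (-(δ / 2)) * ∫ x, |f n x| ^ (2 + δ) ∂π n) +
          |t| ^ (2 + δ) * ((N n : ℝ) ^ (-(δ / 2)) * ∫ x, |g n x| ^ (2 + δ) ∂π n))) atTop (𝓝 0) := by
      simpa using ((hf.const_mul (|s| ^ (2 + δ))).add
        (hg.const_mul (|t| ^ (2 + δ)))).const_mul (2 ^ (2 + δ - 1))
    refine squeeze_zero' (Eventually.of_forall fun n => ?_) ?_ hlim
    · exact mul_nonneg (by positivity) (integral_nonneg fun x => by positivity)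
    · filter_upwards [hint] with n h1
      rw [integral_map (hm n).aemeasurable hpm.aestronglyMeasurable]
      refine (mul_le_mul_of_nonneg_left h1.2 (by positivity)).trans (le_of_eq ?_)
      ring

end Criteria


/-! ### Moments of ⟪Z, Z'⟫ and ⟪u, Z⟫ + ⟪u, Z'⟫ for independent copies Z, Z'. -/

section Kernel

variable {𝒳 E : Type*} [MeasurableSpace 𝒳] [NormedAddCommGroup E] [InnerProductSpace ℝ E]
  [MeasurableSpace E]

/-- A centred random vector with a finite absolute moment of order `2 + δ`. -/
structure IsCenteredVector (π : Measure 𝒳) (Z : 𝒳 → E) (δ : ℝ) : Prop where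
  pos : 0 < δ
  measurable : Measurable Z
  integrable_norm_rpow : Integrable (fun x => ‖Z x‖ ^ (2 + δ)) π
  integral_eq_zero : ∫ x, Z x ∂π = 0

namespace IsCenteredVector

variable [BorelSpace E] [SecondCountableTopology E] {π : Measure 𝒳} {Z : 𝒳 → E} {δ : ℝ}

theorem measurable_inner (h : IsCenteredVector π Z δ) :
    Measurable fun z : 𝒳 × 𝒳 => inner ℝ (Z z.1) (Z z.2) :=
  (h.measurable.comp measurable_fst).inner (h.measurable.comp measurable_snd)

theorem measurable_inner_add (h : IsCenteredVector π Z δ) (u : E) :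
    Measurable fun z : 𝒳 × 𝒳 => inner ℝ u (Z z.1) + inner ℝ u (Z z.2) :=
  ((h.measurable.comp measurable_fst).const_inner (c := u)).add
    ((h.measurable.comp measurable_snd).const_inner (c := u))

variable [IsProbabilityMeasure π]

theorem memLp_norm (h : IsCenteredVector π Z δ) : MemLp (fun x => ‖Z x‖) 2 π :=
  memLp_two_of_integrable_abs_rpow h.pos h.measurable.norm.aestronglyMeasurable
    (by simpa using h.integrable_norm_rpow)

theorem memLp (h : IsCenteredVector π Z δ) : MemLp Z 2 π :=
  (memLp_norm_iff h.measurable.aestronglyMeasurable).1 h.memLp_norm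

theorem integrable (h : IsCenteredVector π Z δ) : Integrable Z π := h.memLp.integrable (by norm_num)

theorem memLp_inner (h : IsCenteredVector π Z δ) (u : E) :
    MemLp (fun x => inner ℝ u (Z x)) 2 π := h.memLp.const_inner u

theorem integral_inner_eq_zero [CompleteSpace E] (h : IsCenteredVector π Z δ) (u : E) :
    ∫ x, inner ℝ u (Z x) ∂π = 0 := by
  rw [integral_inner h.integrable, h.integral_eq_zero, inner_zero_right]

theorem abs_inner_rpow_le (h : IsCenteredVector π Z δ) (x y : 𝒳) :
    |inner ℝ (Z x) (Z y)| ^ (2 + δ) ≤ ‖Z x‖ ^ (2 + δ) * ‖Z y‖ ^ (2 + δ) := by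
  have := h.pos
  rw [← Real.mul_rpow (norm_nonneg _) (norm_nonneg _)]
  exact Real.rpow_le_rpow (abs_nonneg _) (abs_real_inner_le_norm _ _) (by linarith)

theorem integrable_inner_rpow (h : IsCenteredVector π Z δ) :
    Integrable (fun z : 𝒳 × 𝒳 => |inner ℝ (Z z.1) (Z z.2)| ^ (2 + δ)) (π.prod π) :=
  (h.integrable_norm_rpow.mul_prod h.integrable_norm_rpow).mono'
    (h.measurable_inner.abs.pow_const _).aestronglyMeasurable (ae_of_all _ fun z => by
      rw [Real.norm_of_nonneg (by positivity)]
      exact h.abs_inner_rpow_le _ _)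

/-- Cauchy–Schwarz separates the two variables and independence factors the integral. -/
theorem integral_inner_rpow_le (h : IsCenteredVector π Z δ) :
    ∫ z : 𝒳 × 𝒳, |inner ℝ (Z z.1) (Z z.2)| ^ (2 + δ) ∂(π.prod π)
      ≤ (∫ x, ‖Z x‖ ^ (2 + δ) ∂π) ^ 2 := by
  refine (integral_mono h.integrable_inner_rpow
    (h.integrable_norm_rpow.mul_prod h.integrable_norm_rpow)
    fun z => h.abs_inner_rpow_le _ _).trans ?_
  rw [integral_prod_mul (fun x => ‖Z x‖ ^ (2 + δ)) (fun x => ‖Z x‖ ^ (2 + δ)), sq]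

theorem abs_inner_add_rpow_le (h : IsCenteredVector π Z δ) (u : E) (x y : 𝒳) :
    |inner ℝ u (Z x) + inner ℝ u (Z y)| ^ (2 + δ) ≤
      2 ^ (1 + δ) * ‖u‖ ^ (2 + δ) * (‖Z x‖ ^ (2 + δ) + ‖Z y‖ ^ (2 + δ)) := by
  have hδ := h.pos
  have h1 : ∀ x, |inner ℝ u (Z x)| ^ (2 + δ) ≤ ‖u‖ ^ (2 + δ) * ‖Z x‖ ^ (2 + δ) := fun x => by
    rw [← Real.mul_rpow (norm_nonneg _) (norm_nonneg _)]
    exact Real.rpow_le_rpow (abs_nonneg _) (abs_real_inner_le_norm _ _) (by linarith)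
  refine (abs_add_rpow_le (by linarith) _ _).trans ?_
  rw [mul_assoc, mul_add (‖u‖ ^ (2 + δ)), show 2 + δ - 1 = 1 + δ by ring]
  exact mul_le_mul_of_nonneg_left (add_le_add (h1 x) (h1 y)) (by positivity)

theorem integrable_norm_rpow_add (h : IsCenteredVector π Z δ) :
    Integrable (fun z : 𝒳 × 𝒳 => ‖Z z.1‖ ^ (2 + δ) + ‖Z z.2‖ ^ (2 + δ)) (π.prod π) :=
  (h.integrable_norm_rpow.comp_fst π).add (h.integrable_norm_rpow.comp_snd π)

theorem integrable_inner_add_rpow (h : IsCenteredVector π Z δ) (u : E) :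
    Integrable (fun z : 𝒳 × 𝒳 => |inner ℝ u (Z z.1) + inner ℝ u (Z z.2)| ^ (2 + δ))
      (π.prod π) :=
  (h.integrable_norm_rpow_add.const_mul (2 ^ (1 + δ) * ‖u‖ ^ (2 + δ))).mono'
    ((h.measurable_inner_add u).abs.pow_const _).aestronglyMeasurable (ae_of_all _ fun z => by
      rw [Real.norm_of_nonneg (by positivity)]
      exact h.abs_inner_add_rpow_le _ _ _)

theorem integral_inner_add_rpow_le (h : IsCenteredVector π Z δ) (u : E) :
    ∫ z : 𝒳 × 𝒳, |inner ℝ u (Z z.1) + inner ℝ u (Z z.2)| ^ (2 + δ) ∂(π.prod π)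
      ≤ 2 ^ (2 + δ) * ‖u‖ ^ (2 + δ) * ∫ x, ‖Z x‖ ^ (2 + δ) ∂π := by
  refine (integral_mono (h.integrable_inner_add_rpow u)
    (h.integrable_norm_rpow_add.const_mul _)
    fun z => h.abs_inner_add_rpow_le _ _ _).trans (le_of_eq ?_)
  rw [integral_const_mul, integral_add (h.integrable_norm_rpow.comp_fst π)
    (h.integrable_norm_rpow.comp_snd π), integral_fun_fst (fun x => ‖Z x‖ ^ (2 + δ)),
    integral_fun_snd (fun x => ‖Z x‖ ^ (2 + δ))]
  have e : (2 : ℝ) ^ (2 + δ) = 2 * 2 ^ (1 + δ) := by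
    rw [← Real.rpow_one_add' zero_le_two (by linarith [h.pos])]
    ring_nf
  rw [e]
  simp only [probReal_univ, one_smul]
  ring

theorem memLp_inner_prod (h : IsCenteredVector π Z δ) :
    MemLp (fun z : 𝒳 × 𝒳 => inner ℝ (Z z.1) (Z z.2)) 2 (π.prod π) :=
  memLp_two_of_integrable_abs_rpow h.pos h.measurable_inner.aestronglyMeasurable
    h.integrable_inner_rpow

theorem memLp_inner_fst (h : IsCenteredVector π Z δ) (u : E) :
    MemLp (fun z : 𝒳 × 𝒳 => inner ℝ u (Z z.1)) 2 (π.prod π) :=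
  (h.memLp_inner u).comp_fst π

theorem memLp_inner_snd (h : IsCenteredVector π Z δ) (u : E) :
    MemLp (fun z : 𝒳 × 𝒳 => inner ℝ u (Z z.2)) 2 (π.prod π) :=
  (h.memLp_inner u).comp_snd π

variable [CompleteSpace E]

theorem integral_inner_prod (h : IsCenteredVector π Z δ) :
    ∫ z : 𝒳 × 𝒳, inner ℝ (Z z.1) (Z z.2) ∂(π.prod π) = 0 := by
  rw [integral_prod _ (h.memLp_inner_prod.integrable (by norm_num))]
  simp [h.integral_inner_eq_zero]

theorem integral_inner_add (h : IsCenteredVector π Z δ) (u : E) :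
    ∫ z : 𝒳 × 𝒳, (inner ℝ u (Z z.1) + inner ℝ u (Z z.2)) ∂(π.prod π) = 0 := by
  rw [integral_add ((h.memLp_inner_fst u).integrable (by norm_num))
    ((h.memLp_inner_snd u).integrable (by norm_num)), integral_fun_fst (fun x => inner ℝ u (Z x)),
    integral_fun_snd (fun x => inner ℝ u (Z x)), h.integral_inner_eq_zero]
  simp

/-- The kernel ⟪Z, Z'⟫ is degenerate: in each of the two products, integrating first over the
variable that occurs only in the kernel gives zero. Hence the two statistics are uncorrelated. -/
theorem integral_inner_mul_inner_add (h : IsCenteredVector π Z δ) (u : E) :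
    ∫ z : 𝒳 × 𝒳, inner ℝ (Z z.1) (Z z.2) * (inner ℝ u (Z z.1) + inner ℝ u (Z z.2)) ∂(π.prod π)
      = 0 := by
  simp_rw [mul_add]
  have i1 : Integrable (fun z : 𝒳 × 𝒳 => inner ℝ (Z z.1) (Z z.2) * inner ℝ u (Z z.1))
      (π.prod π) := h.memLp_inner_prod.integrable_mul (h.memLp_inner_fst u)
  have i2 : Integrable (fun z : 𝒳 × 𝒳 => inner ℝ (Z z.1) (Z z.2) * inner ℝ u (Z z.2))
      (π.prod π) := h.memLp_inner_prod.integrable_mul (h.memLp_inner_snd u)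
  rw [integral_add i1 i2, integral_prod _ i1, integral_prod_symm _ i2]
  simp only [integral_mul_const, h.integral_inner_eq_zero]
  simp_rw [real_inner_comm (Z _) (Z _)]
  simp [h.integral_inner_eq_zero]

theorem integral_inner_add_sq (h : IsCenteredVector π Z δ) (u : E) :
    ∫ z : 𝒳 × 𝒳, (inner ℝ u (Z z.1) + inner ℝ u (Z z.2)) ^ 2 ∂(π.prod π)
      = 2 * ∫ x, inner ℝ u (Z x) ^ 2 ∂π := by
  simp_rw [add_sq]
  have i1 : Integrable (fun z : 𝒳 × 𝒳 => inner ℝ u (Z z.1) ^ 2) (π.prod π) :=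
    (h.memLp_inner_fst u).integrable_sq
  have i3 : Integrable (fun z : 𝒳 × 𝒳 => inner ℝ u (Z z.2) ^ 2) (π.prod π) :=
    (h.memLp_inner_snd u).integrable_sq
  have i2 : Integrable (fun z : 𝒳 × 𝒳 => 2 * inner ℝ u (Z z.1) * inner ℝ u (Z z.2))
      (π.prod π) := by
    simp_rw [mul_assoc]
    exact ((h.memLp_inner_fst u).integrable_mul (h.memLp_inner_snd u)).const_mul 2
  have i12 : Integrable (fun z : 𝒳 × 𝒳 => inner ℝ u (Z z.1) ^ 2 +
      2 * inner ℝ u (Z z.1) * inner ℝ u (Z z.2)) (π.prod π) := i1.add i2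
  rw [integral_add i12 i3, integral_add i1 i2, integral_fun_fst (fun x => inner ℝ u (Z x) ^ 2),
    integral_fun_snd (fun x => inner ℝ u (Z x) ^ 2), integral_prod _ i2]
  simp only [integral_const_mul, h.integral_inner_eq_zero]
  simp
  ring

end IsCenteredVector

end Kernel

/-! ### Rows of paired observations on a product space. -/

section PairedRows

/-- A pair of families is, up to a measure-preserving reshaping, a family of pairs. -/
theorem iIndepFun_prodMk_pi {𝒳 ι : Type*} [MeasurableSpace 𝒳] [Fintype ι] (π : Measure 𝒳)
    [IsProbabilityMeasure π] {F : Type*} [MeasurableSpace F] {φ : 𝒳 × 𝒳 → F} (hφ : Measurable φ) :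
    iIndepFun (fun i (ω : (ι → 𝒳) × (ι → 𝒳)) => φ (ω.1 i, ω.2 i))
      ((Measure.pi fun _ : ι => π).prod (Measure.pi fun _ : ι => π)) := by
  have h : iIndepFun (fun (i : ι) (ω : (ι → 𝒳) × (ι → 𝒳)) => (ω.1 i, ω.2 i))
      ((Measure.pi fun _ : ι => π).prod (Measure.pi fun _ : ι => π)) := by
    have hmp := (measurePreserving_arrowProdEquivProdArrow 𝒳 𝒳 ι (fun _ => π) fun _ => π).symm
    refine (iIndepFun_iff_map_fun_eq_pi_map fun i => ?_).2 ?_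
    · exact (((measurable_pi_apply i).comp measurable_fst).prodMk
        ((measurable_pi_apply i).comp measurable_snd)).aemeasurable
    · refine hmp.map_eq.trans (congrArg _ (funext fun i => ?_))
      exact (((measurePreserving_eval (fun _ : ι => π) i).prod
        (measurePreserving_eval (fun _ : ι => π) i)).map_eq).symm
  exact h.comp (fun _ => φ) fun _ => hφ

theorem map_prodMk_pi {𝒳 ι : Type*} [MeasurableSpace 𝒳] [Fintype ι] (π : Measure 𝒳)
    [IsProbabilityMeasure π] {F : Type*} [MeasurableSpace F] {φ : 𝒳 × 𝒳 → F} (hφ : Measurable φ)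
    (i : ι) :
    ((Measure.pi fun _ : ι => π).prod (Measure.pi fun _ : ι => π)).map
      (fun ω => φ (ω.1 i, ω.2 i)) = (π.prod π).map φ := by
  have h := (measurePreserving_eval (fun _ : ι => π) i).prod
    (measurePreserving_eval (fun _ : ι => π) i)
  rw [← h.map_eq, Measure.map_map hφ h.measurable]
  rfl

/-- Normalised degenerate and linear statistics of paired observations form a standard array. -/
theorem isStandardArray_pairs {𝒳 : ℕ → Type*} [∀ n, MeasurableSpace (𝒳 n)]
    {π : ∀ n, Measure (𝒳 n)} [∀ n, IsProbabilityMeasure (π n)] {ι : ℕ → Type*}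
    [∀ n, Fintype (ι n)] {Z : ∀ n, 𝒳 n → EuclideanSpace ℝ (ι n)}
    {u : ∀ n, EuclideanSpace ℝ (ι n)} {N : ℕ → ℕ} {δ : ℝ} (hZm : ∀ n, Measurable (Z n))
    (hδ : 0 < δ) (hZ : ∀ᶠ n in atTop, IsCenteredVector (π n) (Z n) δ) {s t q : ℕ → ℝ} {c C : ℝ}
    (hc : 0 < c) (hq : ∀ n, 0 < q n) (hu : ∀ n, ‖u n‖ = q n)
    (hK : ∀ᶠ n in atTop, ∫ x, ‖Z n x‖ ^ (2 + δ) ∂π n ≤ C * q n ^ (2 + δ))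
    (hs : ∀ᶠ n in atTop, c * q n ≤ s n) (ht : ∀ᶠ n in atTop, c * q n ≤ t n)
    (hs2 : ∀ᶠ n in atTop, ∫ z : 𝒳 n × 𝒳 n, inner ℝ (Z n z.1) (Z n z.2) ^ 2 ∂((π n).prod (π n))
      = s n ^ 2)
    (ht2 : ∀ᶠ n in atTop, 2 * ∫ x, inner ℝ (u n) (Z n x) ^ 2 ∂π n = t n ^ 2)
    (hqN : Tendsto (fun n => (N n : ℝ) ^ (-(δ / 2)) * q n ^ (2 + δ)) atTop (𝓝 0)) :
    IsStandardArray
      (fun n => (Measure.pi fun _ : Fin (N n) => π n).prod (Measure.pi fun _ : Fin (N n) => π n)) N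
      (fun n i ω => (s n)⁻¹ * inner ℝ (Z n (ω.1 i)) (Z n (ω.2 i)))
      (fun n i ω => (t n)⁻¹ * (inner ℝ (u n) (Z n (ω.1 i)) + inner ℝ (u n) (Z n (ω.2 i))))
      (fun n => ((π n).prod (π n)).map fun z => ((s n)⁻¹ * inner ℝ (Z n z.1) (Z n z.2),
        (t n)⁻¹ * (inner ℝ (u n) (Z n z.1) + inner ℝ (u n) (Z n z.2)))) δ := by
  have hm1 : ∀ n, Measurable fun z : 𝒳 n × 𝒳 n => (s n)⁻¹ * inner ℝ (Z n z.1) (Z n z.2) :=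
    fun n => (((hZm n).comp measurable_fst).inner ((hZm n).comp measurable_snd)).const_mul _
  have hm2 : ∀ n, Measurable fun z : 𝒳 n × 𝒳 n =>
      (t n)⁻¹ * (inner ℝ (u n) (Z n z.1) + inner ℝ (u n) (Z n z.2)) := fun n =>
    ((((hZm n).comp measurable_fst).const_inner (c := u n)).add
      (((hZm n).comp measurable_snd).const_inner (c := u n))).const_mul _
  have hev : ∀ n (i : Fin (N n)), Measurable
      fun ω : (Fin (N n) → 𝒳 n) × (Fin (N n) → 𝒳 n) => (ω.1 i, ω.2 i) := fun n i =>
    ((measurable_pi_apply i).comp measurable_fst).prodMk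
      ((measurable_pi_apply i).comp measurable_snd)
  -- Dividing by a scale of order at least q gains q^(−(2+δ)) in the moment of order 2 + δ.
  have hpos : ∀ r : ℕ → ℝ, (∀ᶠ n in atTop, c * q n ≤ r n) →
      ∀ᶠ n in atTop, 0 < r n ∧ |(r n)⁻¹| ^ (2 + δ) ≤ (c⁻¹) ^ (2 + δ) * (q n ^ (2 + δ))⁻¹ := by
    intro r hr
    filter_upwards [hr] with n hn
    have h0 : 0 < c * q n := mul_pos hc (hq n)
    refine ⟨h0.trans_le hn, ?_⟩
    rw [abs_of_pos (inv_pos.2 (h0.trans_le hn)), ← Real.inv_rpow (hq n).le,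
      ← Real.mul_rpow (by positivity) (inv_nonneg.2 (hq n).le), ← mul_inv]
    exact Real.rpow_le_rpow (inv_nonneg.2 (h0.le.trans hn)) (inv_anti₀ h0 hn) (by linarith)
  refine ⟨fun n i => (hm1 n).comp (hev n i), fun n i => (hm2 n).comp (hev n i),
    fun n => iIndepFun_prodMk_pi (π n) ((hm1 n).prodMk (hm2 n)),
    fun n i => map_prodMk_pi (π n) ((hm1 n).prodMk (hm2 n)) i,
    lyapunovCondition_of_moments hm1 hm2 hδ ?_ ?_ ?_ ?_ ?_ ?_ ?_ ?_ ?_⟩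
  · filter_upwards [hZ] with n h
    simp_rw [abs_mul, Real.mul_rpow (abs_nonneg _) (abs_nonneg _)]
    exact h.integrable_inner_rpow.const_mul _
  · filter_upwards [hZ] with n h
    simp_rw [abs_mul, Real.mul_rpow (abs_nonneg _) (abs_nonneg _)]
    exact (h.integrable_inner_add_rpow _).const_mul _
  · filter_upwards [hZ] with n h
    rw [integral_const_mul, h.integral_inner_prod, mul_zero]
  · filter_upwards [hZ] with n h
    rw [integral_const_mul, h.integral_inner_add, mul_zero]
  · filter_upwards [hs2, hpos s hs] with n h1 h2
    simp_rw [mul_pow]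
    rw [integral_const_mul, h1, ← mul_pow, inv_mul_cancel₀ h2.1.ne', one_pow]
  · filter_upwards [hZ, ht2, hpos t ht] with n h h1 h2
    simp_rw [mul_pow]
    rw [integral_const_mul, h.integral_inner_add_sq, h1, ← mul_pow, inv_mul_cancel₀ h2.1.ne',
      one_pow]
  · filter_upwards [hZ] with n h
    simp_rw [mul_mul_mul_comm]
    rw [integral_const_mul, h.integral_inner_mul_inner_add, mul_zero]
  -- The moment of the kernel is at most (C q^(2+δ))², so one factor q^(2+δ) survives normalisation;
  -- `hqN` makes it negligible. In the linear statistic the second factor q^(2+δ) comes from ‖u‖ =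
  -- q.
  · have hlim : Tendsto (fun n => (c⁻¹) ^ (2 + δ) * C ^ 2 *
        ((N n : ℝ) ^ (-(δ / 2)) * q n ^ (2 + δ))) atTop (𝓝 0) := by
      simpa using hqN.const_mul ((c⁻¹) ^ (2 + δ) * C ^ 2)
    refine squeeze_zero' (Eventually.of_forall fun n =>
      mul_nonneg (by positivity) (integral_nonneg fun x => by positivity)) ?_ hlim
    filter_upwards [hZ, hK, hpos s hs] with n h h1 h2
    simp_rw [abs_mul, Real.mul_rpow (abs_nonneg _) (abs_nonneg _)]
    rw [integral_const_mul]
    have hQ : 0 < q n ^ (2 + δ) := Real.rpow_pos_of_pos (hq n) _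
    have h0 : 0 ≤ ∫ x, ‖Z n x‖ ^ (2 + δ) ∂π n := integral_nonneg fun x => by positivity
    have h3 : ∫ z : 𝒳 n × 𝒳 n, |inner ℝ (Z n z.1) (Z n z.2)| ^ (2 + δ) ∂((π n).prod (π n))
        ≤ (C * q n ^ (2 + δ)) ^ 2 :=
      h.integral_inner_rpow_le.trans (pow_le_pow_left₀ h0 h1 2)
    have h4 := mul_le_mul h2.2 h3 (integral_nonneg fun x => by positivity) (by positivity)
    refine (mul_le_mul_of_nonneg_left h4 (by positivity)).trans (le_of_eq ?_)
    field_simp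
  · have hlim : Tendsto (fun n => (c⁻¹) ^ (2 + δ) * 2 ^ (2 + δ) * C *
        ((N n : ℝ) ^ (-(δ / 2)) * q n ^ (2 + δ))) atTop (𝓝 0) := by
      simpa using hqN.const_mul ((c⁻¹) ^ (2 + δ) * 2 ^ (2 + δ) * C)
    refine squeeze_zero' (Eventually.of_forall fun n =>
      mul_nonneg (by positivity) (integral_nonneg fun x => by positivity)) ?_ hlim
    filter_upwards [hZ, hK, hpos t ht] with n h h1 h2
    simp_rw [abs_mul, Real.mul_rpow (abs_nonneg _) (abs_nonneg _)]
    rw [integral_const_mul]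
    have hQ : 0 < q n ^ (2 + δ) := Real.rpow_pos_of_pos (hq n) _
    have h3 : ∫ z : 𝒳 n × 𝒳 n, |inner ℝ (u n) (Z n z.1) + inner ℝ (u n) (Z n z.2)| ^ (2 + δ)
        ∂((π n).prod (π n)) ≤ 2 ^ (2 + δ) * q n ^ (2 + δ) * (C * q n ^ (2 + δ)) := by
      refine (h.integral_inner_add_rpow_le (u n)).trans ?_
      rw [hu n]
      exact mul_le_mul_of_nonneg_left h1 (by positivity)
    have h4 := mul_le_mul h2.2 h3 (integral_nonneg fun x => by positivity) (by positivity)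
    refine (mul_le_mul_of_nonneg_left h4 (by positivity)).trans (le_of_eq ?_)
    field_simp

end PairedRows


universe v

/-! ### The two error functionals, absolute sum and Euclidean norm, treated uniformly. -/

noncomputable section ErrorSeminorm

/-- A seminorm on `ℝ^N` dominated by the `ℓ¹` norm, whose second moment at a vector of pairwise
independent centred variables is at most the sum of their variances. -/
structure IsErrorSeminorm.{w} {N : ℕ} (Φ : Seminorm ℝ (Fin N → ℝ)) : Prop where
  measurable : Measurable Φ
  le_sum_abs : ∀ c, Φ c ≤ ∑ i, |c i|
  integral_sq_le : ∀ {Ω : Type w} [MeasurableSpace Ω] (P : Measure Ω) [IsProbabilityMeasure P]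
    (X : Fin N → Ω → ℝ), (∀ i, MemLp (X i) 2 P) →
    (Pairwise fun i j => IndepFun (X i) (X j) P) → (∀ i, ∫ ω, X i ω ∂P = 0) →
    ∫ ω, Φ (fun i => X i ω) ^ 2 ∂P ≤ ∑ i, ∫ ω, X i ω ^ 2 ∂P

/-- The absolute value of the sum of the coordinates. -/
def absSumSeminorm (N : ℕ) : Seminorm ℝ (Fin N → ℝ) :=
  (normSeminorm ℝ ℝ).comp (∑ i, LinearMap.proj i)

theorem absSumSeminorm_apply {N : ℕ} (c : Fin N → ℝ) : absSumSeminorm N c = |∑ i, c i| := by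
  simp [absSumSeminorm]

/-- The Euclidean norm on `ℝ^N`. -/
def euclideanSeminorm (N : ℕ) : Seminorm ℝ (Fin N → ℝ) :=
  (normSeminorm ℝ (EuclideanSpace ℝ (Fin N))).comp (WithLp.linearEquiv 2 ℝ (Fin N → ℝ)).symm.toLinearMap

theorem euclideanSeminorm_apply {N : ℕ} (c : Fin N → ℝ) :
    euclideanSeminorm N c = √(∑ i, c i ^ 2) := by
  simp [euclideanSeminorm, EuclideanSpace.norm_eq]

theorem isErrorSeminorm_absSum (N : ℕ) : IsErrorSeminorm.{v} (absSumSeminorm N) where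
  measurable := by
    rw [funext absSumSeminorm_apply]
    fun_prop
  le_sum_abs c := by
    rw [absSumSeminorm_apply]
    exact Finset.abs_sum_le_sum_abs _ _
  integral_sq_le P _ X h1 h2 h3 := by
    simp_rw [absSumSeminorm_apply, sq_abs]
    exact (integral_sum_sq_eq h1 h2 h3).le

theorem isErrorSeminorm_euclidean (N : ℕ) : IsErrorSeminorm.{v} (euclideanSeminorm N) where
  measurable := by
    rw [funext euclideanSeminorm_apply]
    fun_prop
  le_sum_abs c := by
    rw [euclideanSeminorm_apply]
    refine Real.sqrt_le_iff.2 ⟨Finset.sum_nonneg fun i _ => abs_nonneg _, ?_⟩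
    simp_rw [← sq_abs (c _)]
    exact Finset.sum_sq_le_sq_sum_of_nonneg fun i _ => abs_nonneg _
  integral_sq_le P _ X h1 h2 h3 := by
    simp_rw [euclideanSeminorm_apply]
    have e : ∀ ω, √(∑ i, X i ω ^ 2) ^ 2 = ∑ i, X i ω ^ 2 := fun ω =>
      Real.sq_sqrt (Finset.sum_nonneg fun i _ => sq_nonneg _)
    simp_rw [e]
    exact (integral_finsetSum _ fun i _ => (h1 i).integrable_sq).le

end ErrorSeminorm

/-! ### Expected effect of a small perturbation of the vectors Z. -/

section Perturbation

theorem lintegral_ofReal_le_of_integral_sq_le {Ω : Type*} [MeasurableSpace Ω] {P : Measure Ω}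
    [IsProbabilityMeasure P] {h : Ω → ℝ} (hh : MemLp h 2 P) (h0 : 0 ≤ h) {c : ℝ} (hc : 0 ≤ c)
    (hle : ∫ ω, h ω ^ 2 ∂P ≤ c ^ 2) : ∫⁻ ω, ENNReal.ofReal (h ω) ∂P ≤ ENNReal.ofReal c := by
  rw [← ofReal_integral_eq_lintegral_ofReal (hh.integrable (by norm_num)) (ae_of_all _ h0)]
  refine ENNReal.ofReal_le_ofReal (abs_le_of_sq_le_sq' ?_ hc).2
  have h1 := variance_nonneg h P
  rw [variance_eq_sub hh] at h1
  simp only [Pi.pow_apply] at h1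
  linarith

variable {𝒳 : Type v} {E : Type*} [MeasurableSpace 𝒳] [NormedAddCommGroup E] [InnerProductSpace ℝ E]
  [MeasurableSpace E] [BorelSpace E] [SecondCountableTopology E]
  {π : Measure 𝒳} [IsProbabilityMeasure π] {Z : 𝒳 → E} {δ : ℝ} {N : ℕ}

theorem sum_abs_inner_le (a b : Fin N → E) :
    ∑ i, |inner ℝ (a i) (b i)| ≤ √(∑ i, ‖a i‖ ^ 2) * √(∑ i, ‖b i‖ ^ 2) :=
  (Finset.sum_le_sum fun i _ => abs_real_inner_le_norm (a i) (b i)).trans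
    (Real.sum_mul_le_sqrt_mul_sqrt _ _ _)

variable {Φ : Seminorm ℝ (Fin N → ℝ)}

/-- For fixed d the variables ⟪Z(x_i), d_i⟫ are independent and centred, so their variances add.
Summing absolute values instead would lose a factor √N. -/
theorem IsErrorSeminorm.lintegral_inner_le [CompleteSpace E] (hΦ : IsErrorSeminorm.{v} Φ)
    (hZ : IsCenteredVector π Z δ) {M : ℝ} (hM : 0 ≤ M) (hZ2 : ∫ x, ‖Z x‖ ^ 2 ∂π ≤ M ^ 2)
    (d : Fin N → E) :
    ∫⁻ x, ENNReal.ofReal (Φ fun i => inner ℝ (Z (x i)) (d i)) ∂(Measure.pi fun _ : Fin N => π)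
      ≤ ENNReal.ofReal (M * √(∑ i, ‖d i‖ ^ 2)) := by
  have hX1 : ∀ i, MemLp (fun x => inner ℝ (Z x) (d i)) 2 π := fun i => by
    simpa only [real_inner_comm] using hZ.memLp_inner (d i)
  have hX : ∀ i, MemLp (fun x : Fin N → 𝒳 => inner ℝ (Z (x i)) (d i)) 2
      (Measure.pi fun _ : Fin N => π) := fun i =>
    (hX1 i).comp_measurePreserving (measurePreserving_eval (fun _ : Fin N => π) i)
  have hmeas : ∀ i, Measurable fun x => inner ℝ (Z x) (d i) := fun i =>
    hZ.measurable.inner_const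
  have hXm : ∀ i, Measurable fun x : Fin N → 𝒳 => inner ℝ (Z (x i)) (d i) := fun i =>
    (hmeas i).comp (measurable_pi_apply i)
  have hint : ∀ (i : Fin N) (g : 𝒳 → ℝ), Measurable g →
      ∫ x, g (x i) ∂(Measure.pi fun _ : Fin N => π) = ∫ x, g x ∂π := fun i g hg => by
    have h := (measurePreserving_eval (fun _ : Fin N => π) i).map_eq
    rw [← integral_map (φ := Function.eval i) (measurable_pi_apply i).aemeasurable
      (by rw [h]; exact hg.aestronglyMeasurable), h]
  have hsq := hΦ.integral_sq_le (Measure.pi fun _ : Fin N => π) _ hX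
    (fun i j hij => (iIndepFun_pi (μ := fun _ : Fin N => π)
      fun i => (hmeas i).aemeasurable).indepFun hij)
    (fun i => by
      rw [hint i _ (hmeas i)]
      simp_rw [real_inner_comm (d i)]
      exact hZ.integral_inner_eq_zero (d i))
  have hb : ∀ x : Fin N → 𝒳, ‖Φ fun i => inner ℝ (Z (x i)) (d i)‖ ≤
      ∑ i, |inner ℝ (Z (x i)) (d i)| := fun x => by
    rw [Real.norm_of_nonneg (apply_nonneg Φ _)]
    exact hΦ.le_sum_abs _
  have hmem : MemLp (fun x : Fin N → 𝒳 => Φ fun i => inner ℝ (Z (x i)) (d i)) 2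
      (Measure.pi fun _ : Fin N => π) :=
    (memLp_finsetSum Finset.univ fun i _ => (hX i).abs).mono
      (hΦ.measurable.comp (measurable_pi_iff.2 hXm)).aestronglyMeasurable
      (ae_of_all _ fun x => (hb x).trans (le_abs_self _))
  refine lintegral_ofReal_le_of_integral_sq_le hmem (fun x => apply_nonneg Φ _) (by positivity)
    (hsq.trans ?_)
  rw [mul_pow, Real.sq_sqrt (Finset.sum_nonneg fun i _ => by positivity), Finset.mul_sum]
  refine Finset.sum_le_sum fun i _ => ?_
  rw [hint i _ ((hmeas i).pow_const 2), mul_comm]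
  have h2 : ∫ x, inner ℝ (Z x) (d i) ^ 2 ∂π ≤ ∫ x, ‖d i‖ ^ 2 * ‖Z x‖ ^ 2 ∂π := by
    refine integral_mono (hX1 i).integrable_sq (hZ.memLp_norm.integrable_sq.const_mul _)
      fun x => ?_
    rw [← mul_pow, ← sq_abs, mul_comm ‖d i‖]
    exact pow_le_pow_left₀ (abs_nonneg _) (abs_real_inner_le_norm _ _) 2
  rw [integral_const_mul] at h2
  exact h2.trans (mul_le_mul_of_nonneg_left hZ2 (by positivity))

/-- The random vectors `D x i` have joint size at most `Λ x`, whose mean is at most `B`. -/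
structure IsSmallPerturbation (π : Measure 𝒳) (D : (Fin N → 𝒳) → Fin N → E)
    (Λ : (Fin N → 𝒳) → ℝ) (B : ℝ) : Prop where
  measurable : ∀ i, Measurable fun x => D x i
  measurable_bound : Measurable Λ
  nonneg : 0 ≤ B
  sqrt_sum_norm_sq_le : ∀ x, √(∑ i, ‖D x i‖ ^ 2) ≤ Λ x
  norm_sum_le : ∀ x, ‖∑ i, D x i‖ ≤ Λ x
  lintegral_le : ∫⁻ x, ENNReal.ofReal (Λ x) ∂(Measure.pi fun _ : Fin N => π) ≤ ENNReal.ofReal B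

variable {D : (Fin N → 𝒳) → Fin N → E} {Λ : (Fin N → 𝒳) → ℝ} {B : ℝ}

theorem IsSmallPerturbation.bound_nonneg (hD : IsSmallPerturbation π D Λ B) (x : Fin N → 𝒳) :
    0 ≤ Λ x := (Real.sqrt_nonneg _).trans (hD.sqrt_sum_norm_sq_le x)

theorem IsErrorSeminorm.le_inner_error (hΦ : IsErrorSeminorm.{v} Φ)
    (hD : IsSmallPerturbation π D Λ B) (x y : Fin N → 𝒳) :
    Φ (fun i => inner ℝ (Z (x i) - D x i) (Z (y i) - D y i) - inner ℝ (Z (x i)) (Z (y i))) ≤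
      Φ (fun i => inner ℝ (Z (x i)) (D y i)) + Φ (fun i => inner ℝ (Z (y i)) (D x i)) +
        Λ x * Λ y := by
  have e : (fun i => inner ℝ (Z (x i) - D x i) (Z (y i) - D y i) - inner ℝ (Z (x i)) (Z (y i)))
      = -(fun i => inner ℝ (Z (x i)) (D y i)) + -(fun i => inner ℝ (Z (y i)) (D x i)) +
        fun i => inner ℝ (D x i) (D y i) := by
    funext i
    simp only [Pi.add_apply, Pi.neg_apply, inner_sub_left, inner_sub_right,
      real_inner_comm (D x i) (Z (y i))]
    ring
  rw [e]
  have h1 : Φ (fun i => inner ℝ (D x i) (D y i)) ≤ Λ x * Λ y :=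
    (hΦ.le_sum_abs _).trans ((sum_abs_inner_le _ _).trans
      (mul_le_mul (hD.sqrt_sum_norm_sq_le x) (hD.sqrt_sum_norm_sq_le y) (Real.sqrt_nonneg _)
        (hD.bound_nonneg x)))
  have h2 := map_add_le_add Φ (-(fun i => inner ℝ (Z (x i)) (D y i)))
    (-(fun i => inner ℝ (Z (y i)) (D x i)))
  rw [map_neg_eq_map, map_neg_eq_map] at h2
  exact (map_add_le_add Φ _ _).trans (add_le_add h2 h1)

/-- D is a function of its own half only. By Fubini one half may be frozen, making its perturbation
a fixed vector family while the Z of the other half stay independent and centred. This bounds each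
of the two cross terms by MB; only the term ⟪D, D'⟫ is estimated crudely, by B². -/
theorem IsErrorSeminorm.lintegral_inner_error_le [CompleteSpace E] (hΦ : IsErrorSeminorm.{v} Φ)
    (hZ : IsCenteredVector π Z δ) {M : ℝ} (hM : 0 ≤ M) (hZ2 : ∫ x, ‖Z x‖ ^ 2 ∂π ≤ M ^ 2)
    (hD : IsSmallPerturbation π D Λ B) :
    ∫⁻ ω : (Fin N → 𝒳) × (Fin N → 𝒳), ENNReal.ofReal (Φ fun i =>
        inner ℝ (Z (ω.1 i) - D ω.1 i) (Z (ω.2 i) - D ω.2 i) - inner ℝ (Z (ω.1 i)) (Z (ω.2 i)))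
        ∂((Measure.pi fun _ : Fin N => π).prod (Measure.pi fun _ : Fin N => π))
      ≤ ENNReal.ofReal (2 * M * B + B ^ 2) := by
  have hB := hD.nonneg
  have hZi : ∀ i : Fin N, Measurable fun x : Fin N → 𝒳 => Z (x i) := fun i =>
    hZ.measurable.comp (measurable_pi_apply i)
  have m1 : Measurable fun ω : (Fin N → 𝒳) × (Fin N → 𝒳) =>
      ENNReal.ofReal (Φ fun i => inner ℝ (Z (ω.1 i)) (D ω.2 i)) :=
    (hΦ.measurable.comp (measurable_pi_iff.2 fun i => ((hZi i).comp measurable_fst).inner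
      ((hD.measurable i).comp measurable_snd))).ennreal_ofReal
  have m2 : Measurable fun ω : (Fin N → 𝒳) × (Fin N → 𝒳) =>
      ENNReal.ofReal (Φ fun i => inner ℝ (Z (ω.2 i)) (D ω.1 i)) :=
    (hΦ.measurable.comp (measurable_pi_iff.2 fun i => ((hZi i).comp measurable_snd).inner
      ((hD.measurable i).comp measurable_fst))).ennreal_ofReal
  have hfix : ∀ x : Fin N → 𝒳, ∫⁻ y, ENNReal.ofReal (Φ fun i => inner ℝ (Z (y i)) (D x i))
      ∂(Measure.pi fun _ : Fin N => π) ≤ ENNReal.ofReal M * ENNReal.ofReal (Λ x) := fun x => by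
    rw [← ENNReal.ofReal_mul hM]
    exact (hΦ.lintegral_inner_le hZ hM hZ2 _).trans (ENNReal.ofReal_le_ofReal
      (mul_le_mul_of_nonneg_left (hD.sqrt_sum_norm_sq_le x) hM))
  have hMB : ∫⁻ x, ENNReal.ofReal M * ENNReal.ofReal (Λ x) ∂(Measure.pi fun _ : Fin N => π)
      ≤ ENNReal.ofReal (M * B) := by
    rw [lintegral_const_mul _ hD.measurable_bound.ennreal_ofReal, ENNReal.ofReal_mul hM]
    gcongr
    exact hD.lintegral_le
  have b1 : ∫⁻ ω : (Fin N → 𝒳) × (Fin N → 𝒳),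
      ENNReal.ofReal (Φ fun i => inner ℝ (Z (ω.1 i)) (D ω.2 i))
      ∂((Measure.pi fun _ : Fin N => π).prod (Measure.pi fun _ : Fin N => π))
      ≤ ENNReal.ofReal (M * B) := by
    rw [lintegral_prod_symm _ m1.aemeasurable]
    exact (lintegral_mono hfix).trans hMB
  have b2 : ∫⁻ ω : (Fin N → 𝒳) × (Fin N → 𝒳),
      ENNReal.ofReal (Φ fun i => inner ℝ (Z (ω.2 i)) (D ω.1 i))
      ∂((Measure.pi fun _ : Fin N => π).prod (Measure.pi fun _ : Fin N => π))
      ≤ ENNReal.ofReal (M * B) := by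
    rw [lintegral_prod _ m2.aemeasurable]
    exact (lintegral_mono hfix).trans hMB
  have b3 : ∫⁻ ω : (Fin N → 𝒳) × (Fin N → 𝒳), ENNReal.ofReal (Λ ω.1) * ENNReal.ofReal (Λ ω.2)
      ∂((Measure.pi fun _ : Fin N => π).prod (Measure.pi fun _ : Fin N => π))
      ≤ ENNReal.ofReal (B ^ 2) := by
    rw [lintegral_prod_mul hD.measurable_bound.ennreal_ofReal.aemeasurable
      hD.measurable_bound.ennreal_ofReal.aemeasurable, sq, ENNReal.ofReal_mul hB]
    exact mul_le_mul' hD.lintegral_le hD.lintegral_le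
  calc _ ≤ ∫⁻ ω : (Fin N → 𝒳) × (Fin N → 𝒳),
        (ENNReal.ofReal (Φ fun i => inner ℝ (Z (ω.1 i)) (D ω.2 i)) +
          ENNReal.ofReal (Φ fun i => inner ℝ (Z (ω.2 i)) (D ω.1 i)) +
          ENNReal.ofReal (Λ ω.1) * ENNReal.ofReal (Λ ω.2))
        ∂((Measure.pi fun _ : Fin N => π).prod (Measure.pi fun _ : Fin N => π)) := by
        refine lintegral_mono fun ω => ?_
        rw [← ENNReal.ofReal_mul (hD.bound_nonneg _), ← ENNReal.ofReal_add (apply_nonneg Φ _)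
          (apply_nonneg Φ _), ← ENNReal.ofReal_add (add_nonneg (apply_nonneg Φ _)
          (apply_nonneg Φ _)) (mul_nonneg (hD.bound_nonneg _) (hD.bound_nonneg _))]
        exact ENNReal.ofReal_le_ofReal (hΦ.le_inner_error hD ω.1 ω.2)
    _ ≤ ENNReal.ofReal (M * B) + ENNReal.ofReal (M * B) + ENNReal.ofReal (B ^ 2) := by
        have m12 : Measurable fun ω : (Fin N → 𝒳) × (Fin N → 𝒳) =>
            ENNReal.ofReal (Φ fun i => inner ℝ (Z (ω.1 i)) (D ω.2 i)) +
              ENNReal.ofReal (Φ fun i => inner ℝ (Z (ω.2 i)) (D ω.1 i)) := m1.add m2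
        rw [lintegral_add_left m12, lintegral_add_left m1]
        gcongr
    _ = _ := by
        rw [← ENNReal.ofReal_add (by positivity) (by positivity),
          ← ENNReal.ofReal_add (by positivity) (by positivity)]
        ring_nf

/-- The linear statistic changes only by −⟪u, D⟫ in each half. The absolute sum of these is
controlled by ‖∑ D_i‖ and their Euclidean norm by the ℓ² size of D, which is why
`IsSmallPerturbation` bounds both. -/
theorem lintegral_linear_error_le (hD : IsSmallPerturbation π D Λ B) (u : E)
    (hΦ : ∀ x, Φ (fun i => inner ℝ u (D x i)) ≤ ‖u‖ * Λ x) :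
    ∫⁻ ω : (Fin N → 𝒳) × (Fin N → 𝒳), ENNReal.ofReal (Φ fun i =>
        (inner ℝ u (Z (ω.1 i) - D ω.1 i) + inner ℝ u (Z (ω.2 i) - D ω.2 i)) -
          (inner ℝ u (Z (ω.1 i)) + inner ℝ u (Z (ω.2 i))))
        ∂((Measure.pi fun _ : Fin N => π).prod (Measure.pi fun _ : Fin N => π))
      ≤ ENNReal.ofReal (2 * ‖u‖ * B) := by
  have hm := hD.measurable_bound.ennreal_ofReal
  calc _ ≤ ∫⁻ ω : (Fin N → 𝒳) × (Fin N → 𝒳), (ENNReal.ofReal ‖u‖ * ENNReal.ofReal (Λ ω.1) +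
        ENNReal.ofReal ‖u‖ * ENNReal.ofReal (Λ ω.2))
        ∂((Measure.pi fun _ : Fin N => π).prod (Measure.pi fun _ : Fin N => π)) := by
        refine lintegral_mono fun ω => ?_
        have h1 := hD.bound_nonneg ω.1
        have h2 := hD.bound_nonneg ω.2
        rw [← ENNReal.ofReal_mul (norm_nonneg _), ← ENNReal.ofReal_mul (norm_nonneg _),
          ← ENNReal.ofReal_add (by positivity) (by positivity)]
        refine ENNReal.ofReal_le_ofReal ?_
        have e : (fun i => (inner ℝ u (Z (ω.1 i) - D ω.1 i) + inner ℝ u (Z (ω.2 i) - D ω.2 i)) -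
            (inner ℝ u (Z (ω.1 i)) + inner ℝ u (Z (ω.2 i))))
            = -(fun i => inner ℝ u (D ω.1 i)) + -(fun i => inner ℝ u (D ω.2 i)) := by
          funext i
          simp only [Pi.add_apply, Pi.neg_apply, inner_sub_right]
          ring
        rw [e]
        refine (map_add_le_add Φ _ _).trans ?_
        rw [map_neg_eq_map, map_neg_eq_map]
        exact add_le_add (hΦ _) (hΦ _)
    _ ≤ ENNReal.ofReal ‖u‖ * ENNReal.ofReal B + ENNReal.ofReal ‖u‖ * ENNReal.ofReal B := by
        have m1 : Measurable fun ω : (Fin N → 𝒳) × (Fin N → 𝒳) => ENNReal.ofReal (Λ ω.1) :=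
          hm.comp measurable_fst
        have m2 : Measurable fun ω : (Fin N → 𝒳) × (Fin N → 𝒳) => ENNReal.ofReal (Λ ω.2) :=
          hm.comp measurable_snd
        rw [lintegral_add_left (m1.const_mul _), lintegral_const_mul _ m1,
          lintegral_const_mul _ m2]
        have f1 := (measurePreserving_fst (μ := Measure.pi fun _ : Fin N => π)
          (ν := Measure.pi fun _ : Fin N => π)).lintegral_comp hm
        have f2 := (measurePreserving_snd (μ := Measure.pi fun _ : Fin N => π)
          (ν := Measure.pi fun _ : Fin N => π)).lintegral_comp hm
        rw [f1, f2]
        gcongr <;> exact hD.lintegral_le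
    _ = _ := by
        have := hD.nonneg
        rw [← ENNReal.ofReal_mul (norm_nonneg _), ← ENNReal.ofReal_add (by positivity)
          (by positivity)]
        ring_nf

theorem IsSmallPerturbation.absSum_le (hD : IsSmallPerturbation π D Λ B) (u : E)
    (x : Fin N → 𝒳) : absSumSeminorm N (fun i => inner ℝ u (D x i)) ≤ ‖u‖ * Λ x := by
  rw [absSumSeminorm_apply, ← inner_sum]
  exact (abs_real_inner_le_norm _ _).trans
    (mul_le_mul_of_nonneg_left (hD.norm_sum_le x) (norm_nonneg _))

theorem IsSmallPerturbation.euclidean_le (hD : IsSmallPerturbation π D Λ B) (u : E)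
    (x : Fin N → 𝒳) : euclideanSeminorm N (fun i => inner ℝ u (D x i)) ≤ ‖u‖ * Λ x := by
  rw [euclideanSeminorm_apply]
  refine le_trans ?_ (mul_le_mul_of_nonneg_left (hD.sqrt_sum_norm_sq_le x) (norm_nonneg _))
  rw [← Real.sqrt_sq (norm_nonneg u), ← Real.sqrt_mul (sq_nonneg _), Finset.mul_sum]
  refine Real.sqrt_le_sqrt (Finset.sum_le_sum fun i _ => ?_)
  rw [← mul_pow, ← sq_abs (inner ℝ _ _)]
  exact pow_le_pow_left₀ (abs_nonneg _) (abs_real_inner_le_norm _ _) 2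

end Perturbation


/-! ### Wilks' theorem for perturbed paired products. -/

section PairedLimit

variable {𝒳 : ℕ → Type v} [∀ n, MeasurableSpace (𝒳 n)] {π : ∀ n, Measure (𝒳 n)}
  [∀ n, IsProbabilityMeasure (π n)] {N : ℕ → ℕ}

/-- An expected error of order q², divided by a scale of order at least q and by √N, is of order
q/√N. -/
theorem tendstoZeroInProb_seminorm {q r : ℕ → ℝ} {c K : ℝ} (hc : 0 < c) (hq : ∀ n, 0 < q n)
    (hr : ∀ᶠ n in atTop, c * q n ≤ r n)
    (hqN : Tendsto (fun n => q n / √(N n)) atTop (𝓝 0)) {Ω : ℕ → Type*}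
    [∀ n, MeasurableSpace (Ω n)] {P : ∀ n, Measure (Ω n)} {Φ : ∀ n, Seminorm ℝ (Fin (N n) → ℝ)}
    (hΦ : ∀ n, Measurable (Φ n)) {Δ : ∀ n, Ω n → Fin (N n) → ℝ} (hΔ : ∀ n, Measurable (Δ n))
    (h : ∀ᶠ n in atTop, ∫⁻ ω, ENNReal.ofReal (Φ n (Δ n ω)) ∂P n ≤ ENNReal.ofReal (K * q n ^ 2)) :
    TendstoZeroInProb P fun n ω => (√(N n))⁻¹ * ((r n)⁻¹ * Φ n (Δ n ω)) := by
  have hlim : Tendsto (fun n => |K| * c⁻¹ * (q n / √(N n))) atTop (𝓝 0) := by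
    simpa using hqN.const_mul (|K| * c⁻¹)
  refine tendstoZeroInProb_of_lintegral_le hlim ?_
  filter_upwards [h, hr] with n h1 h2
  have hm : Measurable fun ω => Φ n (Δ n ω) := (hΦ n).comp (hΔ n)
  have h0 : 0 < c * q n := mul_pos hc (hq n)
  have hr0 : 0 < r n := h0.trans_le h2
  refine ⟨((hm.const_mul _).const_mul _).aemeasurable, ?_⟩
  have e : ∀ ω, ENNReal.ofReal |(√(N n))⁻¹ * ((r n)⁻¹ * Φ n (Δ n ω))| =
      ENNReal.ofReal ((√(N n))⁻¹ * (r n)⁻¹) * ENNReal.ofReal (Φ n (Δ n ω)) := fun ω => by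
    have := apply_nonneg (Φ n) (Δ n ω)
    rw [← ENNReal.ofReal_mul (by positivity), abs_of_nonneg (by positivity), mul_assoc]
  simp_rw [e]
  rw [lintegral_const_mul _ hm.ennreal_ofReal]
  refine (mul_le_mul' le_rfl h1).trans ?_
  rw [← ENNReal.ofReal_mul (by positivity)]
  refine ENNReal.ofReal_le_ofReal ?_
  have h3 : (r n)⁻¹ ≤ c⁻¹ * (q n)⁻¹ := by
    rw [← mul_inv]
    exact inv_anti₀ h0 h2
  have hqn := hq n
  calc (√(N n))⁻¹ * (r n)⁻¹ * (K * q n ^ 2)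
      ≤ (√(N n))⁻¹ * (c⁻¹ * (q n)⁻¹) * (|K| * q n ^ 2) := by
        have h4 : K * q n ^ 2 ≤ |K| * q n ^ 2 :=
          mul_le_mul_of_nonneg_right (le_abs_self K) (by positivity)
        exact (mul_le_mul_of_nonneg_left h4 (by positivity)).trans (by gcongr)
    _ = _ := by field_simp

/-- Wilks' theorem for empirical likelihood of slightly perturbed paired products. -/
theorem tendstoInDistribution_negTwoLog_elRatio_pairs {ι : ℕ → Type*}
    [∀ n, Fintype (ι n)] {Z : ∀ n, 𝒳 n → EuclideanSpace ℝ (ι n)}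
    {u : ∀ n, EuclideanSpace ℝ (ι n)} {δ : ℝ} (hZm : ∀ n, Measurable (Z n))
    (hδ : 0 < δ) (hZ : ∀ᶠ n in atTop, IsCenteredVector (π n) (Z n) δ) {q : ℕ → ℝ} {c C : ℝ}
    (hc : 0 < c) (hC : 0 ≤ C) (hq : ∀ n, 0 < q n) (hu : ∀ n, ‖u n‖ = q n)
    (hK : ∀ᶠ n in atTop, ∫ x, ‖Z n x‖ ^ (2 + δ) ∂π n ≤ C * q n ^ (2 + δ))
    (hs2 : ∀ᶠ n in atTop, c * q n ^ 2 ≤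
      ∫ z : 𝒳 n × 𝒳 n, inner ℝ (Z n z.1) (Z n z.2) ^ 2 ∂((π n).prod (π n)))
    (ht2 : ∀ᶠ n in atTop, c * q n ^ 2 ≤ ∫ x, inner ℝ (u n) (Z n x) ^ 2 ∂π n)
    (hN : Tendsto N atTop atTop)
    (hqN : Tendsto (fun n => (N n : ℝ) ^ (-(δ / 2)) * q n ^ (2 + δ)) atTop (𝓝 0))
    (hqN' : Tendsto (fun n => q n / √(N n)) atTop (𝓝 0))
    (hZ2 : ∀ᶠ n in atTop, ∫ x, ‖Z n x‖ ^ 2 ∂π n ≤ (C * q n) ^ 2)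
    {D : ∀ n, (Fin (N n) → 𝒳 n) → Fin (N n) → EuclideanSpace ℝ (ι n)}
    (hDm : ∀ n i, Measurable fun x => D n x i)
    {Λ : ∀ n, (Fin (N n) → 𝒳 n) → ℝ}
    (hD : ∀ᶠ n in atTop, IsSmallPerturbation (π n) (D n) (Λ n) (C * q n)) :
    TendstoInDistribution (fun n (ω : (Fin (N n) → 𝒳 n) × (Fin (N n) → 𝒳 n)) =>
      negTwoLog (elRatio fun i =>
        ((inner ℝ (Z n (ω.1 i) - D n ω.1 i) (Z n (ω.2 i) - D n ω.2 i),
          inner ℝ (u n) (Z n (ω.1 i) - D n ω.1 i) +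
            inner ℝ (u n) (Z n (ω.2 i) - D n ω.2 i)) : ℝ × ℝ)))
      atTop (fun t : ℝ => (t : EReal))
      (fun n => (Measure.pi fun _ : Fin (N n) => π n).prod (Measure.pi fun _ : Fin (N n) => π n))
      (chiSquared 2) := by
  set s : ℕ → ℝ := fun n =>
    √(∫ z : 𝒳 n × 𝒳 n, inner ℝ (Z n z.1) (Z n z.2) ^ 2 ∂((π n).prod (π n))) with hs_def
  set t : ℕ → ℝ := fun n => √(2 * ∫ x, inner ℝ (u n) (Z n x) ^ 2 ∂π n) with ht_def
  have hsc : ∀ᶠ n in atTop, √c * q n ≤ s n := hs2.mono fun n h => by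
    rw [← Real.sqrt_sq (hq n).le, ← Real.sqrt_mul hc.le]
    exact Real.sqrt_le_sqrt h
  have htc : ∀ᶠ n in atTop, √c * q n ≤ t n := ht2.mono fun n h => by
    rw [← Real.sqrt_sq (hq n).le, ← Real.sqrt_mul hc.le]
    refine Real.sqrt_le_sqrt (h.trans ?_)
    have : 0 ≤ ∫ x, inner ℝ (u n) (Z n x) ^ 2 ∂π n := integral_nonneg fun x => sq_nonneg _
    linarith
  have hc' : 0 < √c := Real.sqrt_pos.2 hc
  have hpos : ∀ r : ℕ → ℝ, (∀ᶠ n in atTop, √c * q n ≤ r n) → ∀ᶠ n in atTop, 0 < r n :=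
    fun r hr => hr.mono fun n h => (mul_pos hc' (hq n)).trans_le h
  have harr := isStandardArray_pairs hZm hδ hZ hc' hq hu hK hsc htc
    (Eventually.of_forall fun n => (Real.sq_sqrt (integral_nonneg fun x => sq_nonneg _)).symm)
    (Eventually.of_forall fun n => (Real.sq_sqrt (mul_nonneg zero_le_two
      (integral_nonneg fun x => sq_nonneg _))).symm) hqN
  have mZ1 : ∀ n i, Measurable fun ω : (Fin (N n) → 𝒳 n) × (Fin (N n) → 𝒳 n) => Z n (ω.1 i) :=
    fun n i => (hZm n).comp ((measurable_pi_apply i).comp measurable_fst)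
  have mZ2 : ∀ n i, Measurable fun ω : (Fin (N n) → 𝒳 n) × (Fin (N n) → 𝒳 n) => Z n (ω.2 i) :=
    fun n i => (hZm n).comp ((measurable_pi_apply i).comp measurable_snd)
  have mD1 : ∀ n i, Measurable fun ω : (Fin (N n) → 𝒳 n) × (Fin (N n) → 𝒳 n) => D n ω.1 i :=
    fun n i => (hDm n i).comp measurable_fst
  have mD2 : ∀ n i, Measurable fun ω : (Fin (N n) → 𝒳 n) × (Fin (N n) → 𝒳 n) => D n ω.2 i :=
    fun n i => (hDm n i).comp measurable_snd
  have me : ∀ n i, Measurable fun ω : (Fin (N n) → 𝒳 n) × (Fin (N n) → 𝒳 n) =>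
      (inner ℝ (Z n (ω.1 i) - D n ω.1 i) (Z n (ω.2 i) - D n ω.2 i) : ℝ) := fun n i =>
    ((mZ1 n i).sub (mD1 n i)).inner ((mZ2 n i).sub (mD2 n i))
  have me0 : ∀ n i, Measurable fun ω : (Fin (N n) → 𝒳 n) × (Fin (N n) → 𝒳 n) =>
      (inner ℝ (Z n (ω.1 i)) (Z n (ω.2 i)) : ℝ) := fun n i => (mZ1 n i).inner (mZ2 n i)
  have mv : ∀ n i, Measurable fun ω : (Fin (N n) → 𝒳 n) × (Fin (N n) → 𝒳 n) =>
      (inner ℝ (u n) (Z n (ω.1 i) - D n ω.1 i) + inner ℝ (u n) (Z n (ω.2 i) - D n ω.2 i) : ℝ) :=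
    fun n i => (((mZ1 n i).sub (mD1 n i)).const_inner (c := u n)).add
      (((mZ2 n i).sub (mD2 n i)).const_inner (c := u n))
  have mv0 : ∀ n i, Measurable fun ω : (Fin (N n) → 𝒳 n) × (Fin (N n) → 𝒳 n) =>
      (inner ℝ (u n) (Z n (ω.1 i)) + inner ℝ (u n) (Z n (ω.2 i)) : ℝ) :=
    fun n i => ((mZ1 n i).const_inner (c := u n)).add ((mZ2 n i).const_inner (c := u n))
  have he : ∀ Φ : ∀ n, Seminorm ℝ (Fin (N n) → ℝ), (∀ n, IsErrorSeminorm.{v} (Φ n)) →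
      TendstoZeroInProb (fun n => (Measure.pi fun _ : Fin (N n) => π n).prod
        (Measure.pi fun _ : Fin (N n) => π n)) fun n ω => (√(N n))⁻¹ * ((s n)⁻¹ * Φ n fun i =>
          inner ℝ (Z n (ω.1 i) - D n ω.1 i) (Z n (ω.2 i) - D n ω.2 i) -
            inner ℝ (Z n (ω.1 i)) (Z n (ω.2 i))) := fun Φ hΦ => by
    -- The constant is 2MB + B² with M = B = Cq.
    refine tendstoZeroInProb_seminorm (K := 3 * C ^ 2) hc' hq hsc hqN' (fun n => (hΦ n).measurable)
      (fun n => measurable_pi_iff.2 fun i => (me n i).sub (me0 n i)) ?_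
    filter_upwards [hZ, hZ2, hD] with n h1 h2 h3
    refine ((hΦ n).lintegral_inner_error_le h1 (mul_nonneg hC (hq n).le) h2 h3).trans
      (ENNReal.ofReal_le_ofReal (le_of_eq ?_))
    ring
  have hv : ∀ Φ : ∀ n, Seminorm ℝ (Fin (N n) → ℝ), (∀ n, IsErrorSeminorm.{v} (Φ n)) →
      (∀ᶠ n in atTop, ∀ x, Φ n (fun i => inner ℝ (u n) (D n x i)) ≤ ‖u n‖ * Λ n x) →
      TendstoZeroInProb (fun n => (Measure.pi fun _ : Fin (N n) => π n).prod
        (Measure.pi fun _ : Fin (N n) => π n)) fun n ω => (√(N n))⁻¹ * ((t n)⁻¹ * Φ n fun i =>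
          (inner ℝ (u n) (Z n (ω.1 i) - D n ω.1 i) + inner ℝ (u n) (Z n (ω.2 i) - D n ω.2 i)) -
            (inner ℝ (u n) (Z n (ω.1 i)) + inner ℝ (u n) (Z n (ω.2 i)))) := fun Φ hΦ hΦu => by
    refine tendstoZeroInProb_seminorm (K := 2 * C) hc' hq htc hqN' (fun n => (hΦ n).measurable)
      (fun n => measurable_pi_iff.2 fun i => (mv n i).sub (mv0 n i)) ?_
    filter_upwards [hD, hΦu] with n h1 h2
    refine (lintegral_linear_error_le h1 (u n) h2).trans (ENNReal.ofReal_le_ofReal (le_of_eq ?_))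
    rw [hu n]
    ring
  have hsum : ∀ (m : ℕ) (w r : ℝ) (a b : Fin m → ℝ), |w * ∑ i, (r⁻¹ * a i - r⁻¹ * b i)| ≤
      |w * (r⁻¹ * absSumSeminorm m fun i => a i - b i)| := fun m w r a b => by
    rw [absSumSeminorm_apply]
    simp_rw [← mul_sub, ← Finset.mul_sum, abs_mul, abs_abs]
    rfl
  have hsq : ∀ (m : ℕ) (r : ℝ) (a b : Fin m → ℝ), |(∑ i, (r⁻¹ * a i - r⁻¹ * b i) ^ 2) / m| ≤
      |((√m)⁻¹ * (r⁻¹ * euclideanSeminorm m fun i => a i - b i)) ^ 2| := fun m r a b => by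
    rw [euclideanSeminorm_apply, mul_pow, mul_pow, Real.sq_sqrt (Finset.sum_nonneg fun i _ =>
      sq_nonneg _), inv_pow, Real.sq_sqrt (Nat.cast_nonneg _)]
    simp_rw [← mul_sub, mul_pow, ← Finset.mul_sum]
    rw [div_eq_inv_mul]
  refine harr.tendsto_negTwoLog_elRatio hN
    (fun n => measurable_pi_iff.2 fun i => (me n i).prodMk (mv n i)) (hpos s hsc) (hpos t htc)
    ?_ ?_ ?_ ?_
  · exact (he _ fun n => isErrorSeminorm_absSum (N n)).mono
      (Eventually.of_forall fun n ω => hsum _ _ _ _ _)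
  · exact (hv _ (fun n => isErrorSeminorm_absSum (N n))
      (hD.mono fun n h x => h.absSum_le (u n) x)).mono
      (Eventually.of_forall fun n ω => hsum _ _ _ _ _)
  · exact (he _ fun n => isErrorSeminorm_euclidean (N n)).sq.mono
      (Eventually.of_forall fun n ω => hsq _ _ _ _)
  · exact (hv _ (fun n => isErrorSeminorm_euclidean (N n))
      (hD.mono fun n h x => h.euclidean_le (u n) x)).sq.mono
      (Eventually.of_forall fun n ω => hsq _ _ _ _)

end PairedLimit


/-! ### Matrices as Euclidean vectors. -/

noncomputable section Vectorization

variable {p : ℕ}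

/-- A matrix, regarded as a Euclidean vector indexed by pairs. -/
def matVec (A : Matrix (Fin p) (Fin p) ℝ) : EuclideanSpace ℝ (Fin p × Fin p) :=
  WithLp.toLp 2 fun s => A s.1 s.2

/-- The vector with all entries equal to one, indexed by pairs. -/
def onesVec (p : ℕ) : EuclideanSpace ℝ (Fin p × Fin p) := WithLp.toLp 2 1

@[simp]
theorem matVec_apply (A : Matrix (Fin p) (Fin p) ℝ) (s : Fin p × Fin p) :
    matVec A s = A s.1 s.2 := rfl

@[simp]
theorem onesVec_apply (s : Fin p × Fin p) : onesVec p s = 1 := rfl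

theorem norm_onesVec : ‖onesVec p‖ = p := by
  simp [EuclideanSpace.norm_eq]

theorem inner_onesVec (v : EuclideanSpace ℝ (Fin p × Fin p)) :
    inner ℝ (onesVec p) v = ∑ s, v s := by
  simp [PiLp.inner_apply]

theorem trace_mul_eq_inner (A : Matrix (Fin p) (Fin p) ℝ) {B : Matrix (Fin p) (Fin p) ℝ}
    (hB : B.IsSymm) : (A * B).trace = inner ℝ (matVec A) (matVec B) := by
  simp only [Matrix.trace, Matrix.diag, Matrix.mul_apply, PiLp.inner_apply, matVec_apply,
    Fintype.sum_prod_type]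
  refine Finset.sum_congr rfl fun i _ => Finset.sum_congr rfl fun j _ => ?_
  rw [hB.apply i j, real_inner_comm]
  rfl

theorem onesForm_eq_inner (A : Matrix (Fin p) (Fin p) ℝ) :
    onesForm A = inner ℝ (onesVec p) (matVec A) := by
  rw [inner_onesVec, Fintype.sum_prod_type]
  simp [onesForm, dotProduct, Matrix.mulVec]

theorem outer_isSymm (m x : Fin p → ℝ) : (outer m x).IsSymm :=
  Matrix.IsSymm.ext fun i j => by simp [outer, Matrix.vecMulVec_apply, mul_comm]

theorem covMat_isSymm (ν : Measure (Fin p → ℝ)) : (covMat ν).IsSymm :=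
  Matrix.IsSymm.ext fun _ _ => covariance_comm _ _

theorem measurable_matVec {𝒳 : Type*} [MeasurableSpace 𝒳] {A : 𝒳 → Matrix (Fin p) (Fin p) ℝ}
    (hA : ∀ i j, Measurable fun x => A x i j) : Measurable fun x => matVec (A x) :=
  (WithLp.measurable_toLp 2 _).comp (measurable_pi_iff.2 fun s => hA s.1 s.2)

end Vectorization

/-! ### Moments of the centred matrix and their relation to Θ. -/

noncomputable section Moments

variable {p : ℕ} {ν : Measure (Fin p → ℝ)}

/-- The centred matrix `(x - μ)(x - μ)ᵀ - Σ` as a Euclidean vector. -/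
def centeredVec (ν : Measure (Fin p → ℝ)) (x : Fin p → ℝ) : EuclideanSpace ℝ (Fin p × Fin p) :=
  matVec (outer (meanVec ν) x - covMat ν)

theorem centeredVec_apply (x : Fin p → ℝ) (s : Fin p × Fin p) :
    centeredVec ν x s = outer (meanVec ν) x s.1 s.2 - covMat ν s.1 s.2 := rfl

theorem measurable_centeredVec : Measurable (centeredVec ν) :=
  measurable_matVec fun i j => by
    simp only [outer, Matrix.sub_apply, Matrix.vecMulVec_apply, Pi.sub_apply]
    fun_prop

theorem measurable_centeredVec_apply (s : Fin p × Fin p) :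
    Measurable fun x => centeredVec ν x s := by
  simp only [centeredVec_apply, outer, Matrix.vecMulVec_apply, Pi.sub_apply]
  fun_prop

theorem prodAbsMoment_eq (r : ℝ) (s : Fin p × Fin p) :
    prodAbsMoment ν r s.1 s.2 = ∫⁻ x, ENNReal.ofReal (|centeredVec ν x s| ^ r) ∂ν := rfl

/-- From z^r ≤ 1 + z^r' for z ≥ 0. It lowers the order 2 + δ of A2 to 2 + min(2, δ) and to 2. -/
theorem prodAbsMoment_le_one_add [IsProbabilityMeasure ν] {r r' : ℝ} (hr : 0 ≤ r) (hrr' : r ≤ r')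
    (a b : Fin p) : prodAbsMoment ν r a b ≤ 1 + prodAbsMoment ν r' a b := by
  have h : ∀ x : Fin p → ℝ, ENNReal.ofReal (|outer (meanVec ν) x a b - covMat ν a b| ^ r) ≤
      1 + ENNReal.ofReal (|outer (meanVec ν) x a b - covMat ν a b| ^ r') := fun x => by
    rw [← ENNReal.ofReal_one, ← ENNReal.ofReal_add zero_le_one (by positivity)]
    refine ENNReal.ofReal_le_ofReal ?_
    set z := |outer (meanVec ν) x a b - covMat ν a b|
    have hz : 0 ≤ z := abs_nonneg _
    rcases le_total z 1 with h1 | h1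
    · exact (Real.rpow_le_one hz h1 hr).trans (le_add_of_nonneg_right (by positivity))
    · exact (Real.rpow_le_rpow_of_exponent_le h1 hrr').trans (le_add_of_nonneg_left zero_le_one)
  refine (lintegral_mono h).trans ?_
  rw [lintegral_add_left measurable_const]
  simp [prodAbsMoment]

/-- The power-mean inequality with exponent r/2 for the p² squared coordinates; the cardinality
enters as (p²)^(r/2 − 1) = p^(r − 2). -/
theorem norm_rpow_le_sum {r : ℝ} (hr : 2 ≤ r) (v : EuclideanSpace ℝ (Fin p × Fin p)) :
    ‖v‖ ^ r ≤ (p : ℝ) ^ (r - 2) * ∑ s, |v s| ^ r := by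
  have h := Real.rpow_sum_le_const_mul_sum_rpow (Finset.univ : Finset (Fin p × Fin p))
    (fun s => v s ^ 2) (p := r / 2) (by linarith)
  have e1 : ∀ y : ℝ, 0 ≤ y → (y ^ 2) ^ (r / 2) = y ^ r := fun y hy => by
    rw [← Real.rpow_natCast y 2, ← Real.rpow_mul hy]
    congr 1
    push_cast
    ring
  have e2 : ∑ s, |v s ^ 2| = ‖v‖ ^ 2 := by
    rw [EuclideanSpace.norm_sq_eq]
    simp
  have e3 : ∀ s, |v s ^ 2| ^ (r / 2) = |v s| ^ r := fun s => by
    rw [abs_pow, e1 _ (abs_nonneg _)]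
  rw [e2, e1 _ (norm_nonneg v)] at h
  simp only [e3] at h
  refine h.trans (le_of_eq ?_)
  congr 1
  rw [Finset.card_univ, Fintype.card_prod, Fintype.card_fin, Nat.cast_mul, ← sq,
    ← Real.rpow_natCast (p : ℝ) 2, ← Real.rpow_mul (Nat.cast_nonneg p)]
  congr 1
  push_cast
  ring

theorem lintegral_norm_centeredVec_rpow_le (hp : 0 < p) {r K : ℝ} (hr : 2 ≤ r)
    (h : ∑ a, ∑ b, prodAbsMoment ν r a b ≤ ENNReal.ofReal (K * p ^ 2)) :
    ∫⁻ x, ENNReal.ofReal (‖centeredVec ν x‖ ^ r) ∂ν ≤ ENNReal.ofReal (K * (p : ℝ) ^ r) := by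
  have hp' : (0 : ℝ) < p := Nat.cast_pos.2 hp
  have h1 : ∀ x : Fin p → ℝ, ENNReal.ofReal (‖centeredVec ν x‖ ^ r) ≤
      ENNReal.ofReal ((p : ℝ) ^ (r - 2)) * ∑ s, ENNReal.ofReal (|centeredVec ν x s| ^ r) :=
    fun x => by
    rw [← ENNReal.ofReal_sum_of_nonneg fun s _ => by positivity,
      ← ENNReal.ofReal_mul (by positivity)]
    exact ENNReal.ofReal_le_ofReal (norm_rpow_le_sum hr _)
  refine (lintegral_mono h1).trans ?_
  have hm : ∀ s : Fin p × Fin p, Measurable fun x => ENNReal.ofReal (|centeredVec ν x s| ^ r) :=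
    fun s => ((measurable_centeredVec_apply s).abs.pow_const _).ennreal_ofReal
  rw [lintegral_const_mul _ (Finset.measurable_sum _ fun s _ => hm s),
    lintegral_finsetSum _ fun s _ => hm s]
  simp_rw [← prodAbsMoment_eq]
  rw [Fintype.sum_prod_type]
  refine (mul_le_mul' le_rfl h).trans ?_
  rw [← ENNReal.ofReal_mul (by positivity)]
  refine ENNReal.ofReal_le_ofReal (le_of_eq ?_)
  have e : (p : ℝ) ^ r = (p : ℝ) ^ (r - 2) * p ^ 2 := by
    rw [← Real.rpow_natCast (p : ℝ) 2, ← Real.rpow_add hp']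
    congr 1
    push_cast
    ring
  rw [e]
  ring

theorem integrable_norm_centeredVec_rpow (hp : 0 < p) {r K : ℝ} (hr : 2 ≤ r) (hK : 0 ≤ K)
    (h : ∑ a, ∑ b, prodAbsMoment ν r a b ≤ ENNReal.ofReal (K * p ^ 2)) :
    Integrable (fun x => ‖centeredVec ν x‖ ^ r) ν ∧
      ∫ x, ‖centeredVec ν x‖ ^ r ∂ν ≤ K * (p : ℝ) ^ r := by
  have hle := lintegral_norm_centeredVec_rpow_le hp hr h
  have hm : Measurable fun x => ‖centeredVec ν x‖ ^ r := measurable_centeredVec.norm.pow_const _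
  refine ⟨⟨hm.aestronglyMeasurable, ?_⟩, ?_⟩
  · rw [hasFiniteIntegral_iff_ofReal (ae_of_all _ fun x => by positivity)]
    exact hle.trans_lt ENNReal.ofReal_lt_top
  · rw [integral_eq_lintegral_of_nonneg_ae (ae_of_all _ fun x => by positivity)
      hm.aestronglyMeasurable]
    exact ENNReal.toReal_le_of_le_ofReal (by positivity) hle

theorem integrable_outer [IsProbabilityMeasure ν]
    (hL2 : ∀ a, MemLp (fun x : Fin p → ℝ => x a) 2 ν) (m : Fin p → ℝ) (a b : Fin p) :
    Integrable (fun x => outer m x a b) ν :=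
  ((hL2 a).sub (memLp_const (m a))).integrable_mul ((hL2 b).sub (memLp_const (m b)))

theorem integral_outer (a b : Fin p) :
    ∫ x, outer (meanVec ν) x a b ∂ν = covMat ν a b := rfl

theorem integral_centeredVec [IsProbabilityMeasure ν]
    (hL2 : ∀ a, MemLp (fun x : Fin p → ℝ => x a) 2 ν) (hi : Integrable (centeredVec ν) ν) :
    ∫ x, centeredVec ν x ∂ν = 0 := by
  ext s
  have h := (EuclideanSpace.proj s : EuclideanSpace ℝ (Fin p × Fin p) →L[ℝ] ℝ).integral_comp_comm hi
  refine h.symm.trans ?_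
  change ∫ x, (outer (meanVec ν) x s.1 s.2 - covMat ν s.1 s.2) ∂ν = 0
  rw [integral_sub (integrable_outer hL2 _ _ _) (integrable_const _), integral_outer]
  simp

theorem isCenteredVector_centeredVec [IsProbabilityMeasure ν]
    (hL2 : ∀ a, MemLp (fun x : Fin p → ℝ => x a) 2 ν) {δ : ℝ} (hδ : 0 < δ)
    (hi : Integrable (fun x => ‖centeredVec ν x‖ ^ (2 + δ)) ν) :
    IsCenteredVector ν (centeredVec ν) δ := by
  refine ⟨hδ, measurable_centeredVec, hi, integral_centeredVec hL2 ?_⟩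
  have h := memLp_two_of_integrable_abs_rpow hδ
    (measurable_centeredVec (ν := ν)).norm.aestronglyMeasurable (by simpa using hi)
  exact ((memLp_norm_iff measurable_centeredVec.aestronglyMeasurable).1 h).integrable (by norm_num)

/-- Definitional, because the mean subtracted inside `covariance` is the integral that defines the
entry of Σ. -/
theorem prodCovMat_apply (s t : Fin p × Fin p) :
    prodCovMat ν s t = ∫ x, centeredVec ν x s * centeredVec ν x t ∂ν := rfl

theorem memLp_centeredVec_apply {δ : ℝ} [IsProbabilityMeasure ν]
    (h : IsCenteredVector ν (centeredVec ν) δ) (s : Fin p × Fin p) :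
    MemLp (fun x => centeredVec ν x s) 2 ν := by
  classical
  simpa [EuclideanSpace.inner_single_left] using h.memLp_inner (EuclideanSpace.single s (1 : ℝ))

theorem integral_inner_onesVec_sq [IsProbabilityMeasure ν] {δ : ℝ}
    (h : IsCenteredVector ν (centeredVec ν) δ) :
    ∫ x, inner ℝ (onesVec p) (centeredVec ν x) ^ 2 ∂ν = onesForm (prodCovMat ν) := by
  have hm := memLp_centeredVec_apply h
  have hi : ∀ s t, Integrable (fun x => centeredVec ν x s * centeredVec ν x t) ν := fun s t =>
    (hm s).integrable_mul (hm t)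
  simp_rw [inner_onesVec, sq, Finset.sum_mul_sum]
  rw [integral_finsetSum _ fun s _ => integrable_finsetSum _ fun t _ => hi s t]
  simp only [onesForm, dotProduct, Matrix.mulVec, Pi.one_apply, one_mul, mul_one]
  refine Finset.sum_congr rfl fun s _ => ?_
  rw [integral_finsetSum _ fun t _ => hi s t]
  rfl

/-- Expanding the square over pairs of coordinates, independence turns each term into Θ_st · Θ_st,
and symmetry of Θ makes the sum a trace. -/
theorem integral_inner_centeredVec_sq [IsProbabilityMeasure ν] {δ : ℝ}
    (h : IsCenteredVector ν (centeredVec ν) δ) :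
    ∫ z : (Fin p → ℝ) × (Fin p → ℝ), inner ℝ (centeredVec ν z.1) (centeredVec ν z.2) ^ 2
      ∂(ν.prod ν) = (prodCovMat ν ^ 2).trace := by
  have hm := memLp_centeredVec_apply h
  have e : ∀ z : (Fin p → ℝ) × (Fin p → ℝ),
      inner ℝ (centeredVec ν z.1) (centeredVec ν z.2) ^ 2 = ∑ s, ∑ t,
        (centeredVec ν z.1 s * centeredVec ν z.1 t) *
          (centeredVec ν z.2 s * centeredVec ν z.2 t) := fun z => by
    simp only [PiLp.inner_apply, sq, Finset.sum_mul_sum]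
    refine Finset.sum_congr rfl fun s _ => Finset.sum_congr rfl fun t _ => ?_
    simp only [RCLike.inner_apply, conj_trivial]
    ring
  have hi : ∀ s t, Integrable (fun z : (Fin p → ℝ) × (Fin p → ℝ) =>
      (centeredVec ν z.1 s * centeredVec ν z.1 t) * (centeredVec ν z.2 s * centeredVec ν z.2 t))
      (ν.prod ν) := fun s t =>
    ((hm s).integrable_mul (hm t)).mul_prod ((hm s).integrable_mul (hm t))
  simp_rw [e]
  rw [integral_finsetSum _ fun s _ => integrable_finsetSum _ fun t _ => hi s t, sq]
  simp only [Matrix.trace, Matrix.diag, Matrix.mul_apply]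
  refine Finset.sum_congr rfl fun s _ => ?_
  rw [integral_finsetSum _ fun t _ => hi s t]
  refine Finset.sum_congr rfl fun t _ => ?_
  rw [integral_prod_mul (fun x => centeredVec ν x s * centeredVec ν x t)
    (fun x => centeredVec ν x s * centeredVec ν x t), prodCovMat_apply, prodCovMat_apply]
  simp_rw [mul_comm (centeredVec ν _ t)]

theorem exists_pos_eventually_le_of_liminf_pos {f : ℕ → ℝ}
    (h : 0 < liminf (fun n => (f n : EReal)) atTop) : ∃ c : ℝ, 0 < c ∧ ∀ᶠ n in atTop, c ≤ f n := by
  obtain ⟨c, h1, h2⟩ := EReal.lt_iff_exists_real_btwn.1 h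
  refine ⟨c, by exact_mod_cast h1, (eventually_lt_of_lt_liminf h2).mono fun n hn => ?_⟩
  exact_mod_cast hn.le

end Moments


/-! ### Replacing the mean by the sample mean. -/

noncomputable section SampleMean

variable {p N : ℕ}

/-- The vector with entries `a_i b_j`, as a bilinear map. -/
def tensorVec (p : ℕ) : EuclideanSpace ℝ (Fin p) →ₗ[ℝ] EuclideanSpace ℝ (Fin p) →ₗ[ℝ]
    EuclideanSpace ℝ (Fin p × Fin p) :=
  LinearMap.mk₂ ℝ (fun a b => WithLp.toLp 2 fun s => a s.1 * b s.2)
    (fun a a' b => by ext s; simp [add_mul]) (fun c a b => by ext s; simp [mul_assoc])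
    (fun a b b' => by ext s; simp [mul_add]) (fun c a b => by ext s; simp [mul_left_comm])

@[simp]
theorem tensorVec_apply (a b : EuclideanSpace ℝ (Fin p)) (s : Fin p × Fin p) :
    tensorVec p a b s = a s.1 * b s.2 := rfl

theorem norm_tensorVec (a b : EuclideanSpace ℝ (Fin p)) : ‖tensorVec p a b‖ = ‖a‖ * ‖b‖ := by
  rw [← sq_eq_sq₀ (norm_nonneg _) (by positivity), mul_pow]
  simp_rw [EuclideanSpace.norm_sq_eq]
  simp [Fintype.sum_prod_type, Finset.sum_mul_sum, mul_pow]

theorem le_sq_of_le_quadratic_form {A B s x : ℝ} (hA : 0 ≤ A) (hB : 0 ≤ B) (hs : 0 ≤ s)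
    (h : x ≤ 12 * (A * B) + 3 * B ^ 2 + 3 * s ^ 2) : x ≤ (4 * (A + B + s)) ^ 2 := by
  nlinarith [mul_nonneg hA hB, mul_nonneg hA hs, mul_nonneg hB hs, sq_nonneg A, sq_nonneg B,
    sq_nonneg s]

/-- Bounds for the terms `ξ_i ξ̄ᵀ + ξ̄ ξ_iᵀ - ξ̄ ξ̄ᵀ - S / N`, where `ξ̄` is the mean of the `ξ_i`. -/
theorem sum_norm_sq_recentering_le (hN : 0 < N) (ξ : Fin N → EuclideanSpace ℝ (Fin p))
    (b : EuclideanSpace ℝ (Fin p)) (S : EuclideanSpace ℝ (Fin p × Fin p)) :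
    ∑ i, ‖tensorVec p (ξ i) b + tensorVec p b (ξ i) - tensorVec p b b - (N : ℝ)⁻¹ • S‖ ^ 2 ≤
      (4 * ((N : ℝ)⁻¹ * ∑ i, ‖ξ i‖ ^ 2 + N * ‖b‖ ^ 2 + ‖S‖)) ^ 2 := by
  have hN' : (0 : ℝ) < N := Nat.cast_pos.2 hN
  have hN1 : (N : ℝ)⁻¹ ≤ 1 := inv_le_one_of_one_le₀ (by exact_mod_cast hN)
  -- From (x + y + z)² ≤ 3(x² + y² + z²) with x = 2‖b‖‖ξ_i‖, whence 12 = 3 · 4.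
  have h1 : ∀ i, ‖tensorVec p (ξ i) b + tensorVec p b (ξ i) - tensorVec p b b -
      (N : ℝ)⁻¹ • S‖ ^ 2 ≤ 12 * (‖b‖ ^ 2 * ‖ξ i‖ ^ 2) + 3 * (‖b‖ ^ 2) ^ 2 +
        3 * ((N : ℝ)⁻¹ * ‖S‖) ^ 2 := fun i => by
    have h2 : ‖tensorVec p (ξ i) b + tensorVec p b (ξ i) - tensorVec p b b - (N : ℝ)⁻¹ • S‖ ≤
        2 * (‖b‖ * ‖ξ i‖) + ‖b‖ ^ 2 + (N : ℝ)⁻¹ * ‖S‖ := by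
      refine (norm_sub_le _ _).trans (add_le_add ((norm_sub_le _ _).trans
        (add_le_add ((norm_add_le _ _).trans (le_of_eq ?_)) (le_of_eq ?_))) (le_of_eq ?_))
      · rw [norm_tensorVec, norm_tensorVec]; ring
      · rw [norm_tensorVec, sq]
      · rw [norm_smul, Real.norm_of_nonneg (by positivity)]
    refine (pow_le_pow_left₀ (norm_nonneg _) h2 2).trans ?_
    nlinarith [sq_nonneg (2 * (‖b‖ * ‖ξ i‖) - ‖b‖ ^ 2), sq_nonneg (‖b‖ ^ 2 - (N : ℝ)⁻¹ * ‖S‖),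
      sq_nonneg (2 * (‖b‖ * ‖ξ i‖) - (N : ℝ)⁻¹ * ‖S‖)]
  refine le_sq_of_le_quadratic_form (by positivity) (by positivity)
    (norm_nonneg _) ((Finset.sum_le_sum fun i _ => h1 i).trans ?_)
  simp only [Finset.sum_add_distrib, ← Finset.mul_sum, Finset.sum_const, Finset.card_univ,
    Fintype.card_fin, nsmul_eq_mul]
  have e1 : (N : ℝ)⁻¹ * (∑ i, ‖ξ i‖ ^ 2) * (N * ‖b‖ ^ 2) = ‖b‖ ^ 2 * ∑ i, ‖ξ i‖ ^ 2 := by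
    field_simp
  have e2 : (N : ℝ) * (3 * (‖b‖ ^ 2) ^ 2) ≤ 3 * (N * ‖b‖ ^ 2) ^ 2 := by
    have : (N : ℝ) ≤ N ^ 2 := by exact_mod_cast Nat.le_self_pow two_ne_zero N
    calc (N : ℝ) * (3 * (‖b‖ ^ 2) ^ 2) ≤ N ^ 2 * (3 * (‖b‖ ^ 2) ^ 2) := by gcongr
      _ = _ := by ring
  have e3 : (N : ℝ) * (3 * ((N : ℝ)⁻¹ * ‖S‖) ^ 2) ≤ 3 * ‖S‖ ^ 2 := by
    have : (N : ℝ) * (3 * ((N : ℝ)⁻¹ * ‖S‖) ^ 2) = (N : ℝ)⁻¹ * (3 * ‖S‖ ^ 2) := by field_simp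
    rw [this]
    exact mul_le_of_le_one_left (by positivity) hN1
  rw [e1]
  linarith

/-- Since ∑ ξ_i = N b, the two linear terms give 2N b ⊗ b, of which the quadratic term cancels half.
-/
theorem sum_recentering_eq (hN : 0 < N) {ξ : Fin N → EuclideanSpace ℝ (Fin p)}
    {b : EuclideanSpace ℝ (Fin p)} (hb : ∑ i, ξ i = (N : ℝ) • b)
    (S : EuclideanSpace ℝ (Fin p × Fin p)) :
    ∑ i, (tensorVec p (ξ i) b + tensorVec p b (ξ i) - tensorVec p b b - (N : ℝ)⁻¹ • S) =
      (N : ℝ) • tensorVec p b b - S := by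
  have hN' : (N : ℝ) ≠ 0 := Nat.cast_ne_zero.2 hN.ne'
  simp only [Finset.sum_sub_distrib, Finset.sum_add_distrib, ← map_sum, ← LinearMap.sum_apply, hb,
    map_smul, LinearMap.smul_apply, Finset.sum_const, Finset.card_univ, Fintype.card_fin]
  rw [← Nat.cast_smul_eq_nsmul ℝ N, ← Nat.cast_smul_eq_nsmul ℝ N, smul_smul, mul_inv_cancel₀ hN',
    one_smul, map_smul, add_sub_cancel_right]

/-- The mean of a sample. -/
def sampleMean (x : Fin N → Fin p → ℝ) : Fin p → ℝ := (N : ℝ)⁻¹ • ∑ i, x i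

/-- The deviation `x - m` as a Euclidean vector. -/
def devVec (m x : Fin p → ℝ) : EuclideanSpace ℝ (Fin p) := WithLp.toLp 2 (x - m)

theorem norm_devVec_sq (m x : Fin p → ℝ) : ‖devVec m x‖ ^ 2 = ∑ a, (x a - m a) ^ 2 := by
  simp [EuclideanSpace.norm_sq_eq, devVec]

theorem sum_devVec (hN : 0 < N) (m : Fin p → ℝ) (x : Fin N → Fin p → ℝ) :
    ∑ i, devVec m (x i) = (N : ℝ) • devVec m (sampleMean x) := by
  have hN' : (N : ℝ) ≠ 0 := Nat.cast_ne_zero.2 hN.ne'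
  ext a
  simp [devVec, sampleMean, mul_sub, hN']

theorem mul_norm_devVec_sampleMean_sq (hN : 0 < N) (m : Fin p → ℝ) (x : Fin N → Fin p → ℝ) :
    N * ‖devVec m (sampleMean x)‖ ^ 2 = (N : ℝ)⁻¹ * ∑ a, (∑ i, (x i a - m a)) ^ 2 := by
  have hN' : (N : ℝ) ≠ 0 := Nat.cast_ne_zero.2 hN.ne'
  have h : ∀ a, (∑ i, (x i a - m a)) = N * (sampleMean x a - m a) := fun a => by
    simp [sampleMean, mul_sub, hN']
  simp_rw [h, mul_pow, ← Finset.mul_sum, norm_devVec_sq]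
  field_simp

/-- The difference between the centred matrix `(x_i - μ)(x_i - μ)ᵀ - Σ` and its empirical
version. -/
def recentering (ν : Measure (Fin p → ℝ)) (x : Fin N → Fin p → ℝ) (i : Fin N) :
    EuclideanSpace ℝ (Fin p × Fin p) :=
  centeredVec ν (x i) -
    matVec (outer (sampleMean x) (x i) - (((N : ℝ) - 1) / N) • covMat ν)

/-- A bound for the size of `recentering`. -/
def recenteringBound (ν : Measure (Fin p → ℝ)) (x : Fin N → Fin p → ℝ) : ℝ :=
  4 * ((N : ℝ)⁻¹ * ∑ i, ‖devVec (meanVec ν) (x i)‖ ^ 2 +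
    N * ‖devVec (meanVec ν) (sampleMean x)‖ ^ 2 + ‖matVec (covMat ν)‖)

/-- Put ξ_i = x_i − μ and b = x̄ − μ, and expand (ξ_i − b)(ξ_i − b)ᵀ; the factor (N − 1)/N leaves
Σ/N. -/
theorem recentering_eq (hN : 0 < N) (ν : Measure (Fin p → ℝ)) (x : Fin N → Fin p → ℝ)
    (i : Fin N) : recentering ν x i =
      tensorVec p (devVec (meanVec ν) (x i)) (devVec (meanVec ν) (sampleMean x)) +
      tensorVec p (devVec (meanVec ν) (sampleMean x)) (devVec (meanVec ν) (x i)) -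
      tensorVec p (devVec (meanVec ν) (sampleMean x)) (devVec (meanVec ν) (sampleMean x)) -
      (N : ℝ)⁻¹ • matVec (covMat ν) := by
  have hN' : (N : ℝ) ≠ 0 := Nat.cast_ne_zero.2 hN.ne'
  ext s
  simp only [recentering, centeredVec, PiLp.sub_apply, PiLp.add_apply, PiLp.smul_apply,
    matVec_apply, tensorVec_apply, Matrix.sub_apply, Matrix.smul_apply, outer,
    Matrix.vecMulVec_apply, Pi.sub_apply, devVec, smul_eq_mul]
  field_simp
  ring

theorem sqrt_sum_norm_recentering_sq_le (hN : 0 < N) (ν : Measure (Fin p → ℝ))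
    (x : Fin N → Fin p → ℝ) : √(∑ i, ‖recentering ν x i‖ ^ 2) ≤ recenteringBound ν x := by
  refine Real.sqrt_le_iff.2 ⟨by unfold recenteringBound; positivity, ?_⟩
  simp_rw [recentering_eq hN]
  exact sum_norm_sq_recentering_le hN _ _ _

theorem norm_sum_recentering_le (hN : 0 < N) (ν : Measure (Fin p → ℝ))
    (x : Fin N → Fin p → ℝ) : ‖∑ i, recentering ν x i‖ ≤ recenteringBound ν x := by
  simp_rw [recentering_eq hN]
  rw [sum_recentering_eq hN (sum_devVec hN _ x)]
  refine (norm_sub_le _ _).trans ?_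
  rw [norm_smul, norm_tensorVec, ← sq, Real.norm_of_nonneg (Nat.cast_nonneg N), recenteringBound]
  have h1 : 0 ≤ (N : ℝ)⁻¹ * ∑ i, ‖devVec (meanVec ν) (x i)‖ ^ 2 := by positivity
  have h2 : 0 ≤ N * ‖devVec (meanVec ν) (sampleMean x)‖ ^ 2 := by positivity
  linarith [norm_nonneg (matVec (covMat ν))]

theorem measurable_recentering (ν : Measure (Fin p → ℝ)) (i : Fin N) :
    Measurable fun x : Fin N → Fin p → ℝ => recentering ν x i := by
  refine (measurable_centeredVec.comp (measurable_pi_apply i)).sub (measurable_matVec fun a b => ?_)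
  simp only [outer, Matrix.sub_apply, Matrix.vecMulVec_apply, Pi.sub_apply, sampleMean,
    Pi.smul_apply, Finset.sum_apply]
  fun_prop

theorem measurable_recenteringBound (ν : Measure (Fin p → ℝ)) :
    Measurable fun x : Fin N → Fin p → ℝ => recenteringBound ν x := by
  simp only [recenteringBound, norm_devVec_sq, sampleMean, Pi.smul_apply, Finset.sum_apply]
  fun_prop

section Expectation

variable {ν : Measure (Fin p → ℝ)} [IsProbabilityMeasure ν]

theorem memLp_sub_meanVec (hL2 : ∀ a, MemLp (fun x : Fin p → ℝ => x a) 2 ν) (a : Fin p) :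
    MemLp (fun x : Fin p → ℝ => x a - meanVec ν a) 2 ν :=
  (hL2 a).sub (memLp_const (meanVec ν a))

theorem integral_sub_meanVec (hL2 : ∀ a, MemLp (fun x : Fin p → ℝ => x a) 2 ν) (a : Fin p) :
    ∫ x, (x a - meanVec ν a) ∂ν = 0 := by
  rw [integral_sub ((hL2 a).integrable (by norm_num)) (integrable_const _)]
  simp [meanVec]

theorem integral_sub_meanVec_sq (a : Fin p) :
    ∫ x, (x a - meanVec ν a) ^ 2 ∂ν = covMat ν a a := by
  simp_rw [sq]
  rfl

theorem abs_covMat_le (hL2 : ∀ a, MemLp (fun x : Fin p → ℝ => x a) 2 ν) {C₀ : ℝ}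
    (hC₀ : ∀ a, covMat ν a a ≤ C₀) (a b : Fin p) : |covMat ν a b| ≤ C₀ := by
  have hi : ∀ a, Integrable (fun x : Fin p → ℝ => (x a - meanVec ν a) ^ 2) ν := fun a =>
    (memLp_sub_meanVec hL2 a).integrable_sq
  have hab : Integrable (fun x : Fin p → ℝ => (x a - meanVec ν a) * (x b - meanVec ν b)) ν :=
    (memLp_sub_meanVec hL2 a).integrable_mul (memLp_sub_meanVec hL2 b)
  have h1 : |covMat ν a b| ≤ ∫ x, |(x a - meanVec ν a) * (x b - meanVec ν b)| ∂ν :=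
    abs_integral_le_integral_abs
  have h2 : ∫ x, |(x a - meanVec ν a) * (x b - meanVec ν b)| ∂ν ≤
      ∫ x, ((x a - meanVec ν a) ^ 2 + (x b - meanVec ν b) ^ 2) / 2 ∂ν := by
    refine integral_mono hab.abs (((hi a).add (hi b)).div_const 2) fun x => ?_
    have h3 := two_mul_le_add_sq |x a - meanVec ν a| |x b - meanVec ν b|
    rw [sq_abs, sq_abs] at h3
    simp only [abs_mul]
    linarith
  rw [integral_div, integral_add (hi a) (hi b), integral_sub_meanVec_sq,
    integral_sub_meanVec_sq] at h2
  linarith [hC₀ a, hC₀ b]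

theorem norm_matVec_covMat_le (hL2 : ∀ a, MemLp (fun x : Fin p → ℝ => x a) 2 ν) {C₀ : ℝ}
    (h0 : 0 ≤ C₀) (hC₀ : ∀ a, covMat ν a a ≤ C₀) : ‖matVec (covMat ν)‖ ≤ C₀ * p := by
  rw [EuclideanSpace.norm_eq]
  refine Real.sqrt_le_iff.2 ⟨by positivity, ?_⟩
  have h : ∀ s : Fin p × Fin p, ‖matVec (covMat ν) s‖ ^ 2 ≤ C₀ ^ 2 := fun s =>
    pow_le_pow_left₀ (norm_nonneg _) (abs_covMat_le hL2 hC₀ s.1 s.2) 2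
  refine (Finset.sum_le_sum fun s _ => h s).trans (le_of_eq ?_)
  simp
  ring

theorem integrable_comp_eval {g : (Fin p → ℝ) → ℝ} (hg : Integrable g ν) (i : Fin N) :
    Integrable (fun x : Fin N → Fin p → ℝ => g (x i)) (Measure.pi fun _ : Fin N => ν) :=
  (measurePreserving_eval (fun _ : Fin N => ν) i).integrable_comp_of_integrable hg

theorem integral_comp_eval {g : (Fin p → ℝ) → ℝ} (hg : AEStronglyMeasurable g ν) (i : Fin N) :
    ∫ x : Fin N → Fin p → ℝ, g (x i) ∂(Measure.pi fun _ : Fin N => ν) = ∫ x, g x ∂ν := by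
  have h := (measurePreserving_eval (fun _ : Fin N => ν) i).map_eq
  rw [← integral_map (φ := Function.eval i) (measurable_pi_apply i).aemeasurable
    (by rw [h]; exact hg), h]

theorem integral_sum_sub_meanVec_sq (hL2 : ∀ a, MemLp (fun x : Fin p → ℝ => x a) 2 ν)
    (a : Fin p) :
    Integrable (fun x : Fin N → Fin p → ℝ => (∑ i, (x i a - meanVec ν a)) ^ 2)
      (Measure.pi fun _ : Fin N => ν) ∧
    ∫ x : Fin N → Fin p → ℝ, (∑ i, (x i a - meanVec ν a)) ^ 2 ∂(Measure.pi fun _ : Fin N => ν)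
      = N * covMat ν a a := by
  have hX : ∀ i : Fin N, MemLp (fun x : Fin N → Fin p → ℝ => x i a - meanVec ν a) 2
      (Measure.pi fun _ : Fin N => ν) := fun i =>
    (memLp_sub_meanVec hL2 a).comp_measurePreserving (measurePreserving_eval (fun _ : Fin N => ν) i)
  have hm : Measurable fun x : Fin p → ℝ => x a - meanVec ν a := by fun_prop
  have hind : iIndepFun (fun (i : Fin N) (x : Fin N → Fin p → ℝ) => x i a - meanVec ν a)
      (Measure.pi fun _ : Fin N => ν) :=
    iIndepFun_pi (μ := fun _ : Fin N => ν) (X := fun _ x => x a - meanVec ν a)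
      fun i => hm.aemeasurable
  refine ⟨(memLp_finsetSum Finset.univ fun i _ => hX i).integrable_sq, ?_⟩
  rw [integral_sum_sq_eq hX (fun i j hij => hind.indepFun hij) fun i => by
    rw [integral_comp_eval (g := fun x => x a - meanVec ν a) hm.aestronglyMeasurable i,
      integral_sub_meanVec hL2]]
  have h : ∀ i : Fin N, ∫ x : Fin N → Fin p → ℝ, (x i a - meanVec ν a) ^ 2
      ∂(Measure.pi fun _ : Fin N => ν) = covMat ν a a := fun i => by
    rw [integral_comp_eval (g := fun x => (x a - meanVec ν a) ^ 2)
      (hm.pow_const 2).aestronglyMeasurable i, integral_sub_meanVec_sq]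
  simp [h]

/-- Both N⁻¹ ∑ ‖ξ_i‖² and N‖b‖² have expectation tr Σ ≤ C₀p, and the Frobenius norm of Σ is at most
C₀p. Three such terms times 4 give 12 C₀p. -/
theorem isSmallPerturbation_recentering (hN : 0 < N)
    (hL2 : ∀ a, MemLp (fun x : Fin p → ℝ => x a) 2 ν) {C₀ : ℝ}
    (h0 : 0 ≤ C₀) (hC₀ : ∀ a, covMat ν a a ≤ C₀) :
    IsSmallPerturbation ν (recentering (N := N) ν) (recenteringBound ν) (12 * C₀ * p) := by
  have hN' : (N : ℝ) ≠ 0 := Nat.cast_ne_zero.2 hN.ne'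
  refine ⟨measurable_recentering ν, measurable_recenteringBound ν, by positivity,
    sqrt_sum_norm_recentering_sq_le hN ν, norm_sum_recentering_le hN ν, ?_⟩
  have htr : ∑ a, covMat ν a a ≤ C₀ * p := by
    refine (Finset.sum_le_sum fun a _ => hC₀ a).trans (le_of_eq ?_)
    simp [mul_comm]
  have hia : ∀ (i : Fin N) (a : Fin p), Integrable
      (fun x : Fin N → Fin p → ℝ => (x i a - meanVec ν a) ^ 2) (Measure.pi fun _ : Fin N => ν) :=
    fun i a => integrable_comp_eval (memLp_sub_meanVec hL2 a).integrable_sq i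
  have i1 : Integrable (fun x : Fin N → Fin p → ℝ =>
      (N : ℝ)⁻¹ * ∑ i, ‖devVec (meanVec ν) (x i)‖ ^ 2) (Measure.pi fun _ : Fin N => ν) := by
    simp_rw [norm_devVec_sq]
    exact (integrable_finsetSum _ fun i _ => integrable_finsetSum _ fun a _ => hia i a).const_mul _
  have i2 : Integrable (fun x : Fin N → Fin p → ℝ =>
      N * ‖devVec (meanVec ν) (sampleMean x)‖ ^ 2) (Measure.pi fun _ : Fin N => ν) := by
    simp_rw [mul_norm_devVec_sampleMean_sq hN]
    exact (integrable_finsetSum _ fun a _ => (integral_sum_sub_meanVec_sq hL2 a).1).const_mul _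
  have v1 : ∫ x : Fin N → Fin p → ℝ, (N : ℝ)⁻¹ * ∑ i, ‖devVec (meanVec ν) (x i)‖ ^ 2
      ∂(Measure.pi fun _ : Fin N => ν) = ∑ a, covMat ν a a := by
    simp_rw [norm_devVec_sq]
    rw [integral_const_mul, integral_finsetSum _ fun i _ => integrable_finsetSum _ fun a _ =>
      hia i a]
    have h : ∀ i : Fin N, ∫ x : Fin N → Fin p → ℝ, ∑ a, (x i a - meanVec ν a) ^ 2
        ∂(Measure.pi fun _ : Fin N => ν) = ∑ a, covMat ν a a := fun i => by
      rw [integral_finsetSum _ fun a _ => hia i a]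
      refine Finset.sum_congr rfl fun a _ => ?_
      rw [integral_comp_eval (g := fun x => (x a - meanVec ν a) ^ 2)
        (memLp_sub_meanVec hL2 a).integrable_sq.aestronglyMeasurable i, integral_sub_meanVec_sq]
    simp [h, hN']
  have v2 : ∫ x : Fin N → Fin p → ℝ, N * ‖devVec (meanVec ν) (sampleMean x)‖ ^ 2
      ∂(Measure.pi fun _ : Fin N => ν) = ∑ a, covMat ν a a := by
    simp_rw [mul_norm_devVec_sampleMean_sq hN]
    rw [integral_const_mul, integral_finsetSum _ fun a _ => (integral_sum_sub_meanVec_sq hL2 a).1]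
    simp_rw [(integral_sum_sub_meanVec_sq hL2 _).2, ← Finset.mul_sum]
    rw [inv_mul_cancel_left₀ hN']
  have i12 : Integrable (fun x : Fin N → Fin p → ℝ =>
      (N : ℝ)⁻¹ * ∑ i, ‖devVec (meanVec ν) (x i)‖ ^ 2 +
      N * ‖devVec (meanVec ν) (sampleMean x)‖ ^ 2) (Measure.pi fun _ : Fin N => ν) := i1.add i2
  have i3 : Integrable (fun x : Fin N → Fin p → ℝ => recenteringBound ν x)
      (Measure.pi fun _ : Fin N => ν) := (i12.add (integrable_const _)).const_mul 4
  rw [← ofReal_integral_eq_lintegral_ofReal i3 (ae_of_all _ fun x =>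
    (Real.sqrt_nonneg _).trans (sqrt_sum_norm_recentering_sq_le hN ν x))]
  refine ENNReal.ofReal_le_ofReal ?_
  simp only [recenteringBound]
  rw [integral_const_mul, integral_add i12 (integrable_const _), integral_add i1 i2, v1, v2]
  simp only [integral_const, probReal_univ, one_smul]
  linarith [norm_matVec_covMat_le hL2 h0 hC₀]

end Expectation

end SampleMean


/-! ### Consequences of the growth condition A3. -/

section Rates

/-- With d = min(2, δ) the exponent of A3 becomes the one for which p^(2+d) = o(n^(d/2)), as
Lyapunov's condition requires. -/
theorem min_two_exponent_eq {δ : ℝ} (hδ : 0 < δ) :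
    (δ + min 2 δ) / (4 * (2 + δ)) = min 2 δ / (2 * (2 + min 2 δ)) := by
  rcases le_total 2 δ with h | h
  · rw [min_eq_left h]
    field_simp
    ring
  · rw [min_eq_right h]
    field_simp
    ring

theorem le_three_mul_half {n : ℕ} (hn : 2 ≤ n) : (n : ℝ) ≤ 3 * (n / 2 : ℕ) := by
  have : n ≤ 3 * (n / 2) := by omega
  exact_mod_cast this

variable {p : ℕ → ℕ} {d : ℝ}

/-- The rate is raised to the power 2 + d; passing from n to ⌊n/2⌋ costs a constant, as n ≤ 3⌊n/2⌋
for n ≥ 2. -/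
theorem tendsto_half_rpow_mul_rpow (hd : 0 < d)
    (h : (fun n => (p n : ℝ)) =o[atTop] fun n : ℕ => (n : ℝ) ^ (d / (2 * (2 + d)))) :
    Tendsto (fun n => ((n / 2 : ℕ) : ℝ) ^ (-(d / 2)) * (p n : ℝ) ^ (2 + d)) atTop (𝓝 0) := by
  have h1 := (h.tendsto_div_nhds_zero.rpow_const (p := 2 + d) (Or.inr (by linarith))).const_mul
    ((3 : ℝ) ^ (d / 2))
  rw [Real.zero_rpow (by linarith), mul_zero] at h1
  refine squeeze_zero' (Eventually.of_forall fun n => by positivity) ?_ h1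
  filter_upwards [eventually_ge_atTop 2] with n hn
  have hn0 : (0 : ℝ) < n := by exact_mod_cast (by omega : 0 < n)
  have hN0 : (0 : ℝ) < (n / 2 : ℕ) := by linarith [le_three_mul_half hn]
  have e : ((n : ℝ) ^ (d / (2 * (2 + d)))) ^ (2 + d) = (n : ℝ) ^ (d / 2) := by
    rw [← Real.rpow_mul hn0.le]
    congr 1
    field_simp
  rw [Real.div_rpow (by positivity) (by positivity), e, Real.rpow_neg hN0.le, ← mul_div_assoc,
    mul_div_right_comm]
  refine mul_le_mul_of_nonneg_right ?_ (by positivity)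
  rw [inv_le_comm₀ (by positivity) (by positivity), inv_div, ← Real.div_rpow hn0.le (by norm_num)]
  exact Real.rpow_le_rpow (by positivity) (by linarith [le_three_mul_half hn]) (by positivity)

/-- The exponent d/(2(2 + d)) is below 1/2. -/
theorem tendsto_div_sqrt_half (hd : 0 < d)
    (h : (fun n => (p n : ℝ)) =o[atTop] fun n : ℕ => (n : ℝ) ^ (d / (2 * (2 + d)))) :
    Tendsto (fun n => (p n : ℝ) / √((n / 2 : ℕ) : ℝ)) atTop (𝓝 0) := by
  have h1 := h.tendsto_div_nhds_zero.const_mul √3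
  rw [mul_zero] at h1
  refine squeeze_zero' (Eventually.of_forall fun n => by positivity) ?_ h1
  filter_upwards [eventually_ge_atTop 2] with n hn
  have hn1 : (1 : ℝ) ≤ n := by exact_mod_cast (by omega : 1 ≤ n)
  have hn0 : (0 : ℝ) < n := by linarith
  have hN0 : (0 : ℝ) < (n / 2 : ℕ) := by linarith [le_three_mul_half hn]
  have e : (n : ℝ) ^ (d / (2 * (2 + d))) ≤ √3 * √((n / 2 : ℕ) : ℝ) := by
    rw [← Real.sqrt_mul (by norm_num)]
    refine le_trans ?_ (Real.sqrt_le_sqrt (le_three_mul_half hn))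
    rw [Real.sqrt_eq_rpow]
    refine Real.rpow_le_rpow_of_exponent_le hn1 ?_
    rw [div_le_div_iff₀ (by positivity) two_pos]
    linarith
  rw [← mul_div_assoc, div_le_div_iff₀ (by positivity) (by positivity)]
  have := mul_le_mul_of_nonneg_left e (Nat.cast_nonneg (α := ℝ) (p n))
  linarith

end Rates

/-! ### Normalising the moment assumption A2. -/

section Moments

theorem sum_prodAbsMoment_le {p : ℕ} (hp : 0 < p) {ν : Measure (Fin p → ℝ)}
    [IsProbabilityMeasure ν] {r r' C : ℝ} (hr : 0 ≤ r) (hrr' : r ≤ r')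
    (h : (∑ a, ∑ b, prodAbsMoment ν r' a b) / (p : ℝ≥0∞) ^ 2 ≤ ENNReal.ofReal C) :
    ∑ a, ∑ b, prodAbsMoment ν r a b ≤ ENNReal.ofReal ((1 + |C|) * p ^ 2) := by
  have hp2 : (p : ℝ≥0∞) ^ 2 = ENNReal.ofReal ((p : ℝ) ^ 2) := by
    rw [ENNReal.ofReal_pow (Nat.cast_nonneg p), ENNReal.ofReal_natCast]
  have h0 : (p : ℝ≥0∞) ^ 2 ≠ 0 := by positivity
  have ht : (p : ℝ≥0∞) ^ 2 ≠ ⊤ := by simp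
  rw [ENNReal.div_le_iff h0 ht] at h
  refine (Finset.sum_le_sum fun a _ => Finset.sum_le_sum fun b _ =>
    prodAbsMoment_le_one_add hr hrr' a b).trans ?_
  simp only [Finset.sum_add_distrib, Finset.sum_const, Finset.card_univ, Fintype.card_fin,
    nsmul_eq_mul, mul_one]
  rw [← sq, add_mul, one_mul, ENNReal.ofReal_add (by positivity) (by positivity), ← hp2]
  refine add_le_add le_rfl (h.trans ?_)
  rw [hp2, ENNReal.ofReal_mul (abs_nonneg C)]
  exact mul_le_mul' (ENNReal.ofReal_le_ofReal (le_abs_self C)) le_rfl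

theorem IsSmallPerturbation.mono {𝒳 E : Type*} [MeasurableSpace 𝒳] [NormedAddCommGroup E]
    [MeasurableSpace E] {π : Measure 𝒳} {N : ℕ} {D : (Fin N → 𝒳) → Fin N → E}
    {Λ : (Fin N → 𝒳) → ℝ} {B B' : ℝ} (h : IsSmallPerturbation π D Λ B) (hB : B ≤ B') :
    IsSmallPerturbation π D Λ B' :=
  ⟨h.measurable, h.measurable_bound, h.nonneg.trans hB, h.sqrt_sum_norm_sq_le, h.norm_sum_le,
    h.lintegral_le.trans (ENNReal.ofReal_le_ofReal hB)⟩

end Moments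

/-! ### The limit theorem on product spaces. -/

section ProductSpace

variable {p : ℕ → ℕ} {ν : ∀ n, Measure (Fin (p n) → ℝ)} [∀ n, IsProbabilityMeasure (ν n)]

/-- The limit theorem on product spaces, for general small perturbations of the centred
matrices. -/
theorem tendstoInDistribution_elRatio_centeredVec (hp : ∀ n, 0 < p n)
    (hL2 : ∀ᶠ n in atTop, ∀ a, MemLp (fun x : Fin (p n) → ℝ => x a) 2 (ν n)) {c δ C : ℝ}
    (hc : 0 < c) (hδ : 0 < δ)
    (htr : ∀ᶠ n in atTop, c ≤ (prodCovMat (ν n) ^ 2).trace / (p n : ℝ) ^ 2)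
    (hones : ∀ᶠ n in atTop, c ≤ onesForm (prodCovMat (ν n)) / (p n : ℝ) ^ 2)
    (hmom : ∀ᶠ n in atTop, (∑ a, ∑ b, prodAbsMoment (ν n) (2 + δ) a b) / (p n : ℝ≥0∞) ^ 2
        ≤ ENNReal.ofReal C)
    (hrate : (fun n => (p n : ℝ)) =o[atTop]
      fun n : ℕ => (n : ℝ) ^ ((δ + min 2 δ) / (4 * (2 + δ))))
    {D : ∀ n, (Fin (n / 2) → Fin (p n) → ℝ) → Fin (n / 2) →
      EuclideanSpace ℝ (Fin (p n) × Fin (p n))}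
    (hDm : ∀ n i, Measurable fun x => D n x i)
    {Λ : ∀ n, (Fin (n / 2) → Fin (p n) → ℝ) → ℝ} {K : ℝ} (hK : 0 ≤ K)
    (hD : ∀ᶠ n in atTop, IsSmallPerturbation (ν n) (D n) (Λ n) (K * p n)) :
    TendstoInDistribution
      (fun n (ω : (Fin (n / 2) → Fin (p n) → ℝ) × (Fin (n / 2) → Fin (p n) → ℝ)) =>
        negTwoLog (elRatio fun i =>
          ((inner ℝ (centeredVec (ν n) (ω.1 i) - D n ω.1 i)
              (centeredVec (ν n) (ω.2 i) - D n ω.2 i),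
            inner ℝ (onesVec (p n)) (centeredVec (ν n) (ω.1 i) - D n ω.1 i) +
              inner ℝ (onesVec (p n)) (centeredVec (ν n) (ω.2 i) - D n ω.2 i)) : ℝ × ℝ)))
      atTop (fun t : ℝ => (t : EReal))
      (fun n => (Measure.pi fun _ : Fin (n / 2) => ν n).prod
        (Measure.pi fun _ : Fin (n / 2) => ν n))
      (chiSquared 2) := by
  set d := min 2 δ with hd_def
  have hd : 0 < d := lt_min two_pos hδ
  rw [min_two_exponent_eq hδ] at hrate
  have hp' : ∀ n, (0 : ℝ) < p n := fun n => Nat.cast_pos.2 (hp n)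
  have hC1 : (1 : ℝ) ≤ 1 + |C| := le_add_of_nonneg_right (abs_nonneg C)
  have hm : ∀ r : ℝ, 2 ≤ r → r ≤ 2 + δ → ∀ᶠ n in atTop,
      Integrable (fun x => ‖centeredVec (ν n) x‖ ^ r) (ν n) ∧
        ∫ x, ‖centeredVec (ν n) x‖ ^ r ∂ν n ≤ (1 + |C|) * (p n : ℝ) ^ r := fun r h1 h2 =>
    hmom.mono fun n h => integrable_norm_centeredVec_rpow (hp n) h1 (by linarith)
      (sum_prodAbsMoment_le (hp n) (by linarith) h2 h)
  have hmd := hm (2 + d) (by linarith) (by linarith [min_le_right 2 δ])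
  have hZ : ∀ᶠ n in atTop, IsCenteredVector (ν n) (centeredVec (ν n)) d := by
    filter_upwards [hL2, hmd] with n h1 h2
    exact isCenteredVector_centeredVec h1 hd h2.1
  -- A single constant serves the moment of order 2 + d, the second moment and the size of the
  -- perturbation.
  refine tendstoInDistribution_negTwoLog_elRatio_pairs (C := 1 + |C| + K)
    (Z := fun n => centeredVec (ν n)) (u := fun n => onesVec (p n)) (q := fun n => p n)
    (N := fun n => n / 2) (Λ := Λ) (D := D)
    (fun n => measurable_centeredVec) hd hZ hc (by linarith) hp' (fun n => norm_onesVec) ?_ ?_ ?_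
    (Nat.tendsto_div_const_atTop two_ne_zero) (tendsto_half_rpow_mul_rpow hd hrate)
    (tendsto_div_sqrt_half hd hrate) ?_ hDm ?_
  · filter_upwards [hmd] with n h
    refine h.2.trans (mul_le_mul_of_nonneg_right (by linarith) (by positivity))
  · filter_upwards [hZ, htr] with n h1 h2
    rw [integral_inner_centeredVec_sq h1]
    exact (le_div_iff₀ (by have := hp' n; positivity)).1 h2
  · filter_upwards [hZ, hones] with n h1 h2
    rw [integral_inner_onesVec_sq h1]
    exact (le_div_iff₀ (by have := hp' n; positivity)).1 h2
  · filter_upwards [hm 2 le_rfl (by linarith)] with n h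
    have h2 := h.2
    simp only [Real.rpow_two] at h2
    refine h2.trans ?_
    rw [mul_pow]
    refine mul_le_mul_of_nonneg_right ?_ (by positivity)
    nlinarith
  · filter_upwards [hD] with n h
    exact h.mono (mul_le_mul_of_nonneg_right (by linarith) (hp' n).le)

end ProductSpace

/-! ### The two halves of a sample. -/

section Halves

variable {n p : ℕ} {Ω : Type*} [MeasurableSpace Ω] {P : Measure Ω} [IsProbabilityMeasure P]
  {ν : Measure (Fin p → ℝ)} {X : Fin n → Ω → Fin p → ℝ}

/-- The two index maps have disjoint ranges and are injective, so together they select distinct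
observations; for odd n the last one is left out. -/
theorem map_halves_eq [IsProbabilityMeasure ν] (hind : iIndepFun X P)
    (hlaw : ∀ i, HasLaw (X i) ν P) :
    P.map (fun ω => ((fun i => X (idx₁ i) ω), (fun i => X (idx₂ i) ω))) =
      (Measure.pi fun _ : Fin (n / 2) => ν).prod (Measure.pi fun _ : Fin (n / 2) => ν) := by
  set g : Fin (n / 2) ⊕ Fin (n / 2) → Fin n := Sum.elim idx₁ idx₂ with hg_def
  have hg : Function.Injective g := by
    rintro (i | i) (j | j) h <;>
      simp only [hg_def, Sum.elim_inl, Sum.elim_inr, idx₁, idx₂, Fin.mk.injEq] at h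
    · exact congrArg _ (Fin.ext h)
    · omega
    · omega
    · exact congrArg _ (Fin.ext (by omega))
  have h1 := (hind.precomp hg).map_fun_eq_pi_map fun s => (hlaw (g s)).aemeasurable
  simp_rw [(hlaw _).map_eq] at h1
  have h2 := measurePreserving_sumPiEquivProdPi
    (fun _ : Fin (n / 2) ⊕ Fin (n / 2) => ν)
  rw [← h2.map_eq, ← h1, AEMeasurable.map_map_of_aemeasurable h2.measurable.aemeasurable
    (aemeasurable_pi_lambda _ fun s => (hlaw (g s)).aemeasurable)]
  rfl

theorem aemeasurable_halves (hlaw : ∀ i, HasLaw (X i) ν P) :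
    AEMeasurable (fun ω => ((fun i : Fin (n / 2) => X (idx₁ i) ω),
      (fun i : Fin (n / 2) => X (idx₂ i) ω))) P :=
  (aemeasurable_pi_lambda _ fun i => (hlaw (idx₁ i)).aemeasurable).prodMk
    (aemeasurable_pi_lambda _ fun i => (hlaw (idx₂ i)).aemeasurable)

theorem pair_eq_inner {A B S : Matrix (Fin p) (Fin p) ℝ} (hB : B.IsSymm) (hS : S.IsSymm) :
    (((A - S) * (B - S)).trace, onesForm (A + B - (2 : ℝ) • S)) =
      ((inner ℝ (matVec (A - S)) (matVec (B - S)),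
        inner ℝ (onesVec p) (matVec (A - S)) + inner ℝ (onesVec p) (matVec (B - S))) : ℝ × ℝ) := by
  rw [trace_mul_eq_inner _ (hB.sub hS), onesForm_eq_inner, ← inner_add_right]
  congr 3
  ext s
  simp only [matVec_apply, Matrix.sub_apply, Matrix.add_apply, Matrix.smul_apply, PiLp.add_apply,
    smul_eq_mul]
  ring

end Halves


/-! ### Transfer from product spaces to the given samples. -/

section SampleLimit

variable {p : ℕ → ℕ}

/-- The pairs `(⟪Z_i - D_i, Z'_i - D'_i⟫, ⟪1, Z_i - D_i⟫ + ⟪1, Z'_i - D'_i⟫)`, where `Z` and `Z'`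
are the centred matrices of the two halves of a sample. -/
noncomputable def perturbedPairs {p N : ℕ} (ν : Measure (Fin p → ℝ))
    (D : (Fin N → Fin p → ℝ) → Fin N → EuclideanSpace ℝ (Fin p × Fin p))
    (ω : (Fin N → Fin p → ℝ) × (Fin N → Fin p → ℝ)) (i : Fin N) : ℝ × ℝ :=
  (inner ℝ (centeredVec ν (ω.1 i) - D ω.1 i) (centeredVec ν (ω.2 i) - D ω.2 i),
    inner ℝ (onesVec p) (centeredVec ν (ω.1 i) - D ω.1 i) +
      inner ℝ (onesVec p) (centeredVec ν (ω.2 i) - D ω.2 i))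

theorem measurable_perturbedPairs {p N : ℕ} (ν : Measure (Fin p → ℝ))
    {D : (Fin N → Fin p → ℝ) → Fin N → EuclideanSpace ℝ (Fin p × Fin p)}
    (hD : ∀ i, Measurable fun x => D x i) : Measurable (perturbedPairs ν D) := by
  refine measurable_pi_iff.2 fun i => ?_
  have h1 : Measurable fun ω : (Fin N → Fin p → ℝ) × (Fin N → Fin p → ℝ) =>
      centeredVec ν (ω.1 i) - D ω.1 i :=
    (measurable_centeredVec.comp ((measurable_pi_apply i).comp measurable_fst)).sub
      ((hD i).comp measurable_fst)
  have h2 : Measurable fun ω : (Fin N → Fin p → ℝ) × (Fin N → Fin p → ℝ) =>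
      centeredVec ν (ω.2 i) - D ω.2 i :=
    (measurable_centeredVec.comp ((measurable_pi_apply i).comp measurable_snd)).sub
      ((hD i).comp measurable_snd)
  exact (h1.inner h2).prodMk ((h1.const_inner (c := onesVec p)).add (h2.const_inner (c := onesVec p)))

theorem R₁_eq_perturbedPairs {n p : ℕ} (ν : Measure (Fin p → ℝ)) (x : Fin n → Fin p → ℝ) :
    R₁ (meanVec ν) (covMat ν) x = perturbedPairs ν (fun _ _ => 0)
      ((fun i : Fin (n / 2) => x (idx₁ i)), (fun i : Fin (n / 2) => x (idx₂ i))) := by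
  funext i
  rw [R₁, pair_eq_inner (outer_isSymm _ _) (covMat_isSymm ν)]
  simp only [perturbedPairs, sub_zero]
  rfl

theorem R₂_eq_perturbedPairs {n p : ℕ} (ν : Measure (Fin p → ℝ)) (x : Fin n → Fin p → ℝ) :
    R₂ (covMat ν) x = perturbedPairs ν (recentering ν)
      ((fun i : Fin (n / 2) => x (idx₁ i)), (fun i : Fin (n / 2) => x (idx₂ i))) := by
  funext i
  rw [R₂, shrink, pair_eq_inner (outer_isSymm _ _) ((covMat_isSymm ν).smul _)]
  simp only [perturbedPairs, recentering, sub_sub_cancel]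
  rfl

/-- The statistic depends on the sample through its two halves only, whose joint law is a product
measure; convergence in distribution depends only on laws. -/
theorem tendstoInDistribution_elRatio_perturbedPairs (hp : ∀ n, 0 < p n)
    {Ω : ℕ → Type*} [∀ n, MeasurableSpace (Ω n)] {P : ∀ n, Measure (Ω n)}
    [∀ n, IsProbabilityMeasure (P n)] {ν : ∀ n, Measure (Fin (p n) → ℝ)}
    {X : ∀ n, Fin n → Ω n → (Fin (p n) → ℝ)} (hind : ∀ n, iIndepFun (X n) (P n))
    (hlaw : ∀ n i, HasLaw (X n i) (ν n) (P n))
    (hL2 : ∀ n a, MemLp (fun x : Fin (p n) → ℝ => x a) 2 (ν n))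
    (htr : 0 < liminf (fun n => ((((prodCovMat (ν n)) ^ 2).trace /
      (p n : ℝ) ^ 2 : ℝ) : EReal)) atTop)
    (hones : 0 < liminf (fun n => ((onesForm (prodCovMat (ν n)) /
      (p n : ℝ) ^ 2 : ℝ) : EReal)) atTop)
    {δ : ℝ} (hδ : 0 < δ)
    (hmom : ∃ C : ℝ, ∀ᶠ n in atTop,
      (∑ a, ∑ b, prodAbsMoment (ν n) (2 + δ) a b) / (p n : ℝ≥0∞) ^ 2 ≤ ENNReal.ofReal C)
    (hrate : (fun n => (p n : ℝ)) =o[atTop]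
      fun n : ℕ => (n : ℝ) ^ ((δ + min 2 δ) / (4 * (2 + δ))))
    {D : ∀ n, (Fin (n / 2) → Fin (p n) → ℝ) → Fin (n / 2) →
      EuclideanSpace ℝ (Fin (p n) × Fin (p n))}
    (hDm : ∀ n i, Measurable fun x => D n x i)
    {Λ : ∀ n, (Fin (n / 2) → Fin (p n) → ℝ) → ℝ} {K : ℝ} (hK : 0 ≤ K)
    (hD : ∀ᶠ n in atTop, IsProbabilityMeasure (ν n) →
      IsSmallPerturbation (ν n) (D n) (Λ n) (K * p n)) :
    TendstoInDistribution
      (fun n ω => negTwoLog (elRatio (perturbedPairs (ν n) (D n)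
        ((fun i => X n (idx₁ i) ω), (fun i => X n (idx₂ i) ω)))))
      atTop (fun t : ℝ => (t : EReal)) P (chiSquared 2) := by
  classical
  have hprob : ∀ᶠ n in atTop, IsProbabilityMeasure (ν n) := by
    filter_upwards [eventually_gt_atTop 0] with n hn
    rw [← (hlaw n ⟨0, hn⟩).map_eq]
    exact Measure.isProbabilityMeasure_map (hlaw n ⟨0, hn⟩).aemeasurable
  -- For n = 0 there are no observations, so `hlaw` says nothing about ν 0. A Dirac mass replaces
  -- any law that is not a probability measure, without affecting large n.
  obtain ⟨ν', hν', he⟩ : ∃ ν' : ∀ n, Measure (Fin (p n) → ℝ),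
      (∀ n, IsProbabilityMeasure (ν' n)) ∧ ∀ᶠ n in atTop, ν' n = ν n := by
    refine ⟨fun n => if IsProbabilityMeasure (ν n) then ν n else Measure.dirac 0, fun n => ?_,
      hprob.mono fun n hn => if_pos hn⟩
    dsimp only
    split_ifs with h
    · exact h
    · infer_instance
  obtain ⟨c₁, hc₁, h₁⟩ := exists_pos_eventually_le_of_liminf_pos htr
  obtain ⟨c₂, hc₂, h₂⟩ := exists_pos_eventually_le_of_liminf_pos hones
  obtain ⟨C, hC⟩ := hmom
  have hlim := tendstoInDistribution_elRatio_centeredVec (ν := ν') (c := min c₁ c₂) (δ := δ) (C := C)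
    (D := D) (Λ := Λ) (K := K) hp
    (he.mono fun n e => by rw [e]; exact hL2 n) (lt_min hc₁ hc₂) hδ
    (by filter_upwards [he, h₁] with n e h; rw [e]; exact (min_le_left _ _).trans h)
    (by filter_upwards [he, h₂] with n e h; rw [e]; exact (min_le_right _ _).trans h)
    (by filter_upwards [he, hC] with n e h; rw [e]; exact h) hrate hDm hK
    (by filter_upwards [he, hprob, hD] with n e h1 h2; rw [e]; exact h2 h1)
  have hF : ∀ n, Measurable fun ω => negTwoLog (elRatio (perturbedPairs (ν n) (D n) ω)) := fun n =>
    measurable_negTwoLog.comp (measurable_elRatio.comp (measurable_perturbedPairs (ν n) (hDm n)))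
  refine tendstoInDistribution_of_map_eq hlim
    (fun n => (hF n).comp_aemeasurable (aemeasurable_halves (hlaw n)))
    measurable_coe_real_ereal.aemeasurable ?_ rfl
  filter_upwards [he, hprob] with n e h
  rw [e, ← map_halves_eq (hind n) (hlaw n)]
  exact (AEMeasurable.map_map_of_aemeasurable
    (hF n).aemeasurable (aemeasurable_halves (hlaw n))).symm

end SampleLimit

end CovTest

theorem mainTheorem2
    -- dimension, sample space and common law of the observations at sample size `n`
    (p : ℕ → ℕ) (hp : ∀ n, 0 < p n)
    {Ω : ℕ → Type*} [∀ n, MeasurableSpace (Ω n)]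
    (P : ∀ n, Measure (Ω n)) [∀ n, IsProbabilityMeasure (P n)]
    (ν : ∀ n, Measure (Fin (p n) → ℝ))
    (X : ∀ n, Fin n → Ω n → (Fin (p n) → ℝ))
    -- the observations `X n 0, …, X n (n - 1)` are i.i.d. with law `ν n`
    (hind : ∀ n, iIndepFun (X n) (P n))
    (hlaw : ∀ n i, HasLaw (X n i) (ν n) (P n))
    (hL2 : ∀ n a, MemLp (fun x : Fin (p n) → ℝ => x a) 2 (ν n))
    -- the null hypothesis
    (S₀ : ∀ n, Matrix (Fin (p n)) (Fin (p n)) ℝ)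
    (hH0 : ∀ n, CovTest.covMat (ν n) = S₀ n)
    -- A1
    (hA1_trace : 0 < liminf (fun n => ((((CovTest.prodCovMat (ν n)) ^ 2).trace /
      (p n : ℝ) ^ 2 : ℝ) : EReal)) atTop)
    (hA1_ones : 0 < liminf (fun n => ((CovTest.onesForm (CovTest.prodCovMat (ν n)) /
      (p n : ℝ) ^ 2 : ℝ) : EReal)) atTop)
    -- A2
    (δ : ℝ) (hδ : 0 < δ)
    (hA2 : ∃ C : ℝ, ∀ᶠ n in atTop,
      (∑ a, ∑ b, CovTest.prodAbsMoment (ν n) (2 + δ) a b) / (p n : ℝ≥0∞) ^ 2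
        ≤ ENNReal.ofReal C)
    -- A3
    (hA3 : (fun n => (p n : ℝ)) =o[atTop]
      fun n : ℕ => (n : ℝ) ^ ((δ + min 2 δ) / (4 * (2 + δ)))) :
    TendstoInDistribution
      (fun n ω => CovTest.negTwoLog
        (CovTest.L₁ (CovTest.meanVec (ν n)) (S₀ n) (fun i => X n i ω)))
      atTop (fun t : ℝ => (t : EReal)) P (CovTest.chiSquared 2) ∧
    ((∃ C₀ : ℝ, 0 < C₀ ∧ ∀ n a, S₀ n a a < C₀) →
      TendstoInDistribution
        (fun n ω => CovTest.negTwoLog (CovTest.L₂ (S₀ n) (fun i => X n i ω)))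
        atTop (fun t : ℝ => (t : EReal)) P (CovTest.chiSquared 2)) := by
  obtain rfl : (fun n => CovTest.covMat (ν n)) = S₀ := funext hH0
  refine ⟨?_, fun ⟨C₀, hC₀, hσ⟩ => ?_⟩
  · simp only [CovTest.L₁, CovTest.R₁_eq_perturbedPairs]
    refine CovTest.tendstoInDistribution_elRatio_perturbedPairs hp hind hlaw hL2 hA1_trace hA1_ones
      hδ hA2 hA3 (D := fun n _ _ => 0) (Λ := fun n _ => 0) (fun n i => measurable_const) le_rfl
      (Eventually.of_forall fun n _ => ?_)
    exact ⟨fun i => measurable_const, measurable_const, by simp, by simp, by simp, by simp⟩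
  · simp only [CovTest.L₂, CovTest.R₂_eq_perturbedPairs]
    refine CovTest.tendstoInDistribution_elRatio_perturbedPairs hp hind hlaw hL2 hA1_trace hA1_ones
      hδ hA2 hA3 (fun n i => CovTest.measurable_recentering (ν n) i)
      (K := 12 * C₀) (Λ := fun n => CovTest.recenteringBound (ν n)) (by positivity) ?_
    -- From n = 2 on, each half is nonempty.
    filter_upwards [eventually_ge_atTop 2] with n hn _
    exact CovTest.isSmallPerturbation_recentering (by omega) (hL2 n) hC₀.le fun a => (hσ n a).le
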